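/- **Setting.** Let $\mathbb R^d$ be divided by finitely many distinct hyperplanes $\mathcal H_1,\dots,\mathcal H_q$ which form at most two families of parallel hyperplanes, hyperplanes of different families being perpendicular. Let $\Gamma=\bigcup_j\mathcal H_j$ and let the cells $\Omega_1,\dots,\Omega_m$ be pairwise disjoint with **(H1)** $\mathbb R^d=\Gamma\cup\bigcup_i\Omega_i$, $\ \Gamma\cap\Omega_i=\emptyset$, $\ \Omega_i$ open and connected. The set $\Gamma$ is the disjoint union of the relatively open faces $\Gamma_k$ of the hyperplane arrangement that it contains. The subdomains $\mathcal M_k$ are the cells $\Omega_i$ and the faces $\Gamma_k$. Let $\mathscr A\subset\mathbb R^n$ be compact, let $f:\mathbb R^d\times\mathscr A\to\mathbb R^d$ and $\ell:\mathbb R^d\times\mathscr A\to\mathbb R$ be Borel measurable, and put $F(x)=f(x,\mathscr A)$, $L(x)=\ell(x,\mathscr A)$. Assume: **(HF)** $F$ is upper semicontinuous with nonempty compact values; on each $\Omega_i$ it is locally Lipschitz for the Hausdorff distance up to $\overline{\Omega}_i$ (each point of $\overline\Omega_i$ has a neighbourhood $U$ such that $F$ is Lipschitz on $U\cap\Omega_i$);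 on each $\Gamma_k$ it has an extension by continuity to $\overline{\Gamma}_k$ with nonempty compact values; and there is $c_f>0$ with $|p|\le c_f(1+|x|)$ for all $p\in F(x)$. **(HL)** $L$ is upper semicontinuous with nonempty compact values; on each $\Omega_i$ it is locally Lipschitz for the Hausdorff distance up to $\overline\Omega_i$; and there are $c_l>0$, $\lambda_l\ge1$ with $0\le c\le c_l(1+|x|^{\lambda_l})$ for all $c\in L(x)$. **(HG)** The augmented dynamics $G(x)=\{(f(x,a),-\ell(x,a)-r): a\in\mathscr A,\ 0\le r\le c_l(1+|x|^{\lambda_l})-\ell(x,a)\}$ is upper semicontinuous with convex compact values. For $x\in\overline{\mathcal M}_k$ let $F^{\rm ext}_k$ be the extension by continuity of $F|_{\mathcal M_k}$ to $\overline{\mathcal M}_k$, and let $F^E_{\mathcal M_k}(x)=F_k^{\rm ext}(x)\cap\mathcal T_{\overline{\mathcal M}_k}(x)$, where $\mathcal T_C(x)=\{v:\liminf_{t\to0^+}d(x+tv,C)/t=0\}$. Let $A^E(x)$ be the set of $a\in\mathscr A$ such that $f(x,a)\in F^E_{\mathcal M_k}(x)$ for some $k$ with $x\in\overline{\mathcal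 M}_k$. Put $$H_F(x,p)=\sup_{a\in\mathscr A}\{-p\cdot f(x,a)-\ell(x,a)\},\qquad H^E(x,p)=\sup_{a\in A^E(x)}\{-p\cdot f(x,a)-\ell(x,a)\}.$$ Let $T>0$ and let $u:(0,T]\times\mathbb R^d\to\mathbb R$ be lower semicontinuous. For $H\in\{H^E,H_F\}$, $u$ is a supersolution for $H$ if for all $(t_0,x_0)\in(0,T)\times\mathbb R^d$ and all $\phi\in C^1((0,T)\times\mathbb R^d)$ such that $u-\phi$ has a local minimum at $(t_0,x_0)$ one has $-\phi_t(t_0,x_0)+H(x_0,D\phi(t_0,x_0))\ge0$. We say that $u$ satisfies super-optimality at $(t,x)$ if there are a control $\alpha\in L^\infty(0,T;\mathscr A)$ and an absolutely continuous $y$ with $\dot y(s)=f(y(s),\alpha(s))$ for a.e. $s\in(t,T)$, $y(t)=x$, and $$u(t,x)\ \ge\ u(t+h,y(t+h))+\int_t^{t+h}\ell(y(s),\alpha(s))\,ds\qquad\text{for all }h\in[0,T-t].$$ **Theorem.** Without any controllability assumption, the following are equivalent: (i) $u$ satisfies super-optimality at every $(t,x)\in(0,T]\times\mathbb R^d$;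 (ii) $u$ is a supersolution for the essential Hamiltonian $H^E$; (iii) $u$ is a supersolution for $H_F$. If moreover $u$ is also given at $t=0$, with $u(0,x)\ge\liminf_{(s,y)\to(0,x),\,s>0}u(s,y)$ for all $x$, then (i) may be replaced by super-optimality at every $(t,x)\in[0,T]\times\mathbb R^d$. -/

import Mathlib

open Set Filter Topology MeasureTheory

noncomputable section

/-- The Euclidean space `ℝ^d`. -/
abbrev Vec (d : ℕ) := EuclideanSpace ℝ (Fin d)

/-! ### The multi-domain -/

/-- The data of a multi-domain: `q` hyperplanes `{x | ⟪normal j, x⟫ = offset j}` and `m` cells. -/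
structure MultiDomain (d : ℕ) where
  q : ℕ
  m : ℕ
  normal : Fin q → Vec d
  offset : Fin q → ℝ
  cell : Fin m → Set (Vec d)

namespace MultiDomain

variable {d : ℕ} (P : MultiDomain d)

/-- The `j`-th separating hyperplane. -/
def hyperplane (j : Fin P.q) : Set (Vec d) :=
  {x | inner ℝ (P.normal j) x = P.offset j}

/-- The union of all the hyperplanes. -/
def interface : Set (Vec d) := ⋃ j, P.hyperplane j

/-- The relatively open face through `z` of the hyperplane arrangement: the points lying, with
respect to every hyperplane, on the same side as `z` (on it, if `z` is on it). -/
def face (z : Vec d) : Set (Vec d) :=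
  {x | ∀ j, SignType.sign (inner ℝ (P.normal j) x - P.offset j)
    = SignType.sign (inner ℝ (P.normal j) z - P.offset j)}

/-- `M` is one of the pairwise disjoint pieces into which the interface is divided. -/
def IsInterfacePiece (M : Set (Vec d)) : Prop := ∃ z ∈ P.interface, M = P.face z

/-- `M` is one of the subdomains: a cell or a piece of the interface. -/
def IsSubdomain (M : Set (Vec d)) : Prop := (∃ i, M = P.cell i) ∨ P.IsInterfacePiece M

/-- Standing assumptions on the multi-domain. The hyperplanes are distinct, form (at most) two
families of parallel hyperplanes, and hyperplanes of different families are perpendicular;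
the cells are disjoint, open, connected, do not meet the interface and fill its complement. -/
structure H1 : Prop where
  unit_normal : ∀ j, ‖P.normal j‖ = 1
  hyperplane_injective : Function.Injective P.hyperplane
  parallel_or_perp : ∀ i j,
    (P.normal i = P.normal j ∨ P.normal i = -P.normal j) ∨ inner ℝ (P.normal i) (P.normal j) = 0
  two_families : ∃ fam : Fin P.q → Bool, ∀ i j, fam i = fam j →
    (P.normal i = P.normal j ∨ P.normal i = -P.normal j)
  cover : P.interface ∪ (⋃ i, P.cell i) = univ
  interface_inter_cell : ∀ i, P.interface ∩ P.cell i = ∅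
  cell_isOpen : ∀ i, IsOpen (P.cell i)
  cell_isConnected : ∀ i, IsConnected (P.cell i)
  cell_disjoint : Pairwise fun i j => Disjoint (P.cell i) (P.cell j)

end MultiDomain

/-! ### Multifunctions -/

/-- On `M`, the multifunction `Φ` is locally Lipschitz for the Hausdorff distance, up to the
closure of `M`: every point of the closure has a neighbourhood `U` on which there is a Lipschitz
constant valid on `U ∩ M`. -/
def LocallyLipschitzUpTo {d : ℕ} {E : Type*} [PseudoMetricSpace E]
    (Φ : Vec d → Set E) (M : Set (Vec d)) : Prop :=
  ∀ x ∈ closure M, ∃ K : ℝ, ∃ U ∈ 𝓝 x, ∀ y ∈ U ∩ M, ∀ z ∈ U ∩ M,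
    Metric.hausdorffDist (Φ y) (Φ z) ≤ K * dist y z

/-- The restriction of `Φ` to `M` has an extension by continuity, with nonempty compact values and
for the Hausdorff distance, to the closure of `M`. -/
def ExtendsByContinuity {d : ℕ} {E : Type*} [PseudoMetricSpace E]
    (Φ : Vec d → Set E) (M : Set (Vec d)) : Prop :=
  ∀ x ∈ closure M, ∃ C : Set E, C.Nonempty ∧ IsCompact C ∧
    Tendsto (fun y => Metric.hausdorffDist (Φ y) C) (𝓝[M] x) (𝓝 0)

/-- The value at `x` of the extension by continuity of `Φ` restricted to `M`: the limits of
`v n ∈ Φ (z n)` with `z n ∈ M`, `z n → x`. When the Hausdorff limit of `Φ z` as `z → x` in `M`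
exists among nonempty compact sets, this set is that limit. -/
def contExt {d : ℕ} {E : Type*} [TopologicalSpace E]
    (Φ : Vec d → Set E) (M : Set (Vec d)) (x : Vec d) : Set E :=
  {p | ∃ (z : ℕ → Vec d) (v : ℕ → E), (∀ n, z n ∈ M) ∧ (∀ n, v n ∈ Φ (z n)) ∧
    Tendsto z atTop (𝓝 x) ∧ Tendsto v atTop (𝓝 p)}

/-- The tangent cone to `C` at `x`. -/
def tangentConeOf {d : ℕ} (C : Set (Vec d)) (x : Vec d) : Set (Vec d) :=
  {v | liminf (fun t : ℝ => Metric.infDist (x + t • v) C / t) (𝓝[>] 0) = 0}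

/-! ### The control problem -/

/-- The data of a control problem: the set of control values, the dynamics, the running cost. -/
structure ControlProblem (d n : ℕ) where
  A : Set (Vec n)
  f : Vec d → Vec n → Vec d
  ℓ : Vec d → Vec n → ℝ

namespace ControlProblem

variable {d n : ℕ} (S : ControlProblem d n)

/-- The set of velocities. -/
def F (x : Vec d) : Set (Vec d) := S.f x '' S.A

/-- The set of running costs. -/
def L (x : Vec d) : Set ℝ := S.ℓ x '' S.A

/-- The augmented dynamics, `cl` and `lam` being the constants in the growth bound of the cost. -/
def G (cl lam : ℝ) (x : Vec d) : Set (Vec d × ℝ) :=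
  {w | ∃ a ∈ S.A, ∃ r : ℝ, 0 ≤ r ∧ r ≤ cl * (1 + ‖x‖ ^ lam) - S.ℓ x a ∧
    w = (S.f x a, -S.ℓ x a - r)}

/-- The control set is compact, and the dynamics and the cost are Borel measurable. -/
structure Regular : Prop where
  isCompact_A : IsCompact S.A
  measurable_f : Measurable fun z : Vec d × S.A => S.f z.1 z.2
  measurable_ℓ : Measurable fun z : Vec d × S.A => S.ℓ z.1 z.2

/-- Assumptions on the velocities. The field `extends_interface` says that the extension by continuity which
enters the essential dynamics makes sense on the pieces of the interface too. -/
structure HF (P : MultiDomain d) : Prop where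
  nonempty : ∀ x, (S.F x).Nonempty
  isCompact : ∀ x, IsCompact (S.F x)
  usc : UpperHemicontinuous S.F
  lipschitz : ∀ i, LocallyLipschitzUpTo S.F (P.cell i)
  extends_interface : ∀ M, P.IsInterfacePiece M → ExtendsByContinuity S.F M
  growth : ∃ cf : ℝ, 0 < cf ∧ ∀ x, ∀ p ∈ S.F x, ‖p‖ ≤ cf * (1 + ‖x‖)

/-- Assumptions on the running cost. -/
structure HL (P : MultiDomain d) (cl lam : ℝ) : Prop where
  nonempty : ∀ x, (S.L x).Nonempty
  isCompact : ∀ x, IsCompact (S.L x)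
  usc : UpperHemicontinuous S.L
  lipschitz : ∀ i, LocallyLipschitzUpTo S.L (P.cell i)
  cl_pos : 0 < cl
  one_le_lam : 1 ≤ lam
  growth : ∀ x, ∀ c ∈ S.L x, 0 ≤ c ∧ c ≤ cl * (1 + ‖x‖ ^ lam)

/-- Assumptions on the augmented dynamics: it is upper semicontinuous with convex compact
values. -/
structure HG (cl lam : ℝ) : Prop where
  convex : ∀ x, Convex ℝ (S.G cl lam x)
  isCompact : ∀ x, IsCompact (S.G cl lam x)
  usc : UpperHemicontinuous (S.G cl lam)

/-- The essential velocities at `x` relative to the subdomain `M`. -/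
def FE (M : Set (Vec d)) (x : Vec d) : Set (Vec d) :=
  contExt S.F M x ∩ tangentConeOf (closure M) x

/-- The controls at `x` whose velocity is essential relative to some subdomain having `x` in its
closure. -/
def AE (P : MultiDomain d) (x : Vec d) : Set (Vec n) :=
  {a | a ∈ S.A ∧ ∃ M, P.IsSubdomain M ∧ x ∈ closure M ∧ S.f x a ∈ S.FE M x}

/-- The supremum of `-p · f(x,a) - ℓ(x,a)` over the controls `a ∈ B`, in the extended reals. -/
def hamiltonian (B : Set (Vec n)) (x p : Vec d) : EReal :=
  ⨆ a ∈ B, ((-inner ℝ p (S.f x a) - S.ℓ x a : ℝ) : EReal)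

/-- The Hamiltonian over all controls. -/
def HamF (x p : Vec d) : EReal := S.hamiltonian S.A x p

/-- The essential Hamiltonian. -/
def HamE (P : MultiDomain d) (x p : Vec d) : EReal := S.hamiltonian (S.AE P x) x p

/-- `α` is a control on `(0,T)`: (a representative of) an element of `L^∞(0,T;A)`. -/
def IsControl (T : ℝ) (α : ℝ → Vec n) : Prop :=
  AEMeasurable α (volume.restrict (Ioo 0 T)) ∧ ∀ᵐ s ∂(volume.restrict (Ioo 0 T)), α s ∈ S.A

/-- `(y, α)` is a trajectory-control pair on `[t,T]` starting from `x`: `y` is the absolutely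
continuous solution of `y' = f(y,α)` a.e. on `(t,T)`, `y(t) = x`, written in integral form. -/
def IsTrajectory (T t : ℝ) (x : Vec d) (y : ℝ → Vec d) (α : ℝ → Vec n) : Prop :=
  S.IsControl T α ∧ IntervalIntegrable (fun s => S.f (y s) (α s)) volume t T ∧
    ∀ s ∈ Icc t T, y s = x + ∫ r in t..s, S.f (y r) (α r)

/-- The super-optimality principle for `u` on `[0,T] × ℝ^d`, for the starting times in `I`. -/
def SuperOptimal (T : ℝ) (I : Set ℝ) (u : ℝ → Vec d → ℝ) : Prop :=
  ∀ t ∈ I, ∀ x : Vec d, ∃ (y : ℝ → Vec d) (α : ℝ → Vec n),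
    S.IsTrajectory T t x y α ∧
    IntervalIntegrable (fun s => S.ℓ (y s) (α s)) volume t T ∧
    ∀ h ∈ Icc 0 (T - t),
      u t x ≥ u (t + h) (y (t + h)) + ∫ s in t..(t + h), S.ℓ (y s) (α s)

end ControlProblem

/-- `u` is a viscosity supersolution of `-∂ₜu + H(x, Du) = 0` on `(0,T) × ℝ^d`. -/
def IsSupersolution {d : ℕ} (T : ℝ) (H : Vec d → Vec d → EReal) (u : ℝ → Vec d → ℝ) : Prop :=
  LowerSemicontinuousOn (fun z : ℝ × Vec d => u z.1 z.2) (Ioc 0 T ×ˢ univ) ∧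
  ∀ t₀ ∈ Ioo 0 T, ∀ x₀ : Vec d, ∀ φ : ℝ × Vec d → ℝ,
    ContDiffOn ℝ 1 φ (Ioo 0 T ×ˢ univ) →
    IsLocalMin (fun z : ℝ × Vec d => u z.1 z.2 - φ z) (t₀, x₀) →
    0 ≤ ((-deriv (fun t => φ (t, x₀)) t₀ : ℝ) : EReal) + H x₀ (gradient (fun x => φ (t₀, x)) x₀)

/-- At the initial time `u` is not below its values at positive times:
`u(0,x) ≥ liminf u(s,y)` as `(s,y) → (0,x)` with `0 < s`. -/
def InitialTimeRegular {d : ℕ} (u : ℝ → Vec d → ℝ) : Prop :=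
  ∀ x : Vec d, ∀ ε > 0, ∃ᶠ z : ℝ × Vec d in 𝓝[Ioi 0 ×ˢ univ] (0, x), u z.1 z.2 < u 0 x + ε

end

/-! Since essential controls are controls, `HamE ≤ HamF`, so (ii) gives (iii). It remains to prove
(iii) ⇒ (i) and (i) ⇒ (ii).

(iii) ⇒ (i) does not see the hyperplanes. Take an inf-convolution of `u` with a quadratic penalty.
At a minimiser `z` the penalty provides a test function, and the supersolution inequality yields a
control `α` such that a step with velocity `S.f z α` lowers the inf-convolution by the cost of the
step, up to a small error (`exists_infConv_step`). Iteration gives Euler polygons along which `u`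
plus cost almost decreases. Their limit solves the differential inclusion for `G`, because `G` is
upper semicontinuous with convex compact values (`exists_limit_trajectory`), and a measurable
selection turns it into a controlled trajectory.

(i) ⇒ (ii): suppose the inequality fails at `(t₀, x₀)` for `φ`, with `τ = φ_t` and `q = Dφ`. Then `τ
+ q · f + ℓ > 0` on the essential controls. Near `x₀` the subdomains are the sign patterns `σ` of at
most two orthogonal coordinates. For each `σ`, Hahn-Banach gives a linear form `k σ` of the normal
velocity, nonnegative on the orthant of `σ`, that stays below `τ + q · f + ℓ` by a margin, for all
controls and on the whole open star of `σ` (`exists_linear_minorant`); upper semicontinuity of `F`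
carries the estimate from the subdomain to its star. Integrated along an optimal trajectory, these
forms bound the increments of the normal coordinates by those of a function `Ψ` which is negative at
positive times, as `u - φ` has a local minimum. A planar argument
(`sign_pattern_increments_contradiction`) excludes such a curve, however often it crosses the
hyperplanes. -/

/-! ### Measurable selection via analytic sets. -/

/-- The finite-level box: sequences bounded by `b` in the first `k` coordinates. -/
def partialBox (b : ℕ → ℕ) (k : ℕ) : Set (ℕ → ℕ) := {σ | ∀ i < k, σ i ≤ b i}

lemma isCompact_setOf_forall_le (b : ℕ → ℕ) : IsCompact {σ : ℕ → ℕ | ∀ i, σ i ≤ b i} := by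
  have h : {σ : ℕ → ℕ | ∀ i, σ i ≤ b i} = Set.pi univ fun i => Iic (b i) := by
    ext; simp [Pi.le_def]
  rw [h]
  exact isCompact_univ_pi fun i => (finite_Iic (b i)).isCompact

lemma partialBox_antitone (b : ℕ → ℕ) : Antitone (partialBox b) :=
  fun _ _ hkl _ hσ i hi => hσ i (hi.trans_le hkl)

lemma isOpen_setOf_forall_lt_eq (τ : ℕ → ℕ) (k : ℕ) : IsOpen {σ : ℕ → ℕ | ∀ i < k, σ i = τ i} := by
  have h : {σ : ℕ → ℕ | ∀ i < k, σ i = τ i} = ⋂ i ∈ Finset.range k, (fun σ : ℕ → ℕ => σ i) ⁻¹' {τ i} := by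
    ext; simp
  rw [h]
  exact isOpen_biInter_finset fun i _ => (isOpen_discrete _).preimage (continuous_apply i)

lemma exists_prefix_subset_of_mem_isOpen {U : Set (ℕ → ℕ)} (hU : IsOpen U) {τ : ℕ → ℕ} (hτ : τ ∈ U) :
    ∃ k, {σ : ℕ → ℕ | ∀ i < k, σ i = τ i} ⊆ U := by
  by_contra! h
  simp only [not_subset] at h
  choose σ hσ hσU using h
  have : Tendsto σ atTop (𝓝 τ) := by
    rw [tendsto_pi_nhds]
    intro i
    refine tendsto_const_nhds.congr' ?_
    filter_upwards [eventually_gt_atTop i] with k hk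
    exact (hσ k i hk).symm
  obtain ⟨k, hk⟩ := (this.eventually (hU.mem_nhds hτ)).exists
  exact hσU k hk

/-- Points of `partialBox b k` outside `U`, truncated by `b`, accumulate at a point of the full box,
and truncation does not alter the first `k` coordinates. -/
lemma exists_partialBox_subset {U : Set (ℕ → ℕ)} (hU : IsOpen U) {b : ℕ → ℕ}
    (hb : {σ : ℕ → ℕ | ∀ i, σ i ≤ b i} ⊆ U) : ∃ k, partialBox b k ⊆ U := by
  by_contra! h
  simp only [not_subset] at h
  choose σ hσ hσU using h
  let τ : ℕ → ℕ → ℕ := fun k i => min (σ k i) (b i)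
  obtain ⟨ρ, hρ, φ, hφ, hlim⟩ := (isCompact_setOf_forall_le b).tendsto_subseq (x := τ)
    (fun k i => min_le_right _ _)
  obtain ⟨m, hm⟩ := exists_prefix_subset_of_mem_isOpen hU (hb hρ)
  have h1 := hlim.eventually ((isOpen_setOf_forall_lt_eq ρ m).mem_nhds (fun _ _ => rfl))
  obtain ⟨k, hk, hkm⟩ := (h1.and (eventually_ge_atTop m)).exists
  refine hσU (φ k) (hm fun i hi => ?_)
  rw [← hk i hi]
  exact (min_eq_left (hσ (φ k) i (hi.trans_le (hkm.trans (hφ.id_le k))))).symm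

section
variable {Y : Type*} [TopologicalSpace Y] [T2Space Y] [MeasurableSpace Y]
  [BorelSpace Y] (μ : Measure Y) [IsFiniteMeasure μ] {h : (ℕ → ℕ) → Y}

/-- Capacitability: the bounds are chosen one coordinate at a time, each losing measure at most `ε'
k`, and compactness of the full box allows the passage to the limit. -/
lemma exists_compact_image_measure_ge (hh : Continuous h) {ε : ENNReal} (hε : ε ≠ 0) :
    ∃ b : ℕ → ℕ, μ (range h) ≤ μ (h '' {σ | ∀ i, σ i ≤ b i}) + ε := by
  obtain ⟨ε', hε', hsum⟩ := ENNReal.exists_pos_sum_of_countable hε ℕ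
  have step : ∀ (k : ℕ) (b : ℕ → ℕ), ∃ m : ℕ, μ (h '' partialBox b k) ≤
      μ (h '' partialBox (Function.update b k m) (k + 1)) + ε' k := by
    intro k b
    have hU : h '' partialBox b k = ⋃ m, h '' partialBox (Function.update b k m) (k + 1) := by
      rw [← image_iUnion]
      congr 1
      ext σ
      simp only [partialBox, mem_iUnion, mem_ofPred_eq]
      constructor
      · intro hσ
        refine ⟨σ k, fun i hi => ?_⟩
        rcases eq_or_ne i k with rfl | hik
        · simp
        · rw [Function.update_of_ne hik]; exact hσ i (by omega)
      · rintro ⟨m, hm⟩ i hi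
        have := hm i (by omega)
        rwa [Function.update_of_ne (by omega)] at this
    have hmono : Monotone fun m => h '' partialBox (Function.update b k m) (k + 1) := by
      intro m m' hmm
      refine image_mono fun σ hσ i hi => (hσ i hi).trans ?_
      rcases eq_or_ne i k with rfl | hik
      · simpa using hmm
      · simp [Function.update_of_ne hik]
    rw [hU, hmono.measure_iUnion]
    have hfin : (⨆ m, μ (h '' partialBox (Function.update b k m) (k + 1))) ≠ ⊤ := by
      rw [← hmono.measure_iUnion]; exact measure_ne_top _ _
    rcases eq_or_ne (⨆ m, μ (h '' partialBox (Function.update b k m) (k + 1))) 0 with h0 | h0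
    · exact ⟨0, by rw [h0]; exact zero_le⟩
    have hlt := ENNReal.sub_lt_self hfin h0 (ENNReal.coe_ne_zero.2 (hε' k).ne')
    obtain ⟨m, hm⟩ := lt_iSup_iff.1 hlt
    exact ⟨m, tsub_le_iff_right.1 hm.le⟩
  choose g hg using step
  let B : ℕ → ℕ → ℕ := fun k => Nat.rec (fun _ => 0) (fun k b => Function.update b k (g k b)) k
  have hB : ∀ k, B (k + 1) = Function.update (B k) k (g k (B k)) := fun k => rfl
  let b : ℕ → ℕ := fun i => B (i + 1) i
  have hBb : ∀ k i, i < k → B k i = b i := by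
    intro k
    induction k with
    | zero => intro i hi; omega
    | succ k ih =>
      intro i hi
      rcases eq_or_ne i k with rfl | hik
      · rfl
      · rw [hB, Function.update_of_ne hik]; exact ih i (by omega)
  have hbox : ∀ k, partialBox (B k) k = partialBox b k := by
    intro k; ext σ
    refine forall₂_congr fun i hi => ?_
    rw [hBb k i hi]
  have hk : ∀ k, μ (range h) ≤ μ (h '' partialBox b k) + ∑ i ∈ Finset.range k, (ε' i : ENNReal) := by
    intro k
    induction k with
    | zero => simp [partialBox]
    | succ k ih =>
      have := hg k (B k)
      rw [hbox, ← hB, hbox (k + 1)] at this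
      rw [Finset.sum_range_succ, add_comm (∑ i ∈ Finset.range k, (ε' i : ENNReal)), ← add_assoc]
      exact ih.trans (by gcongr)
  have hk' : ∀ k, μ (range h) - ε ≤ μ (closure (h '' partialBox b k)) := by
    intro k
    refine tsub_le_iff_right.2 ((hk k).trans ?_)
    gcongr
    · exact subset_closure
    · exact (ENNReal.sum_le_tsum _).trans hsum.le
  -- A point off the compact image is separated from it by open sets, and the image of some
  -- finite-level box already lies on the side of the compact set.
  have hint : (⋂ k, closure (h '' partialBox b k)) ⊆ h '' {σ | ∀ i, σ i ≤ b i} := by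
    intro y hy
    by_contra hyK
    have hKc : IsCompact (h '' {σ | ∀ i, σ i ≤ b i}) := (isCompact_setOf_forall_le b).image hh
    obtain ⟨V, W, hV, hW, hKV, hyW, hVW⟩ := SeparatedNhds.of_isCompact_isCompact hKc
      (isCompact_singleton (x := y)) (disjoint_singleton_right.2 hyK)
    obtain ⟨k, hk⟩ := exists_partialBox_subset (hV.preimage hh) (image_subset_iff.1 hKV)
    have := mem_iInter.1 hy k
    obtain ⟨z, hzW, hz⟩ := mem_closure_iff.1 this W hW (hyW rfl)
    exact disjoint_left.1 hVW (image_subset_iff.2 hk hz) hzW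
  refine ⟨b, tsub_le_iff_right.1 (le_trans ?_ (measure_mono hint))⟩
  have hanti : Antitone fun k => closure (h '' partialBox b k) :=
    fun k l hkl => closure_mono (image_mono (partialBox_antitone b hkl))
  rw [hanti.measure_iInter (fun k => isClosed_closure.measurableSet.nullMeasurableSet)
    ⟨0, measure_ne_top _ _⟩]
  exact le_iInf hk'

lemma nullMeasurableSet_range_of_continuous (hh : Continuous h) : NullMeasurableSet (range h) μ := by
  have : ∀ n : ℕ, ∃ b : ℕ → ℕ, μ (range h) ≤ μ (h '' {σ | ∀ i, σ i ≤ b i}) + (n + 1 : ENNReal)⁻¹ :=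
    fun n => exists_compact_image_measure_ge μ hh (by simp)
  choose b hb using this
  let K : Set Y := ⋃ n, h '' {σ | ∀ i, σ i ≤ b n i}
  have hK : MeasurableSet K := MeasurableSet.iUnion fun n =>
    ((isCompact_setOf_forall_le (b n)).image hh).isClosed.measurableSet
  have hKr : K ⊆ range h := iUnion_subset fun n => image_subset_range _ _
  have hle : μ (range h) ≤ μ K := by
    have hlim : Tendsto (fun n : ℕ => μ K + (n + 1 : ENNReal)⁻¹) atTop (𝓝 (μ K + 0)) := by
      refine tendsto_const_nhds.add ?_
      have := (tendsto_add_atTop_iff_nat 1).2 ENNReal.tendsto_inv_nat_nhds_zero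
      simpa using this
    rw [add_zero] at hlim
    refine ge_of_tendsto' hlim fun n => (hb n).trans ?_
    gcongr
    exact subset_iUnion (fun n => h '' {σ | ∀ i, σ i ≤ b n i}) n
  have : K =ᵐ[μ] range h :=
    ae_eq_of_subset_of_measure_ge hKr hle hK.nullMeasurableSet (measure_ne_top _ _)
  exact hK.nullMeasurableSet.congr this

/-- Analytic sets are measurable with respect to the completion of every finite measure. -/
lemma MeasureTheory.AnalyticSet.nullMeasurableSet {s : Set Y} (hs : AnalyticSet s) :
    NullMeasurableSet s μ := by
  rw [AnalyticSet] at hs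
  rcases hs with rfl | ⟨h, hh, rfl⟩
  · exact nullMeasurableSet_empty
  · exact nullMeasurableSet_range_of_continuous μ hh


/-- The lexicographically least element of the fiber of `h` over `y`, when that fiber is closed and
nonempty. -/
noncomputable def leftmostBranch {Y : Type*} (h : (ℕ → ℕ) → Y) (y : Y) (k : ℕ) : ℕ :=
  sInf {n | ∃ τ, h τ = y ∧ (∀ i : Fin k, τ i = leftmostBranch h y i) ∧ τ k = n}
termination_by k
decreasing_by exact i.2

lemma exists_fiber_eq_leftmostBranch {Y : Type*} {h : (ℕ → ℕ) → Y} {y : Y} (hy : y ∈ range h) (k : ℕ) :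
    ∃ τ, h τ = y ∧ ∀ i < k, τ i = leftmostBranch h y i := by
  induction k with
  | zero => obtain ⟨τ, rfl⟩ := hy; exact ⟨τ, rfl, by simp⟩
  | succ k ih =>
    obtain ⟨τ, hτ, hτk⟩ := ih
    have hne : {n | ∃ τ, h τ = y ∧ (∀ i : Fin k, τ i = leftmostBranch h y i) ∧ τ k = n}.Nonempty :=
      ⟨τ k, τ, hτ, fun i => hτk i i.2, rfl⟩
    obtain ⟨ρ, hρ, hρk, hρ'⟩ := Nat.sInf_mem hne
    refine ⟨ρ, hρ, fun i hi => ?_⟩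
    rcases Nat.lt_succ_iff_lt_or_eq.1 hi with hi | rfl
    · exact hρk ⟨i, hi⟩
    · rw [hρ', leftmostBranch]

lemma apply_leftmostBranch {Y : Type*} [TopologicalSpace Y] [T2Space Y] {h : (ℕ → ℕ) → Y}
    (hh : Continuous h) {y : Y} (hy : y ∈ range h) :
    h (leftmostBranch h y) = y := by
  choose τ hτ hτk using fun k => exists_fiber_eq_leftmostBranch hy k
  have : Tendsto τ atTop (𝓝 (leftmostBranch h y)) := by
    rw [tendsto_pi_nhds]
    intro i
    refine tendsto_const_nhds.congr' ?_
    filter_upwards [eventually_gt_atTop i] with k hk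
    exact (hτk k i hk).symm
  have h2 := (hh.tendsto _).comp this
  refine tendsto_nhds_unique h2 ?_
  simp [Function.comp_def, hτ]

lemma nullMeasurableSet_setOf_sInf_eq {Y : Type*} [MeasurableSpace Y] {μ : Measure Y} {N : Y → Set ℕ}
    (hN : ∀ n, NullMeasurableSet {y | n ∈ N y} μ) (m : ℕ) : NullMeasurableSet {y | sInf (N y) = m} μ := by
  -- The second piece of the union accounts for the convention `sInf ∅ = 0`.
  have : {y | sInf (N y) = m} = ({y | m ∈ N y} ∩ ⋂ j ∈ Finset.range m, {y | j ∈ N y}ᶜ) ∪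
      ((⋂ j, {y | j ∈ N y}ᶜ) ∩ {_y | m = 0}) := by
    ext y
    simp only [mem_ofPred_eq, mem_union, mem_inter_iff, mem_iInter, mem_compl_iff, Finset.mem_range]
    constructor
    · rintro rfl
      rcases (N y).eq_empty_or_nonempty with h | h
      · right; simp [h]
      · left; exact ⟨Nat.sInf_mem h, fun j hj => Nat.notMem_of_lt_sInf hj⟩
    · rintro (⟨h1, h2⟩ | ⟨h1, rfl⟩)
      · refine le_antisymm (Nat.sInf_le h1) ?_
        by_contra! hlt
        exact h2 _ hlt (Nat.sInf_mem ⟨m, h1⟩)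
      · have : N y = ∅ := eq_empty_of_forall_notMem h1
        simp [this]
  rw [this]
  refine ((hN m).inter ?_).union ((NullMeasurableSet.iInter fun j => (hN j).compl).inter ?_)
  · exact NullMeasurableSet.biInter (Finset.range m).countable_toSet fun j _ => (hN j).compl
  · exact (MeasurableSet.const _).nullMeasurableSet

/-- Once the first `k` values are fixed, the next one is the infimum of a set of integers whose
membership sets are images of open cylinders under `h`, hence analytic. -/
lemma nullMeasurableSet_leftmostBranch_prefix {h : (ℕ → ℕ) → Y} (hh : Continuous h) (k : ℕ) (w : ℕ → ℕ) :
    NullMeasurableSet {y | ∀ i < k, leftmostBranch h y i = w i} μ := by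
  induction k with
  | zero => simp
  | succ k ih =>
    have hs : {y | ∀ i < k + 1, leftmostBranch h y i = w i} =
        {y | ∀ i < k, leftmostBranch h y i = w i} ∩
        {y | sInf {n | ∃ τ, h τ = y ∧ (∀ i : Fin k, τ i = w i) ∧ τ k = n} = w k} := by
      ext y
      simp only [mem_inter_iff, mem_ofPred_eq, Nat.lt_succ_iff_lt_or_eq, or_imp, forall_and,
        forall_eq]
      refine and_congr_right fun hk => ?_
      rw [leftmostBranch]
      have : ∀ i : Fin k, leftmostBranch h y i = w i := fun i => hk i i.2
      simp only [this]
    rw [hs]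
    refine ih.inter (nullMeasurableSet_setOf_sInf_eq (fun n => ?_) _)
    have : {y | n ∈ {n | ∃ τ, h τ = y ∧ (∀ i : Fin k, τ i = w i) ∧ τ k = n}} =
        h '' ({τ | ∀ i < k, τ i = w i} ∩ {τ | τ k = n}) := by
      ext y
      simp only [mem_ofPred_eq, mem_image, mem_inter_iff]
      constructor
      · rintro ⟨τ, h1, h2, h3⟩; exact ⟨τ, ⟨fun i hi => h2 ⟨i, hi⟩, h3⟩, h1⟩
      · rintro ⟨τ, ⟨h2, h3⟩, h1⟩; exact ⟨τ, h1, fun i => h2 i i.2, h3⟩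
    rw [this]
    refine MeasureTheory.AnalyticSet.nullMeasurableSet μ (IsOpen.analyticSet_image ?_ hh)
    exact (isOpen_setOf_forall_lt_eq w k).inter
      ((isOpen_discrete {n}).preimage (continuous_apply (A := fun _ : ℕ => ℕ) k))

lemma aemeasurable_leftmostBranch {h : (ℕ → ℕ) → Y} (hh : Continuous h) :
    AEMeasurable (leftmostBranch h) μ := by
  refine aemeasurable_pi_lambda _ fun k => NullMeasurable.aemeasurable fun s _ => ?_
  have : (fun y => leftmostBranch h y k) ⁻¹' s = ⋃ w ∈ {w : Fin (k + 1) → ℕ | w (Fin.last k) ∈ s},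
      {y | ∀ i < k + 1, leftmostBranch h y i = if hi : i < k + 1 then w ⟨i, hi⟩ else 0} := by
    ext y
    simp only [mem_preimage, mem_ofPred_eq, mem_iUnion, exists_prop]
    constructor
    · intro hy
      exact ⟨fun i => leftmostBranch h y i, hy, fun i hi => by simp [hi]⟩
    · rintro ⟨w, hw, h2⟩
      rw [h2 k (by omega)]
      simpa [Fin.last] using hw
  rw [this]
  exact NullMeasurableSet.biUnion (to_countable _) fun w _ =>
    nullMeasurableSet_leftmostBranch_prefix μ hh (k + 1) _

end

/-- A measurable function on a nonempty standard Borel space becomes continuous after composition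
with a suitable measurable surjection from the Baire space. -/
lemma exists_measurable_surjective_continuous_comp {B Y : Type*} [t : TopologicalSpace B] [PolishSpace B]
    [MeasurableSpace B] [BorelSpace B] [Nonempty B] [TopologicalSpace Y] [SecondCountableTopology Y]
    [MeasurableSpace Y] [OpensMeasurableSpace Y] {f : B → Y} (hf : Measurable f) :
    ∃ p : (ℕ → ℕ) → B, Measurable p ∧ Function.Surjective p ∧ Continuous fun σ => f (p σ) := by
  obtain ⟨t', ht', hcont, hpol⟩ := hf.exists_continuous
  obtain ⟨p, hp, hps⟩ := @PolishSpace.exists_nat_nat_continuous_surjective B t' hpol _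
  have hp' : Continuous[_, t] p := continuous_le_rng ht' hp
  exact ⟨p, @Continuous.measurable _ _ _ _ _ t _ _ p hp', hps,
    @Continuous.comp _ _ _ _ t' _ _ _ hcont hp⟩

/-- **Measurable selection** (Jankov-von Neumann, almost everywhere form): a measurable
relation in a product with a standard Borel space has a measurable selection almost everywhere. -/
theorem exists_aemeasurable_selection {Y X : Type*} [MeasurableSpace Y] [StandardBorelSpace Y]
    [MeasurableSpace X] [StandardBorelSpace X] [Nonempty X] (μ : Measure Y) [IsFiniteMeasure μ]
    {B : Set (Y × X)} (hB : MeasurableSet B) (hne : ∀ᵐ y ∂μ, ∃ x, (y, x) ∈ B) :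
    ∃ g : Y → X, AEMeasurable g μ ∧ ∀ᵐ y ∂μ, (y, g y) ∈ B := by
  classical
  let _ := upgradeStandardBorel Y
  rcases B.eq_empty_or_nonempty with rfl | hBne
  · exact ⟨fun _ => Classical.arbitrary X, aemeasurable_const, by simpa using hne⟩
  have : StandardBorelSpace B := hB.standardBorel
  let _ := upgradeStandardBorel B
  have : Nonempty B := hBne.to_subtype
  -- `B` is parametrized by the Baire space so that its projection to `Y` becomes continuous; the
  -- leftmost branch of each fibre is then a section.
  obtain ⟨p, hpmeas, hps, hh⟩ := exists_measurable_surjective_continuous_comp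
    (f := fun z : B => z.1.1) (measurable_fst.comp measurable_subtype_coe)
  refine ⟨fun y => (p (leftmostBranch (fun σ => (p σ).1.1) y)).1.2, ?_, ?_⟩
  · exact (measurable_snd.comp (measurable_subtype_coe.comp hpmeas)).comp_aemeasurable
      (aemeasurable_leftmostBranch μ hh)
  · filter_upwards [hne] with y ⟨x, hx⟩
    obtain ⟨σ, hσ⟩ := hps ⟨(y, x), hx⟩
    have h1 : (p (leftmostBranch (fun σ => (p σ).1.1) y)).1.1 = y :=
      apply_leftmostBranch hh ⟨σ, by simp [hσ]⟩
    have h2 := (p (leftmostBranch (fun σ => (p σ).1.1) y)).2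
    convert h2 using 1
    exact Prod.ext h1.symm rfl

/-! ### Lipschitz curves and limits of polygons. -/

/-- A Lipschitz curve is the integral of its derivative. -/
lemma LipschitzWith.intervalIntegral_deriv_eq_sub {E : Type*} [NormedAddCommGroup E] [NormedSpace ℝ E]
    [FiniteDimensional ℝ E] {K : NNReal} {Y : ℝ → E} (hY : LipschitzWith K Y) (a b : ℝ) :
    IntervalIntegrable (deriv Y) volume a b ∧ ∫ x in a..b, deriv Y x = Y b - Y a := by
  have : CompleteSpace E := FiniteDimensional.complete ℝ E
  have hm : StronglyMeasurable (deriv Y) := by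
    borelize E
    exact stronglyMeasurable_deriv Y
  have hb : ∀ x, ‖deriv Y x‖ ≤ K := fun x => norm_deriv_le_of_lipschitz hY
  have hint : ∀ a b : ℝ, IntervalIntegrable (deriv Y) volume a b := fun a b =>
    (intervalIntegrable_const (c := (K : ℝ))).mono_fun hm.aestronglyMeasurable
      (Eventually.of_forall fun x => (hb x).trans (le_abs_self _))
  refine ⟨hint a b, ?_⟩
  let I : ℝ → E := fun x => ∫ t in a..x, deriv Y t
  have hI : LipschitzWith K I := by
    refine LipschitzWith.of_dist_le_mul fun x y => ?_
    have : I x - I y = ∫ t in y..x, deriv Y t := by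
      simp only [I]
      rw [intervalIntegral.integral_interval_sub_left (hint _ _) (hint _ _)]
    rw [dist_eq_norm, this, Real.dist_eq]
    exact intervalIntegral.norm_integral_le_of_norm_le_const fun t _ => hb t
  -- `Y` minus the integral of its derivative is absolutely continuous with zero derivative almost
  -- everywhere, hence constant.
  have hac : AbsolutelyContinuousOnInterval (fun x => Y x - I x) a b :=
    (hY.lipschitzOnWith.absolutelyContinuousOnInterval).sub
      hI.lipschitzOnWith.absolutelyContinuousOnInterval
  obtain ⟨C, hC⟩ := hac.const_of_ae_hasDerivAt_zero (by
    filter_upwards [hY.ae_differentiableAt_real, (hint a b).ae_hasDerivAt_integral] with x h1 h2 hx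
    have := h1.hasDerivAt.sub (h2 hx a left_mem_uIcc)
    rw [sub_self] at this
    exact this)
  have h1 := hC a left_mem_uIcc
  have h2 := hC b right_mem_uIcc
  simp only [I, intervalIntegral.integral_same, sub_zero] at h1 h2
  rw [h1, ← h2]
  abel

lemma Convex.inv_smul_sum_mem {E : Type*} [AddCommGroup E] [Module ℝ E] {C : Set E} (hC : Convex ℝ C)
    {s : Finset ℕ} (hs : s.Nonempty) {V : ℕ → E} (hV : ∀ i ∈ s, V i ∈ C) :
    ((s.card : ℝ)⁻¹) • ∑ i ∈ s, V i ∈ C := by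
  have hc : (s.card : ℝ) ≠ 0 := by exact_mod_cast hs.card_pos.ne'
  rw [Finset.smul_sum]
  refine hC.sum_mem (fun i _ => by positivity) ?_ hV
  simp [hc]

section PolygonLimit

variable {E : Type*} [NormedAddCommGroup E] [NormedSpace ℝ E]

/-- The values of the polygon with step `h`, velocities `V` and starting point `y`. -/
noncomputable def polygon (y : E) (h : ℝ) (V : ℕ → E) (i : ℕ) : E := y + h • ∑ j ∈ Finset.range i, V j

/-- The step function in time defined by a polygon starting at time `t`. -/
noncomputable def polygonPath (t h : ℝ) (y : E) (V : ℕ → E) (s : ℝ) : E := polygon y h V ⌊(s - t) / h⌋₊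

lemma polygon_sub {y : E} {h : ℝ} {V : ℕ → E} {i j : ℕ} (hij : i ≤ j) :
    polygon y h V j - polygon y h V i = h • ∑ l ∈ Finset.Ico i j, V l := by
  simp only [polygon]
  rw [add_sub_add_left_eq_sub, ← smul_sub, Finset.sum_Ico_eq_sub _ hij]

/-- The extra `h` pays for rounding the times down to the grid. -/
lemma norm_polygonPath_sub_le {t h : ℝ} {y : E} {V : ℕ → E} {M : ℝ} (hh : 0 < h)
    (hV : ∀ i, ‖V i‖ ≤ M) {s r : ℝ} (hsr : s ≤ r) :
    ‖polygonPath t h y V r - polygonPath t h y V s‖ ≤ M * (r - s + h) := by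
  have hM : 0 ≤ M := (norm_nonneg _).trans (hV 0)
  have hle : ⌊(s - t) / h⌋₊ ≤ ⌊(r - t) / h⌋₊ := Nat.floor_mono (by gcongr)
  rw [polygonPath, polygonPath, polygon_sub hle, norm_smul, Real.norm_of_nonneg hh.le]
  have h1 : ‖∑ l ∈ Finset.Ico ⌊(s - t) / h⌋₊ ⌊(r - t) / h⌋₊, V l‖ ≤
      ((⌊(r - t) / h⌋₊ : ℝ) - ⌊(s - t) / h⌋₊) * M := by
    refine (norm_sum_le_of_le _ fun i _ => hV i).trans (le_of_eq ?_)
    simp [Nat.cast_sub hle]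
  have h2 : ((⌊(r - t) / h⌋₊ : ℝ) - ⌊(s - t) / h⌋₊) * h ≤ r - s + h := by
    have h4 := Nat.lt_floor_add_one ((s - t) / h)
    have e2 : (s - t) / h * h = s - t := by field_simp
    rcases le_or_gt 0 ((r - t) / h) with h0 | h0
    · have h3 := Nat.floor_le h0
      have e1 : (r - t) / h * h = r - t := by field_simp
      nlinarith
    · rw [Nat.floor_of_nonpos h0.le, Nat.floor_of_nonpos ((div_le_div_of_nonneg_right (by linarith) hh.le).trans h0.le)]
      simp; linarith
  calc h * _ ≤ h * (((⌊(r - t) / h⌋₊ : ℝ) - ⌊(s - t) / h⌋₊) * M) := by gcongr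
    _ = M * (((⌊(r - t) / h⌋₊ : ℝ) - ⌊(s - t) / h⌋₊) * h) := by ring
    _ ≤ _ := by gcongr

lemma tendsto_floor_mul {ι : Type*} {l : Filter ι} {t h : ι → ℝ} {t₀ s : ℝ} (hh : ∀ N, 0 < h N)
    (hh0 : Tendsto h l (𝓝 0)) (ht : Tendsto t l (𝓝 t₀)) (hs : t₀ < s) :
    Tendsto (fun N => h N * (⌊(s - t N) / h N⌋₊ : ℝ)) l (𝓝 (s - t₀)) := by
  have h1 : Tendsto (fun N => s - t N) l (𝓝 (s - t₀)) := tendsto_const_nhds.sub ht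
  have h2 : Tendsto (fun N => s - t N - h N) l (𝓝 (s - t₀)) := by simpa using h1.sub hh0
  have hev : ∀ᶠ N in l, t N < s := ht.eventually_lt_const hs
  refine tendsto_of_tendsto_of_tendsto_of_le_of_le' h2 h1 ?_ ?_
  · filter_upwards [hev] with N hN
    have h4 := Nat.lt_floor_add_one ((s - t N) / h N)
    rw [div_lt_iff₀ (hh N)] at h4
    linarith
  · filter_upwards [hev] with N hN
    have h4 := Nat.floor_le (div_nonneg (sub_nonneg.2 hN.le) (hh N).le)
    rw [le_div_iff₀ (hh N)] at h4
    linarith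

variable {t h : ℕ → ℝ} {y : ℕ → E} {V : ℕ → ℕ → E} {t₀ M : ℝ} {Y : ℝ → E} {l : Filter ℕ}

lemma lipschitzWith_of_polygonPath_tendsto [l.NeBot] (hh : ∀ N, 0 < h N) (hh0 : Tendsto h l (𝓝 0))
    (hV : ∀ N i, ‖V N i‖ ≤ M)
    (hY : ∀ s, Tendsto (fun N => polygonPath (t N) (h N) (y N) (V N) s) l (𝓝 (Y s))) :
    LipschitzWith M.toNNReal Y := by
  have key : ∀ s r, s ≤ r → ‖Y r - Y s‖ ≤ M * (r - s) := by
    intro s r hsr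
    have h1 := ((hY r).sub (hY s)).norm
    have h2 : Tendsto (fun N => M * (r - s + h N)) l (𝓝 (M * (r - s + 0))) :=
      (hh0.const_add _).const_mul _
    rw [add_zero] at h2
    exact le_of_tendsto_of_tendsto' h1 h2 fun N => norm_polygonPath_sub_le (hh N) (hV N) hsr
  refine LipschitzWith.of_dist_le' fun r s => ?_
  rw [dist_eq_norm, Real.dist_eq]
  rcases le_total s r with hsr | hsr
  · rw [abs_of_nonneg (sub_nonneg.2 hsr)]; exact key s r hsr
  · rw [abs_of_nonpos (sub_nonpos.2 hsr), norm_sub_rev, neg_sub]; exact key r s hsr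

/-- The derivative of a limit of polygons lies in every closed convex set that contains the
velocities of the polygons near the time considered. -/
lemma deriv_mem_of_polygonPath_tendsto [l.NeBot] (hh : ∀ N, 0 < h N) (hh0 : Tendsto h l (𝓝 0))
    (ht : Tendsto t l (𝓝 t₀))
    (hY : ∀ s, Tendsto (fun N => polygonPath (t N) (h N) (y N) (V N) s) l (𝓝 (Y s)))
    {C : Set E} (hC : Convex ℝ C) (hCc : IsClosed C) {s ρ : ℝ} (hs : t₀ < s) (hρ : 0 < ρ)
    (hmem : ∀ᶠ N in l, ∀ i : ℕ, |t N + i * h N - s| ≤ ρ → V N i ∈ C) (hd : DifferentiableAt ℝ Y s) :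
    deriv Y s ∈ C := by
  have hslope : Tendsto (slope Y s) (𝓝[>] s) (𝓝 (deriv Y s)) :=
    (hasDerivAt_iff_tendsto_slope.1 hd.hasDerivAt).mono_left
      (nhdsWithin_mono _ fun x hx => (ne_of_gt hx))
  refine hCc.mem_of_tendsto hslope ?_
  filter_upwards [Ioo_mem_nhdsGT (show s < s + ρ by linarith)] with r hr
  -- `n N` is the grid time elapsed between `s` and `r`. Divided by it instead of `r - s`, the
  -- increment of the polygon is exactly an average of its velocities.
  let n : ℕ → ℝ := fun N => h N * (⌊(r - t N) / h N⌋₊ : ℝ) - h N * (⌊(s - t N) / h N⌋₊ : ℝ)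
  have hn : Tendsto n l (𝓝 (r - s)) := by
    have := (tendsto_floor_mul hh hh0 ht (hs.trans hr.1)).sub (tendsto_floor_mul hh hh0 ht hs)
    simpa using this
  have hlim : Tendsto (fun N => (n N)⁻¹ • (polygonPath (t N) (h N) (y N) (V N) r -
      polygonPath (t N) (h N) (y N) (V N) s)) l (𝓝 (slope Y s r)) := by
    rw [slope_def_module]
    exact (hn.inv₀ (sub_pos.2 hr.1).ne').smul ((hY r).sub (hY s))
  refine hCc.mem_of_tendsto hlim ?_
  filter_upwards [hmem, hn.eventually_const_lt (sub_pos.2 hr.1), hh0.eventually_lt_const hρ,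
    ht.eventually_lt_const hs] with N hN hnN hhN htN
  have hle : ⌊(s - t N) / h N⌋₊ ≤ ⌊(r - t N) / h N⌋₊ :=
    Nat.floor_mono (by have := hh N; have := hr.1.le; gcongr)
  have hlt : ⌊(s - t N) / h N⌋₊ < ⌊(r - t N) / h N⌋₊ := by
    refine hle.lt_of_ne fun he => ?_
    simp only [n, he, sub_self, lt_irrefl] at hnN
  rw [polygonPath, polygonPath, polygon_sub hle, smul_smul]
  have hcoef : (n N)⁻¹ * h N = ((Finset.Ico ⌊(s - t N) / h N⌋₊ ⌊(r - t N) / h N⌋₊).card : ℝ)⁻¹ := by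
    rw [Nat.card_Ico, Nat.cast_sub hle]
    have h1 : n N = h N * ((⌊(r - t N) / h N⌋₊ : ℝ) - ⌊(s - t N) / h N⌋₊) := by simp only [n]; ring
    have := (hh N).ne'
    rw [h1, mul_inv]
    field_simp
  rw [hcoef]
  refine hC.inv_smul_sum_mem (by simpa using hlt) fun i hi => hN i ?_
  rw [Finset.mem_Ico] at hi
  have h3 := Nat.lt_floor_add_one ((s - t N) / h N)
  rw [div_lt_iff₀ (hh N)] at h3
  have h4 := Nat.floor_le (div_nonneg (sub_nonneg.2 (htN.le.trans hr.1.le)) (hh N).le)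
  rw [le_div_iff₀ (hh N)] at h4
  have h5 : ((⌊(s - t N) / h N⌋₊ : ℕ) : ℝ) ≤ i := by exact_mod_cast hi.1
  have h6 : ((i : ℕ) : ℝ) ≤ (⌊(r - t N) / h N⌋₊ : ℝ) := by exact_mod_cast hi.2.le
  have h7 := mul_le_mul_of_nonneg_right h5 (hh N).le
  have h8 := mul_le_mul_of_nonneg_right h6 (hh N).le
  rw [abs_le]
  constructor <;> nlinarith [hr.2]

/-- Bounded sequences converge along an ultrafilter, so one ultrafilter serves all times at once and
no subsequence has to be extracted. -/
lemma exists_polygonPath_tendsto [ProperSpace E] (U : Ultrafilter ℕ) {b : ℝ} (hh : ∀ N, 0 < h N)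
    (hhb : ∀ N, h N ≤ b) (htb : ∀ N, |t N| ≤ b) (hyb : ∀ N, ‖y N‖ ≤ b) (hV : ∀ N i, ‖V N i‖ ≤ M) (s : ℝ) :
    ∃ Y : E, Tendsto (fun N => polygonPath (t N) (h N) (y N) (V N) s) U (𝓝 Y) := by
  have hM : 0 ≤ M := (norm_nonneg _).trans (hV 0 0)
  have hbd : ∀ N, polygonPath (t N) (h N) (y N) (V N) s ∈
      Metric.closedBall (0 : E) (M * (|s| + b + b + b) + b) := by
    intro N
    rw [mem_closedBall_zero_iff]
    have h1 : polygonPath (t N) (h N) (y N) (V N) (min s (t N)) = y N := by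
      have : (min s (t N) - t N) / h N ≤ 0 :=
        div_nonpos_of_nonpos_of_nonneg (by simp) (hh N).le
      simp [polygonPath, polygon, Nat.floor_of_nonpos this]
    have h2 := norm_polygonPath_sub_le (t := t N) (y := y N) (hh N) (hV N) (min_le_left s (t N))
    rw [h1] at h2
    have h3 := norm_le_norm_add_norm_sub' (polygonPath (t N) (h N) (y N) (V N) s) (y N)
    have h4 : s - min s (t N) ≤ |s| + b + b := by
      have := le_abs_self s
      have := neg_abs_le (t N)
      have := htb N
      have := abs_nonneg (t N)
      have := abs_nonneg s
      rcases min_choice s (t N) with h | h <;> rw [h] <;> linarith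
    have h5 : M * (s - min s (t N) + h N) ≤ M * (|s| + b + b + b) := by
      have := hhb N
      gcongr
    linarith [hyb N]
  obtain ⟨Y, -, hY⟩ := (isCompact_closedBall (0 : E) _).ultrafilter_le_nhds'
    (U.map fun N => polygonPath (t N) (h N) (y N) (V N) s)
    (by rw [Ultrafilter.mem_map]; exact Filter.univ_mem' hbd)
  exact ⟨Y, hY⟩

end PolygonLimit

/-! ### Inf-convolution and Euler polygons. -/

section Euler

variable {d n : ℕ} {P : MultiDomain d} {S : ControlProblem d n} {T cl lam : ℝ} {u : ℝ → Vec d → ℝ}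

/-- The inf-convolution of `u`, with parameter `ε`, over `[a, T] × B(0,R)`, is at most `b` at `(t,x)`. -/
def InfConvLE (u : ℝ → Vec d → ℝ) (a T R ε t : ℝ) (x : Vec d) (b : ℝ) : Prop :=
  ∃ s ∈ Icc a T, ∃ z ∈ Metric.closedBall (0 : Vec d) R,
    u s z + (‖z - x‖ ^ 2 + (s - t) ^ 2) / (2 * ε) ≤ b

lemma exists_lower_bound {a R : ℝ} (ha : 0 < a)
    (hu : LowerSemicontinuousOn (fun z : ℝ × Vec d => u z.1 z.2) (Ioc 0 T ×ˢ univ)) :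
    ∃ m : ℝ, ∀ s ∈ Icc a T, ∀ z ∈ Metric.closedBall (0 : Vec d) R, m ≤ u s z := by
  let K : Set (ℝ × Vec d) := Icc a T ×ˢ Metric.closedBall 0 R
  have hK : IsCompact K := isCompact_Icc.prod (isCompact_closedBall _ _)
  rcases K.eq_empty_or_nonempty with h | h
  · exact ⟨0, fun s hs z hz => (h ▸ notMem_empty (s, z) : (s, z) ∉ K) ⟨hs, hz⟩ |>.elim⟩
  · obtain ⟨w, -, hw⟩ := (hu.mono fun z hz => ⟨⟨ha.trans_le hz.1.1, hz.1.2⟩, mem_univ _⟩ :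
      LowerSemicontinuousOn (fun z : ℝ × Vec d => u z.1 z.2) K).exists_isMinOn h hK
    exact ⟨u w.1 w.2, fun s hs z hz => hw (show (s, z) ∈ K from ⟨hs, hz⟩)⟩

lemma InfConvLE.exists_isMinOn {a R ε t b : ℝ} {x : Vec d} (ha : 0 < a)
    (hu : LowerSemicontinuousOn (fun z : ℝ × Vec d => u z.1 z.2) (Ioc 0 T ×ˢ univ))
    (h : InfConvLE u a T R ε t x b) :
    ∃ s ∈ Icc a T, ∃ z ∈ Metric.closedBall (0 : Vec d) R,
      u s z + (‖z - x‖ ^ 2 + (s - t) ^ 2) / (2 * ε) ≤ b ∧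
      ∀ s' ∈ Icc a T, ∀ z' ∈ Metric.closedBall (0 : Vec d) R,
        u s z + (‖z - x‖ ^ 2 + (s - t) ^ 2) / (2 * ε) ≤
          u s' z' + (‖z' - x‖ ^ 2 + (s' - t) ^ 2) / (2 * ε) := by
  obtain ⟨s, hs, z, hz, hb⟩ := h
  let K : Set (ℝ × Vec d) := Icc a T ×ˢ Metric.closedBall 0 R
  have hK : IsCompact K := isCompact_Icc.prod (isCompact_closedBall _ _)
  have hKs : K ⊆ Ioc 0 T ×ˢ univ := fun z hz => ⟨⟨ha.trans_le hz.1.1, hz.1.2⟩, mem_univ _⟩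
  have hlsc : LowerSemicontinuousOn
      (fun w : ℝ × Vec d => u w.1 w.2 + (‖w.2 - x‖ ^ 2 + (w.1 - t) ^ 2) / (2 * ε)) K := by
    refine LowerSemicontinuousOn.add (hu.mono hKs) ?_
    exact Continuous.lowerSemicontinuous (by fun_prop) |>.lowerSemicontinuousOn _
  obtain ⟨w, hwK, hw⟩ := hlsc.exists_isMinOn (show K.Nonempty from ⟨(s, z), hs, hz⟩) hK
  refine ⟨w.1, hwK.1, w.2, hwK.2, (hw (show (s, z) ∈ K from ⟨hs, hz⟩)).trans hb, fun s' hs' z' hz' => ?_⟩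
  exact hw (show (s', z') ∈ K from ⟨hs', hz'⟩)

/-- This fixes `ε` so small that minimisers of the inf-convolution stay within `ρ` of the base
point. -/
lemma penalty_bound {m D B ρ ε w p : ℝ} (hρ : 0 < ρ) (hD : 1 ≤ D) (hBm : B - m ≤ D)
    (hε : ε = ρ ^ 2 / (4 * D)) (hm : m ≤ w) (h : w + p / (2 * ε) ≤ B) : p < ρ ^ 2 := by
  have hε0 : 0 < ε := by rw [hε]; positivity
  have h1 : p / (2 * ε) ≤ D := by linarith
  rw [div_le_iff₀ (by positivity)] at h1
  have h2 : D * (2 * ε) = ρ ^ 2 / 2 := by rw [hε]; field_simp; ring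
  have : 0 < ρ ^ 2 := by positivity
  linarith

/-- At a minimum point of the inf-convolution, the supersolution property provides a control along
which the inf-convolution decreases. -/
lemma exists_control_of_isMinOn (hsup : IsSupersolution T S.HamF u) {a R ε t : ℝ} {x : Vec d}
    (ha : 0 < a) (hε : 0 < ε) {s : ℝ} {z : Vec d} (hs : s ∈ Ioo a T) (hz : ‖z‖ < R)
    (hmin : ∀ s' ∈ Icc a T, ∀ z' ∈ Metric.closedBall (0 : Vec d) R,
        u s z + (‖z - x‖ ^ 2 + (s - t) ^ 2) / (2 * ε) ≤
          u s' z' + (‖z' - x‖ ^ 2 + (s' - t) ^ 2) / (2 * ε)) {η : ℝ} (hη : 0 < η) :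
    ∃ α ∈ S.A, -η ≤ (s - t) / ε + inner ℝ (z - x) (S.f z α) / ε - S.ℓ z α := by
  let φ : ℝ × Vec d → ℝ := fun w => -((‖w.2 - x‖ ^ 2 + (w.1 - t) ^ 2) / (2 * ε))
  have hφ : ContDiff ℝ 1 φ := by
    have h1 : ContDiff ℝ 1 fun w : ℝ × Vec d => ‖w.2 - x‖ ^ 2 :=
      (contDiff_snd.sub contDiff_const).norm_sq ℝ
    have h2 : ContDiff ℝ 1 fun w : ℝ × Vec d => (w.1 - t) ^ 2 :=
      (contDiff_fst.sub contDiff_const).pow 2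
    exact ((h1.add h2).div_const _).neg
  have hloc : IsLocalMin (fun w : ℝ × Vec d => u w.1 w.2 - φ w) (s, z) := by
    have hnhds : Icc a T ×ˢ Metric.closedBall (0 : Vec d) R ∈ 𝓝 (s, z) :=
      prod_mem_nhds (Icc_mem_nhds hs.1 hs.2)
        (Metric.closedBall_mem_nhds_of_mem (by simpa using hz))
    filter_upwards [hnhds] with w hw
    have := hmin w.1 hw.1 w.2 hw.2
    simp only [φ, sub_neg_eq_add]
    exact this
  have h := hsup.2 s ⟨ha.trans hs.1, hs.2⟩ z φ hφ.contDiffOn hloc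
  have hdt : deriv (fun r => φ (r, z)) s = -((s - t) / ε) := by
    have h1 : HasDerivAt (fun r : ℝ => -((‖z - x‖ ^ 2 + (r - t) ^ 2) / (2 * ε)))
        (-((2 * (s - t)) / (2 * ε))) s := by
      have h2 : HasDerivAt (fun r : ℝ => (r - t) ^ 2) (2 * (s - t)) s := by
        simpa using ((hasDerivAt_id s).sub_const t).fun_pow 2
      exact ((h2.const_add _).div_const _).neg
    rw [h1.deriv, mul_div_mul_left _ _ two_ne_zero]
  have hdx : gradient (fun y => φ (s, y)) z = -(ε⁻¹ • (z - x)) := by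
    refine HasGradientAt.gradient ?_
    rw [hasGradientAt_iff_hasFDerivAt]
    have h2 : HasFDerivAt (fun y : Vec d => ‖y - x‖ ^ 2) (2 • innerSL ℝ (z - x)) z := by
      have := (hasStrictFDerivAt_norm_sq (z - x)).hasFDerivAt.comp z ((hasFDerivAt_id z).sub_const x)
      simpa [Function.comp_def] using this
    have h3 := ((h2.add_const ((s - t) ^ 2)).mul_const (2 * ε)⁻¹).neg
    simp only [← div_eq_mul_inv] at h3
    refine h3.congr_fderiv ?_
    ext v
    simp
    field_simp
  rw [hdt, hdx, neg_neg] at h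
  -- The slack `η` below the supremum yields a control without asking that the supremum be attained.
  have hlt : ((-((s - t) / ε) - η : ℝ) : EReal) < S.HamF z (-(ε⁻¹ • (z - x))) := by
    by_contra! hle
    have h3 : ((s - t) / ε : ℝ) + S.HamF z (-(ε⁻¹ • (z - x))) ≤
        (((s - t) / ε : ℝ) : EReal) + ((-((s - t) / ε) - η : ℝ) : EReal) := by gcongr
    have h4 := h.trans h3
    rw [← EReal.coe_add] at h4
    have h5 : (0 : ℝ) ≤ (s - t) / ε + (-((s - t) / ε) - η) := by exact_mod_cast h4
    linarith
  unfold ControlProblem.HamF ControlProblem.hamiltonian at hlt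
  obtain ⟨α, hα⟩ := lt_iSup_iff.1 hlt
  obtain ⟨hαA, hα⟩ := lt_iSup_iff.1 hα
  refine ⟨α, hαA, ?_⟩
  have := EReal.coe_lt_coe_iff.1 hα
  rw [inner_neg_left, real_inner_smul_left] at this
  have e : inner ℝ (z - x) (S.f z α) / ε = ε⁻¹ * inner ℝ (z - x) (S.f z α) := by ring
  linarith

/-- The minimiser `(s, z)` for `(t, x)` is kept as competitor for the displaced point, so only the
quadratic penalty changes: its first-order part is controlled by the choice of `α`, its second-order
part by the bound on `h`. As `ε` is fixed, the admissible step `h₀` does not depend on `(t, x)`.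
Keeping `t` in `[a, T - η]` makes the minimiser interior in time. -/
lemma exists_infConv_step (hsup : IsSupersolution T S.HamF u)
    {a R M B η : ℝ} (ha : 0 < a) (hη : 0 < η)
    (hM : ∀ z : Vec d, ‖z‖ ≤ R + 1 → ∀ α ∈ S.A, ‖S.f z α‖ ≤ M) :
    ∃ ε > 0, ∃ h₀ > 0, ∀ t ∈ Icc a (T - η), ∀ x : Vec d, ‖x‖ ≤ R → ∀ b ≤ B,
      InfConvLE u (a / 2) T (R + 1) ε t x b →
      (∃ s ∈ Icc (a / 2) T, ∃ z : Vec d, |s - t| ≤ η ∧ ‖z - x‖ ≤ η ∧ u s z ≤ b) ∧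
      ∃ z : Vec d, ∃ α ∈ S.A, ‖z - x‖ ≤ η ∧ ∀ h ∈ Ioc 0 h₀,
        InfConvLE u (a / 2) T (R + 1) ε (t + h) (x + h • S.f z α) (b - h * S.ℓ z α + h * η) := by
  obtain ⟨m, hm⟩ := exists_lower_bound (R := R + 1) (half_pos ha) hsup.1
  let ρ : ℝ := min (min η (a / 2)) 1
  have hρ : 0 < ρ := by simp only [ρ]; positivity
  have hρη : ρ ≤ η := (min_le_left _ _).trans (min_le_left _ _)
  have hρa : ρ ≤ a / 2 := (min_le_left _ _).trans (min_le_right _ _)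
  have hρ1 : ρ ≤ 1 := min_le_right _ _
  let D : ℝ := max (B - m) 0 + 1
  have hD : 1 ≤ D := by simp [D]
  have hBm : B - m ≤ D := by have := le_max_left (B - m) 0; simp only [D]; linarith
  let ε : ℝ := ρ ^ 2 / (4 * D)
  have hε : 0 < ε := by simp only [ε]; positivity
  -- This bound on the step makes the quadratic term at most `h * η / 2`; the other `h * η / 2` is
  -- the slack in the choice of the control.
  refine ⟨ε, hε, ε * η / (M ^ 2 + 1), by positivity, fun t ht x hx b hb hE => ?_⟩
  obtain ⟨s, hs, z, hz, hval, hmin⟩ := hE.exists_isMinOn (half_pos ha) hsup.1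
  have hpen := penalty_bound hρ hD hBm rfl (hm s hs z hz) (hval.trans hb)
  have h1 : ‖z - x‖ < ρ := by
    refine lt_of_pow_lt_pow_left₀ 2 hρ.le ?_
    have := sq_nonneg (s - t); linarith
  have h2 : |s - t| < ρ := by
    refine lt_of_pow_lt_pow_left₀ 2 hρ.le ?_
    rw [sq_abs]
    have := sq_nonneg ‖z - x‖; linarith
  have h2' := abs_lt.1 h2
  have hsI : s ∈ Ioo (a / 2) T := ⟨by linarith [ht.1], by linarith [ht.2]⟩
  have hzR : ‖z‖ < R + 1 := by
    have := norm_le_norm_add_norm_sub' z x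
    linarith
  constructor
  · refine ⟨s, hs, z, by linarith, by linarith, le_trans ?_ hval⟩
    have : 0 ≤ (‖z - x‖ ^ 2 + (s - t) ^ 2) / (2 * ε) := by positivity
    linarith
  obtain ⟨α, hα, hαη⟩ := exists_control_of_isMinOn hsup (half_pos ha) hε hsI hzR hmin (half_pos hη)
  refine ⟨z, α, hα, by linarith, fun h hh => ⟨s, hs, z, hz, ?_⟩⟩
  have hfM : ‖S.f z α‖ ^ 2 ≤ M ^ 2 :=
    pow_le_pow_left₀ (norm_nonneg _) (hM z hzR.le α hα) 2
  have e1 : ‖z - (x + h • S.f z α)‖ ^ 2 =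
      ‖z - x‖ ^ 2 - 2 * h * inner ℝ (z - x) (S.f z α) + h ^ 2 * ‖S.f z α‖ ^ 2 := by
    rw [← sub_sub, norm_sub_sq_real, real_inner_smul_right, norm_smul, mul_pow, Real.norm_eq_abs, sq_abs]
    ring
  have e2 : (‖z - (x + h • S.f z α)‖ ^ 2 + (s - (t + h)) ^ 2) / (2 * ε) =
      (‖z - x‖ ^ 2 + (s - t) ^ 2) / (2 * ε) - h * (inner ℝ (z - x) (S.f z α) / ε + (s - t) / ε)
        + h * (h * (‖S.f z α‖ ^ 2 + 1) / (2 * ε)) := by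
    rw [e1]; field_simp; ring
  have h3 : h * (‖S.f z α‖ ^ 2 + 1) / (2 * ε) ≤ η / 2 := by
    have h4 := hh.2
    rw [le_div_iff₀ (by positivity)] at h4
    rw [div_le_iff₀ (by positivity)]
    have : h * (‖S.f z α‖ ^ 2 + 1) ≤ h * (M ^ 2 + 1) := by
      have := hh.1.le; gcongr
    linarith
  have h5 := mul_le_mul_of_nonneg_left h3 hh.1.le
  have h6 := mul_le_mul_of_nonneg_left hαη hh.1.le
  rw [e2]
  linarith

end Euler

section EulerLimit

variable {d n : ℕ} {P : MultiDomain d} {S : ControlProblem d n} {T cl lam : ℝ} {u : ℝ → Vec d → ℝ}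

/-- The velocity of the augmented system. -/
def ControlProblem.augVelocity (S : ControlProblem d n) (z : Vec d) (α : Vec n) : Vec d × ℝ :=
  (S.f z α, -S.ℓ z α)

lemma polygon_succ {E : Type*} [NormedAddCommGroup E] [NormedSpace ℝ E] (y : E) (h : ℝ) (V : ℕ → E)
    (i : ℕ) : polygon y h V (i + 1) = polygon y h V i + h • V i := by
  simp [polygon, Finset.sum_range_succ, add_assoc]

lemma polygon_congr {E : Type*} [NormedAddCommGroup E] [NormedSpace ℝ E] {y : E} {h : ℝ} {V V' : ℕ → E}
    {i : ℕ} (hV : ∀ j < i, V j = V' j) : polygon y h V i = polygon y h V' i := by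
  simp only [polygon]
  rw [Finset.sum_congr rfl fun j hj => hV j (Finset.mem_range.1 hj)]

/-- Iterates `exists_infConv_step` on augmented points whose last component is minus the cost spent
so far. Each step adds an error `h * η`, so the total is at most `T * η`. -/
lemma exists_euler_polygon (hsup : IsSupersolution T S.HamF u) {cf : ℝ} (hcf : 0 < cf)
    (hf : ∀ x, ∀ α ∈ S.A, ‖S.f x α‖ ≤ cf * (1 + ‖x‖)) (hℓ : ∀ x, ∀ α ∈ S.A, 0 ≤ S.ℓ x α)
    (hA : S.A.Nonempty) {a : ℝ} (ha : 0 < a) (haT : a < T) (x₀ : Vec d) {η : ℝ} (hη : 0 < η) (hη1 : η ≤ 1) :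
    ∃ h > 0, h ≤ η ∧ ∃ (Z : ℕ → Vec d) (α : ℕ → Vec n), (∀ i, α i ∈ S.A) ∧
      (∀ i, ‖Z i - (polygon (x₀, (0 : ℝ)) h (fun j => S.augVelocity (Z j) (α j)) i).1‖ ≤ η) ∧
      (∀ i : ℕ, a + i * h ≤ T →
        ‖(polygon (x₀, (0 : ℝ)) h (fun j => S.augVelocity (Z j) (α j)) i).1‖ ≤
          (‖x₀‖ + 2) * Real.exp (cf * T)) ∧
      ∀ i : ℕ, a + i * h ≤ T - η → ∃ s ∈ Ioc 0 T, ∃ z : Vec d, |s - (a + i * h)| ≤ η ∧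
        ‖z - (polygon (x₀, (0 : ℝ)) h (fun j => S.augVelocity (Z j) (α j)) i).1‖ ≤ η ∧
        u s z ≤ u a x₀ + (polygon (x₀, (0 : ℝ)) h (fun j => S.augVelocity (Z j) (α j)) i).2 + T * η := by
  let R : ℝ := (‖x₀‖ + 2) * Real.exp (cf * T)
  have hT : 0 < T := ha.trans haT
  obtain ⟨ε, hε, h₀, hh₀, hstep⟩ := exists_infConv_step (S := S) (R := R) (M := cf * (1 + (R + 1)))
    (B := u a x₀ + T * η) hsup ha hη (fun z hz α hα => (hf z α hα).trans (by gcongr))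
  let h : ℝ := min h₀ η
  have hh : 0 < h := lt_min hh₀ hη
  let b : ℕ → ℝ → ℝ := fun i p => u a x₀ + p + i * h * η
  -- The step is made total: outside the range where the estimate applies, a dummy point and control
  -- are returned, so that the recursion needs no side conditions.
  have hex : ∀ (i : ℕ) (p : Vec d × ℝ), ∃ z : Vec d, ∃ α ∈ S.A, ‖z - p.1‖ ≤ η ∧
      (a + i * h ≤ T - η → ‖p.1‖ ≤ R → p.2 ≤ 0 →
        InfConvLE u (a / 2) T (R + 1) ε (a + i * h) p.1 (b i p.2) →
        InfConvLE u (a / 2) T (R + 1) ε (a + (i + 1 : ℕ) * h) (p + h • S.augVelocity z α).1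
          (b (i + 1) (p + h • S.augVelocity z α).2)) := by
    intro i p
    by_cases hc : a + i * h ≤ T - η ∧ ‖p.1‖ ≤ R ∧ p.2 ≤ 0 ∧
        InfConvLE u (a / 2) T (R + 1) ε (a + i * h) p.1 (b i p.2)
    · obtain ⟨h1, h2, h3, h4⟩ := hc
      have hi : 0 ≤ i * h := by positivity
      obtain ⟨-, z, α, hα, hz, hE⟩ := hstep (a + i * h) ⟨by linarith, h1⟩ p.1 h2 (b i p.2)
        (by have : i * h * η ≤ T * η := by gcongr; linarith
            simp only [b]; linarith) h4
      refine ⟨z, α, hα, hz, fun _ _ _ _ => ?_⟩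
      have := hE h ⟨hh, min_le_left _ _⟩
      convert this using 1
      · push_cast; ring
      · simp [ControlProblem.augVelocity]
      · simp only [b, ControlProblem.augVelocity, Prod.snd_add, Prod.smul_snd, smul_eq_mul]
        push_cast; ring
    · obtain ⟨α, hα⟩ := hA
      exact ⟨p.1, α, hα, by simpa using hη.le, fun h1 h2 h3 h4 => absurd ⟨h1, h2, h3, h4⟩ hc⟩
  choose z α hα hz hE using hex
  let p : ℕ → Vec d × ℝ := fun i => Nat.rec (x₀, 0) (fun i p => p + h • S.augVelocity (z i p) (α i p)) i
  have hp : ∀ i, p (i + 1) = p i + h • S.augVelocity (z i (p i)) (α i (p i)) := fun i => rfl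
  have hpol : ∀ i, polygon (x₀, (0 : ℝ)) h (fun j => S.augVelocity (z j (p j)) (α j (p j))) i = p i := by
    intro i
    induction i with
    | zero => simp [polygon, p]
    | succ i ih => rw [polygon_succ, ih, hp]
  -- Discrete Grönwall inequality. The constant 2 covers the distance, at most `η ≤ 1`, from the
  -- polygon to the point where the velocity is taken.
  have hgrow : ∀ i, ‖(p i).1‖ + 2 ≤ (‖x₀‖ + 2) * Real.exp (cf * (i * h)) := by
    intro i
    induction i with
    | zero => simp [p]
    | succ i ih =>
      have h1 : ‖(p (i + 1)).1‖ ≤ ‖(p i).1‖ + h * (cf * (2 + ‖(p i).1‖)) := by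
        rw [hp, Prod.fst_add, Prod.smul_fst]
        refine (norm_add_le _ _).trans ?_
        rw [norm_smul, Real.norm_of_nonneg hh.le]
        gcongr
        refine (hf _ _ (hα i (p i))).trans ?_
        have := norm_le_norm_add_norm_sub' (z i (p i)) (p i).1
        have := hz i (p i)
        have h4 : 1 + ‖z i (p i)‖ ≤ 2 + ‖(p i).1‖ := by linarith
        gcongr
      have h2 : Real.exp (cf * ((i + 1 : ℕ) * h)) = Real.exp (cf * (i * h)) * Real.exp (cf * h) := by
        rw [← Real.exp_add]; congr 1; push_cast; ring
      have h3 : 1 + cf * h ≤ Real.exp (cf * h) := by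
        have := Real.add_one_le_exp (cf * h); linarith
      rw [h2, ← mul_assoc]
      calc ‖(p (i + 1)).1‖ + 2 ≤ (‖(p i).1‖ + 2) * (1 + cf * h) := by linarith
        _ ≤ _ := by gcongr
  have hbound : ∀ i : ℕ, a + i * h ≤ T → ‖(p i).1‖ ≤ R := by
    intro i hi
    have h1 := hgrow i
    have h2 : Real.exp (cf * (i * h)) ≤ Real.exp (cf * T) := by
      apply Real.exp_le_exp.2; gcongr; linarith
    have h3 : (‖x₀‖ + 2) * Real.exp (cf * (i * h)) ≤ R := by simp only [R]; gcongr
    linarith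
  have hneg : ∀ i, (p i).2 ≤ 0 := by
    intro i
    induction i with
    | zero => simp [p]
    | succ i ih =>
      rw [hp]
      have := mul_nonneg hh.le (hℓ (z i (p i)) _ (hα i (p i)))
      simp only [ControlProblem.augVelocity, Prod.snd_add, Prod.smul_snd, smul_eq_mul]
      linarith
  have hInf : ∀ i : ℕ, a + i * h ≤ T - η →
      InfConvLE u (a / 2) T (R + 1) ε (a + i * h) (p i).1 (b i (p i).2) := by
    intro i
    induction i with
    | zero =>
      intro h0
      refine ⟨a, ⟨by linarith, haT.le⟩, x₀, ?_, ?_⟩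
      · rw [mem_closedBall_zero_iff]
        have := hbound 0 (by simpa using haT.le)
        change ‖x₀‖ ≤ R at this
        linarith
      · simp [p, b]
    | succ i ih =>
      intro h0
      have h1 : a + i * h ≤ T - η := by push_cast at h0; linarith
      rw [hp]
      exact hE i (p i) h1 (hbound i (by linarith)) (hneg i) (ih h1)
  refine ⟨h, hh, min_le_right _ _, fun i => z i (p i), fun i => α i (p i), fun i => hα i _, ?_, ?_, ?_⟩
  · intro i; rw [hpol]; exact hz i (p i)
  · intro i hi; rw [hpol]; exact hbound i hi
  · intro i hi
    rw [hpol]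
    have hi0 : 0 ≤ i * h := by positivity
    have hiη : i * h * η ≤ T * η := by gcongr; linarith
    obtain ⟨⟨s, hs, y, h1, h2, h3⟩, -⟩ := hstep (a + i * h) ⟨by linarith, hi⟩ (p i).1
      (hbound i (by linarith)) (b i (p i).2) (by simp only [b]; linarith [hneg i]) (hInf i hi)
    exact ⟨s, ⟨by linarith [hs.1], hs.2⟩, y, h1, h2, by simp only [b] at h3; linarith⟩

end EulerLimit

/-! ### Limit trajectories, controls and super-optimality. -/

section LimitTrajectory

variable {d n : ℕ} {P : MultiDomain d} {S : ControlProblem d n} {T cl lam : ℝ} {u : ℝ → Vec d → ℝ}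

lemma ControlProblem.HL.le_bound (hL : S.HL P cl lam) {x : Vec d} {α : Vec n} (hα : α ∈ S.A) :
    0 ≤ S.ℓ x α ∧ S.ℓ x α ≤ cl * (1 + ‖x‖ ^ lam) :=
  hL.growth x _ (mem_image_of_mem _ hα)

lemma ControlProblem.HL.augVelocity_mem (hL : S.HL P cl lam) {x : Vec d} {α : Vec n} (hα : α ∈ S.A) :
    S.augVelocity x α ∈ S.G cl lam x :=
  ⟨α, hα, 0, le_rfl, sub_nonneg.2 (hL.le_bound hα).2, by simp [ControlProblem.augVelocity]⟩

lemma ControlProblem.HG.exists_thickening (hG : S.HG cl lam) (x : Vec d) {ε : ℝ} (hε : 0 < ε) :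
    ∃ δ > 0, ∀ z, dist z x < δ → S.G cl lam z ⊆ Metric.thickening ε (S.G cl lam x) := by
  have h := hG.usc x _ (Metric.isOpen_thickening.mem_nhdsSet.2
    (Metric.self_subset_thickening hε (S.G cl lam x)))
  obtain ⟨δ, hδ, hδ'⟩ := Metric.eventually_nhds_iff.1 h
  exact ⟨δ, hδ, fun z hz => subset_of_mem_nhdsSet (hδ' hz)⟩

/-- The supersolution property yields, from every limit of starting points, a trajectory of the
convexified augmented system along which `u` plus the cost does not increase. -/
lemma exists_limit_trajectory (hF : S.HF P) (hL : S.HL P cl lam) (hG : S.HG cl lam)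
    (hsup : IsSupersolution T S.HamF u) {t₀ : ℝ} {x₀ : Vec d} {u₀ : ℝ} (ht₀ : 0 ≤ t₀)
    {t : ℕ → ℝ} {x : ℕ → Vec d} (ht : ∀ N, 0 < t N ∧ t₀ ≤ t N ∧ t N < T) (htlim : Tendsto t atTop (𝓝 t₀))
    (hx : ∀ N, ‖x N‖ ≤ ‖x₀‖ + 1) (hxlim : Tendsto x atTop (𝓝 x₀))
    (hul : ∀ N : ℕ, u (t N) (x N) ≤ u₀ + 1 / ((N : ℝ) + 1)) :
    ∃ (K : NNReal) (Y : ℝ → Vec d × ℝ), LipschitzWith K Y ∧ Y t₀ = (x₀, 0) ∧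
      (∀ s ∈ Ioo t₀ T, DifferentiableAt ℝ Y s → deriv Y s ∈ S.G cl lam (Y s).1) ∧
      ∀ s ∈ Ioo t₀ T, u s (Y s).1 ≤ u₀ + (Y s).2 := by
  obtain ⟨cf, hcf, hgrow⟩ := hF.growth
  have hf : ∀ x, ∀ α ∈ S.A, ‖S.f x α‖ ≤ cf * (1 + ‖x‖) := fun x α hα =>
    hgrow x _ (mem_image_of_mem _ hα)
  have hℓ : ∀ x, ∀ α ∈ S.A, 0 ≤ S.ℓ x α := fun x α hα => (hL.le_bound hα).1
  have hA : S.A.Nonempty := (hF.nonempty 0).of_image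
  have hT : 0 < T := (ht 0).1.trans (ht 0).2.2
  let η : ℕ → ℝ := fun N => 1 / ((N : ℝ) + 1)
  have hη : ∀ N, 0 < η N := fun N => by simp only [η]; positivity
  have hη1 : ∀ N, η N ≤ 1 := fun N => by
    simp only [η]; rw [div_le_one (by positivity)]; linarith [N.cast_nonneg (α := ℝ)]
  have hηlim : Tendsto η atTop (𝓝 0) := tendsto_one_div_add_atTop_nhds_zero_nat
  choose h hh hhη Z α hα hZ hR hval using fun N =>
    exists_euler_polygon hsup hcf hf hℓ hA (ht N).1 (ht N).2.2 (x N) (hη N) (hη1 N)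
  let V : ℕ → ℕ → Vec d × ℝ := fun N j => S.augVelocity (Z N j) (α N j)
  -- Velocities after time `T` are replaced by zero, since no bound on the polygon is available
  -- there.
  let V' : ℕ → ℕ → Vec d × ℝ := fun N j => if t N + j * h N ≤ T then V N j else 0
  let R : ℝ := (‖x₀‖ + 1 + 2) * Real.exp (cf * T)
  have hR0 : 0 ≤ R := by positivity
  let M : ℝ := max (cf * (1 + (R + 1))) (cl * (1 + (R + 1) ^ lam))
  have hM0 : 0 ≤ M := le_max_of_le_left (by positivity)
  have hlam : 0 ≤ lam := zero_le_one.trans hL.one_le_lam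
  have hV' : ∀ N i, ‖V' N i‖ ≤ M := by
    intro N i
    simp only [V']
    split_ifs with hi
    · have h1 := hR N i hi
      have h2 : ‖Z N i‖ ≤ R + 1 := by
        have h3 := norm_le_norm_add_norm_sub' (Z N i) (polygon (x N, (0 : ℝ)) (h N) (V N) i).1
        have h4 := (hZ N i).trans (hη1 N)
        have h5 : (‖x N‖ + 2) * Real.exp (cf * T) ≤ R := by
          simp only [R]; have := hx N; gcongr
        simp only [V] at h3
        linarith
      refine norm_prod_le_iff.2 ⟨?_, ?_⟩
      · exact (hf _ _ (hα N i)).trans (le_max_of_le_left (by gcongr))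
      · have h6 := hL.le_bound (x := Z N i) (hα N i)
        simp only [V, ControlProblem.augVelocity, norm_neg]
        rw [Real.norm_of_nonneg h6.1]
        refine h6.2.trans (le_max_of_le_right ?_)
        have := hL.cl_pos.le
        gcongr
    · simpa using hM0
  have hcongr : ∀ (N i : ℕ), (∀ j < i, t N + (j : ℝ) * h N ≤ T) →
      polygon (x N, (0 : ℝ)) (h N) (V N) i = polygon (x N, (0 : ℝ)) (h N) (V' N) i :=
    fun N i hi => polygon_congr fun j hj => by simp only [V', if_pos (hi j hj)]
  have hhlim : Tendsto h atTop (𝓝 0) :=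
    squeeze_zero (fun N => (hh N).le) hhη hηlim
  let U : Ultrafilter ℕ := hyperfilter ℕ
  have hU : (U : Filter ℕ) ≤ atTop := Nat.hyperfilter_le_atTop
  let pp : ℕ → ℝ → Vec d × ℝ := fun N => polygonPath (t N) (h N) (x N, (0 : ℝ)) (V' N)
  have hlim : ∀ s, ∃ Y : Vec d × ℝ, Tendsto (fun N => pp N s) U (𝓝 Y) := fun s =>
    exists_polygonPath_tendsto U (b := max (max 1 T) (‖x₀‖ + 1)) hh
      (fun N => ((hhη N).trans (hη1 N)).trans ((le_max_left _ _).trans (le_max_left _ _)))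
      (fun N => by rw [abs_of_pos (ht N).1]; exact (ht N).2.2.le.trans ((le_max_right _ _).trans (le_max_left _ _)))
      (fun N => (norm_prod_le_iff.2 ⟨hx N, by simp; positivity⟩ : ‖(x N, (0 : ℝ))‖ ≤ ‖x₀‖ + 1).trans (le_max_right _ _))
      hV' s
  choose Y hY using hlim
  have hLip := lipschitzWith_of_polygonPath_tendsto (l := (U : Filter ℕ)) hh (hhlim.mono_left hU) hV' hY
  have hgrid : ∀ N (i : ℕ), pp N (t N + i * h N) = polygon (x N, (0 : ℝ)) (h N) (V' N) i := by
    intro N i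
    have : (t N + i * h N - t N) / h N = i := by have := (hh N).ne'; field_simp; ring
    simp only [pp, polygonPath, this, Nat.floor_natCast]
  have hclose : ∀ N (r s : ℝ), ‖pp N r - pp N s‖ ≤ M * (|r - s| + h N) := by
    intro N r s
    rcases le_total s r with hsr | hsr
    · rw [abs_of_nonneg (sub_nonneg.2 hsr)]; exact norm_polygonPath_sub_le (hh N) (hV' N) hsr
    · rw [abs_of_nonpos (sub_nonpos.2 hsr), norm_sub_rev, neg_sub]
      exact norm_polygonPath_sub_le (hh N) (hV' N) hsr
  refine ⟨M.toNNReal, Y, hLip, ?_, ?_, ?_⟩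
  · refine tendsto_nhds_unique (hY t₀) ?_
    -- The grids start at `t N ≥ t₀`, and the natural floor of a nonpositive number is 0.
    have h1 : ∀ N, pp N t₀ = (x N, 0) := by
      intro N
      have : (t₀ - t N) / h N ≤ 0 := div_nonpos_of_nonpos_of_nonneg (by linarith [(ht N).2.1]) (hh N).le
      simp [pp, polygonPath, polygon, Nat.floor_of_nonpos this]
    simp only [h1]
    exact (hxlim.mono_left hU).prodMk_nhds tendsto_const_nhds
  · intro s hs hd
    have hcl : closure (S.G cl lam (Y s).1) = S.G cl lam (Y s).1 :=
      (hG.isCompact _).isClosed.closure_eq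
    -- Each closed thickening of the value of `G` is closed and convex and, by upper semicontinuity,
    -- contains the velocities of the polygons near time `s`, for most indices along the
    -- ultrafilter.
    rw [← hcl, Metric.closure_eq_iInter_cthickening]
    refine mem_iInter₂.2 fun ε hε => ?_
    obtain ⟨δ, hδ, hδG⟩ := hG.exists_thickening (Y s).1 hε
    let ρ : ℝ := min (δ / (4 * (M + 1))) ((T - s) / 2)
    have hρ : 0 < ρ := lt_min (by positivity) (by linarith [hs.2])
    have hρδ : M * ρ ≤ δ / 4 := by
      have h1 : ρ ≤ δ / (4 * (M + 1)) := min_le_left _ _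
      rw [le_div_iff₀ (by positivity)] at h1
      nlinarith [hρ]
    refine deriv_mem_of_polygonPath_tendsto (l := (U : Filter ℕ)) hh (hhlim.mono_left hU)
      (htlim.mono_left hU) hY ((hG.convex _).cthickening ε) Metric.isClosed_cthickening hs.1 hρ ?_ hd
    have e1 : ∀ᶠ N in (U : Filter ℕ), ‖pp N s - Y s‖ < δ / 4 := by
      have := tendsto_iff_norm_sub_tendsto_zero.1 (hY s)
      exact this.eventually_lt_const (by positivity)
    have e2 : ∀ᶠ N in (U : Filter ℕ), M * h N < δ / 4 := by
      have : Tendsto (fun N => M * h N) U (𝓝 (M * 0)) := (hhlim.mono_left hU).const_mul M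
      rw [mul_zero] at this
      exact this.eventually_lt_const (by positivity)
    have e3 : ∀ᶠ N in (U : Filter ℕ), η N < δ / 4 :=
      (hηlim.mono_left hU).eventually_lt_const (by positivity)
    filter_upwards [e1, e2, e3] with N h1 h2 h3 i hi
    have hiT : t N + i * h N ≤ T := by
      have h4 := (abs_le.1 hi).2
      have h5 : ρ ≤ (T - s) / 2 := min_le_right _ _
      linarith [hs.2]
    have hV'V : V' N i = V N i := by simp only [V', if_pos hiT]
    rw [hV'V]
    refine Metric.thickening_subset_cthickening _ _ (hδG (Z N i) ?_ (hL.augVelocity_mem (hα N i)))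
    have hjT : ∀ j < i, t N + (j : ℝ) * h N ≤ T := fun j hj => by
      have : (j : ℝ) ≤ i := by exact_mod_cast hj.le
      have := mul_le_mul_of_nonneg_right this (hh N).le
      linarith
    have h6 : ‖Z N i - (pp N (t N + i * h N)).1‖ ≤ η N := by
      rw [hgrid, ← hcongr N i hjT]; exact hZ N i
    have h7 : ‖(pp N (t N + i * h N)).1 - (pp N s).1‖ ≤ M * (ρ + h N) := by
      refine (norm_fst_le (pp N (t N + i * h N) - pp N s)).trans ((hclose _ _ _).trans ?_)
      gcongr
    have h8 : ‖(pp N s).1 - (Y s).1‖ < δ / 4 := (norm_fst_le (pp N s - Y s)).trans_lt h1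
    rw [dist_eq_norm]
    have h9 : Z N i - (Y s).1 = (Z N i - (pp N (t N + i * h N)).1) +
        ((pp N (t N + i * h N)).1 - (pp N s).1) + ((pp N s).1 - (Y s).1) := by abel
    rw [h9]
    refine (norm_add₃_le).trans_lt ?_
    rw [mul_add] at h7
    linarith
  · intro s hs
    let i : ℕ → ℕ := fun N => ⌊(s - t N) / h N⌋₊
    have htgrid : Tendsto (fun N => t N + i N * h N) U (𝓝 s) := by
      have := (htlim.mono_left hU).add
        (tendsto_floor_mul hh (hhlim.mono_left hU) (htlim.mono_left hU) hs.1)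
      simpa [i, mul_comm] using this
    have hev : ∀ᶠ N in (U : Filter ℕ), t N + i N * h N ≤ s := by
      filter_upwards [(htlim.mono_left hU).eventually_lt_const hs.1] with N hN
      have h4 := Nat.floor_le (div_nonneg (sub_nonneg.2 hN.le) (hh N).le)
      rw [le_div_iff₀ (hh N)] at h4
      simp only [i]
      linarith
    have hevη : ∀ᶠ N in (U : Filter ℕ), η N < T - s :=
      (hηlim.mono_left hU).eventually_lt_const (sub_pos.2 hs.2)
    have hex : ∀ᶠ N in (U : Filter ℕ), ∃ w : ℝ × Vec d, w.1 ∈ Ioc 0 T ∧ |w.1 - (t N + i N * h N)| ≤ η N ∧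
        ‖w.2 - (pp N s).1‖ ≤ η N ∧ u w.1 w.2 ≤ u₀ + η N + (pp N s).2 + T * η N := by
      filter_upwards [hev, hevη] with N h1 h2
      obtain ⟨r, hr, z, h3, h4, h5⟩ := hval N (i N) (by linarith)
      have hjT : ∀ j < i N, t N + (j : ℝ) * h N ≤ T := fun j hj => by
        have : (j : ℝ) ≤ i N := by exact_mod_cast hj.le
        have := mul_le_mul_of_nonneg_right this (hh N).le
        linarith [hs.2]
      have h6 := hcongr N (i N) hjT
      simp only [V] at h6
      rw [h6] at h4 h5
      refine ⟨(r, z), hr, h3, h4, h5.trans ?_⟩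
      have := hul N
      simp only [pp, polygonPath, η]
      gcongr
    obtain ⟨w, hw⟩ := hex.choice
    have hw1 : Tendsto (fun N => (w N).1) U (𝓝 s) := by
      refine htgrid.congr_dist ?_
      refine squeeze_zero' (Eventually.of_forall fun _ => dist_nonneg) ?_ (hηlim.mono_left hU)
      filter_upwards [hw] with N hN
      rw [dist_comm, Real.dist_eq]; exact hN.2.1
    have hw2 : Tendsto (fun N => (w N).2) U (𝓝 (Y s).1) := by
      refine ((continuous_fst.tendsto _).comp (hY s)).congr_dist ?_
      refine squeeze_zero' (Eventually.of_forall fun _ => dist_nonneg) ?_ (hηlim.mono_left hU)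
      filter_upwards [hw] with N hN
      rw [dist_comm, dist_eq_norm]; exact hN.2.2.1
    have hwt : Tendsto w U (𝓝[Ioc 0 T ×ˢ univ] (s, (Y s).1)) := by
      refine tendsto_nhdsWithin_iff.2 ⟨hw1.prodMk_nhds hw2, ?_⟩
      filter_upwards [hw] with N hN
      exact ⟨hN.1, mem_univ _⟩
    have hlimR : Tendsto (fun N => u₀ + η N + (pp N s).2 + T * η N) U (𝓝 (u₀ + 0 + (Y s).2 + T * 0)) :=
      (((hηlim.mono_left hU).const_add _).add ((continuous_snd.tendsto _).comp (hY s))).add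
        ((hηlim.mono_left hU).const_mul _)
    simp only [add_zero, mul_zero] at hlimR
    refine le_of_forall_lt fun c hc => ?_
    obtain ⟨c', hcc', hc'⟩ := exists_between hc
    have hl := hwt.eventually (hsup.1 (s, (Y s).1) ⟨⟨ht₀.trans_lt hs.1, hs.2.le⟩, mem_univ _⟩ c' hc')
    refine hcc'.trans_le (ge_of_tendsto hlimR ?_)
    filter_upwards [hl, hw] with N h1 h2
    exact h1.le.trans h2.2.2.2

end LimitTrajectory

section SuperOptimality

variable {d n : ℕ} {P : MultiDomain d} {S : ControlProblem d n} {T cl lam : ℝ} {u : ℝ → Vec d → ℝ}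

/-- Trajectories of the convexified augmented system come from measurable controls. -/
lemma exists_control_of_deriv_mem (hS : S.Regular) (hA : S.A.Nonempty) {t₀ : ℝ} {Y : ℝ → Vec d × ℝ}
    (hY : Continuous Y) (hd : ∀ᵐ s ∂volume.restrict (Ioo t₀ T), deriv Y s ∈ S.G cl lam (Y s).1) :
    ∃ α : ℝ → S.A, Measurable α ∧ ∀ᵐ s ∂volume.restrict (Ioo t₀ T),
      S.f (Y s).1 (α s) = (deriv Y s).1 ∧ S.ℓ (Y s).1 (α s) ≤ -(deriv Y s).2 := by
  have : StandardBorelSpace S.A := hS.isCompact_A.isClosed.measurableSet.standardBorel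
  have : Nonempty S.A := hA.to_subtype
  have hdm : Measurable (deriv Y) := measurable_deriv Y
  have hpair : Measurable fun z : ℝ × S.A => ((Y z.1).1, z.2) :=
    ((measurable_fst.comp hY.measurable).comp measurable_fst).prodMk measurable_snd
  have hB : MeasurableSet {z : ℝ × S.A | S.f (Y z.1).1 z.2 = (deriv Y z.1).1 ∧
      S.ℓ (Y z.1).1 z.2 ≤ -(deriv Y z.1).2} := by
    refine (measurableSet_eq_fun (hS.measurable_f.comp hpair)
      (measurable_fst.comp (hdm.comp measurable_fst))).inter
      (measurableSet_le (hS.measurable_ℓ.comp hpair)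
      (measurable_snd.comp (hdm.comp measurable_fst)).neg)
  obtain ⟨g, hg, hgB⟩ := exists_aemeasurable_selection (volume.restrict (Ioo t₀ T)) hB (by
    filter_upwards [hd] with s hs
    obtain ⟨a, ha, r, hr, -, he⟩ := hs
    exact ⟨⟨a, ha⟩, by simp [he], by simp [he, hr]⟩)
  refine ⟨hg.mk, hg.measurable_mk, ?_⟩
  filter_upwards [hgB, hg.ae_eq_mk] with s h1 h2
  rw [← h2]
  exact h1

/-- Starting points may approach `(t₀, x₀)` because the supersolution property says nothing at `t₀ =
0`; for `t₀ > 0` constant sequences serve. The slack `r` in `G` is harmless, as the true cost is at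
most minus the derivative of the last component. -/
lemma exists_superOptimal_trajectory (hS : S.Regular) (hF : S.HF P) (hL : S.HL P cl lam)
    (hG : S.HG cl lam) (hsup : IsSupersolution T S.HamF u) {t₀ : ℝ} {x₀ : Vec d} (ht₀ : t₀ ∈ Ico 0 T)
    {t : ℕ → ℝ} {x : ℕ → Vec d} (ht : ∀ N, 0 < t N ∧ t₀ ≤ t N ∧ t N < T) (htlim : Tendsto t atTop (𝓝 t₀))
    (hx : ∀ N, ‖x N‖ ≤ ‖x₀‖ + 1) (hxlim : Tendsto x atTop (𝓝 x₀))
    (hul : ∀ N : ℕ, u (t N) (x N) ≤ u t₀ x₀ + 1 / ((N : ℝ) + 1)) :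
    ∃ (y : ℝ → Vec d) (α : ℝ → Vec n), S.IsTrajectory T t₀ x₀ y α ∧
      IntervalIntegrable (fun s => S.ℓ (y s) (α s)) volume t₀ T ∧
      ∀ h ∈ Icc 0 (T - t₀),
        u t₀ x₀ ≥ u (t₀ + h) (y (t₀ + h)) + ∫ s in t₀..(t₀ + h), S.ℓ (y s) (α s) := by
  obtain ⟨K, Y, hLip, hY0, hYd, hYu⟩ :=
    exists_limit_trajectory hF hL hG hsup ht₀.1 ht htlim hx hxlim hul
  have hA : S.A.Nonempty := (hF.nonempty 0).of_image
  have hd : ∀ᵐ s ∂volume.restrict (Ioo t₀ T), deriv Y s ∈ S.G cl lam (Y s).1 := by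
    rw [ae_restrict_iff' measurableSet_Ioo]
    filter_upwards [hLip.ae_differentiableAt_real] with s hs hsI
    exact hYd s hsI hs
  obtain ⟨α, hα, hαY⟩ := exists_control_of_deriv_mem hS hA hLip.continuous hd
  have hαI : ∀ s ∈ Icc t₀ T, ∀ᵐ r ∂volume.restrict (Ioc t₀ s),
      S.f (Y r).1 (α r) = (deriv Y r).1 ∧ S.ℓ (Y r).1 (α r) ≤ -(deriv Y r).2 := by
    intro s hs
    rw [← restrict_Ioo_eq_restrict_Ioc]
    exact ae_restrict_of_ae_restrict_of_subset (Ioo_subset_Ioo_right hs.2) hαY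
  have hmeas : ∀ {E : Type} [MeasurableSpace E] {g : Vec d → Vec n → E},
      (Measurable fun z : Vec d × S.A => g z.1 z.2) → Measurable fun s => g (Y s).1 (α s) := by
    intro E _ g hg
    exact hg.comp ((measurable_fst.comp hLip.continuous.measurable).prodMk hα)
  have hI : ∀ s, IntervalIntegrable (deriv Y) volume t₀ s := fun s =>
    (hLip.intervalIntegral_deriv_eq_sub t₀ s).1
  have hI1 : ∀ s, IntervalIntegrable (fun r => (deriv Y r).1) volume t₀ s := fun s =>
    (hI s).mono_fun (measurable_fst.comp (measurable_deriv Y)).aestronglyMeasurable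
      (Eventually.of_forall fun r => norm_fst_le _)
  have hI2 : ∀ s, IntervalIntegrable (fun r => -(deriv Y r).2) volume t₀ s := fun s =>
    ((hI s).mono_fun (g := fun r => (deriv Y r).2)
      (measurable_snd.comp (measurable_deriv Y)).aestronglyMeasurable
      (Eventually.of_forall fun r => norm_snd_le _)).neg
  have hint1 : ∀ s, ∫ r in t₀..s, (deriv Y r).1 = (Y s).1 - x₀ := fun s => by
    have h1 := (ContinuousLinearMap.fst ℝ (Vec d) ℝ).intervalIntegral_comp_comm (hI s)
    rw [(hLip.intervalIntegral_deriv_eq_sub t₀ s).2, hY0] at h1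
    simpa using h1
  have hint2 : ∀ s, ∫ r in t₀..s, -(deriv Y r).2 = -(Y s).2 := fun s => by
    have h1 := (ContinuousLinearMap.snd ℝ (Vec d) ℝ).intervalIntegral_comp_comm (hI s)
    rw [(hLip.intervalIntegral_deriv_eq_sub t₀ s).2, hY0] at h1
    rw [intervalIntegral.integral_neg]
    simpa using h1
  have hfI : ∀ s ∈ Icc t₀ T, (∀ᵐ r ∂volume.restrict (uIoc t₀ s), (deriv Y r).1 = S.f (Y r).1 (α r)) ∧
      ∀ᵐ r ∂volume.restrict (uIoc t₀ s), S.ℓ (Y r).1 (α r) ≤ -(deriv Y r).2 := fun s hs => by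
    rw [uIoc_of_le hs.1]
    exact ⟨(hαI s hs).mono fun r hr => hr.1.symm, (hαI s hs).mono fun r hr => hr.2⟩
  have hTI : T ∈ Icc t₀ T := ⟨ht₀.2.le, le_rfl⟩
  have hℓI : ∀ s ∈ Icc t₀ T, IntervalIntegrable (fun r => S.ℓ (Y r).1 (α r)) volume t₀ s := fun s hs => by
    refine (hI2 s).mono_fun (hmeas hS.measurable_ℓ).aestronglyMeasurable ?_
    filter_upwards [(hfI s hs).2] with r hr
    rw [Real.norm_of_nonneg (hL.le_bound (α r).2).1]
    exact hr.trans (le_abs_self _)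
  have hfint : ∀ s ∈ Icc t₀ T, ∫ r in t₀..s, S.f (Y r).1 (α r) = (Y s).1 - x₀ := fun s hs => by
    rw [← hint1]
    refine intervalIntegral.integral_congr_ae_restrict ?_
    exact (hfI s hs).1.mono fun r hr => hr.symm
  have hℓint : ∀ s ∈ Icc t₀ T, ∫ r in t₀..s, S.ℓ (Y r).1 (α r) ≤ -(Y s).2 := fun s hs => by
    rw [← hint2]
    refine intervalIntegral.integral_mono_ae_restrict hs.1 (hℓI s hs) (hI2 s) ?_
    rw [← Measure.restrict_congr_set Ioc_ae_eq_Icc]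
    exact (hαI s hs).mono fun r hr => hr.2
  have hend : ∀ s ∈ Ioc t₀ T, u s (Y s).1 ≤ u t₀ x₀ + (Y s).2 := by
    intro s hs
    rcases hs.2.lt_or_eq with hsT | rfl
    · exact hYu s ⟨hs.1, hsT⟩
    -- The final time is reached from the left by lower semicontinuity.
    refine le_of_forall_lt fun c hc => ?_
    obtain ⟨c', hcc', hc'⟩ := exists_between hc
    have hl := hsup.1 (s, (Y s).1) ⟨⟨ht₀.1.trans_lt hs.1, le_rfl⟩, mem_univ _⟩ c' hc'
    have hlim : Tendsto (fun r : ℝ => (r, (Y r).1)) (𝓝[<] s) (𝓝[Ioc 0 s ×ˢ univ] (s, (Y s).1)) := by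
      refine tendsto_nhdsWithin_iff.2 ⟨?_, ?_⟩
      · exact ((continuous_id.prodMk (continuous_fst.comp hLip.continuous)).tendsto s).mono_left
          nhdsWithin_le_nhds
      · filter_upwards [Ioo_mem_nhdsLT hs.1] with r hr
        exact ⟨⟨ht₀.1.trans_lt hr.1, hr.2.le⟩, mem_univ _⟩
    have hR : Tendsto (fun r : ℝ => u t₀ x₀ + (Y r).2) (𝓝[<] s) (𝓝 (u t₀ x₀ + (Y s).2)) :=
      ((continuous_const.add (continuous_snd.comp hLip.continuous)).tendsto s).mono_left nhdsWithin_le_nhds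
    refine hcc'.trans_le (ge_of_tendsto hR ?_)
    filter_upwards [hlim.eventually hl, Ioo_mem_nhdsLT hs.1] with r h1 h2
    exact h1.le.trans (hYu r h2)
  refine ⟨fun s => (Y s).1, fun s => α s, ⟨⟨?_, ?_⟩, ?_, ?_⟩, hℓI T hTI, ?_⟩
  · exact (measurable_subtype_coe.comp hα).aemeasurable
  · exact Eventually.of_forall fun s => (α s).2
  · exact (hI1 T).congr_ae (hfI T hTI).1
  · intro s hs
    rw [hfint s hs]
    abel
  · intro h hh
    rcases hh.1.eq_or_lt with rfl | h0
    · simp [hY0]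
    · have hs : t₀ + h ∈ Ioc t₀ T := ⟨by linarith, by linarith [hh.2]⟩
      have h1 := hend _ hs
      have h2 := hℓint _ ⟨hs.1.le, hs.2⟩
      simp only [ge_iff_le]
      linarith

lemma superOptimal_Ioc_of_isSupersolution (hS : S.Regular) (hF : S.HF P) (hL : S.HL P cl lam)
    (hG : S.HG cl lam) (hsup : IsSupersolution T S.HamF u) : S.SuperOptimal T (Ioc 0 T) u := by
  intro t₀ ht₀ x₀
  rcases ht₀.2.lt_or_eq with hlt | rfl
  · exact exists_superOptimal_trajectory hS hF hL hG hsup (t := fun _ => t₀) (x := fun _ => x₀)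
      ⟨ht₀.1.le, hlt⟩ (fun _ => ⟨ht₀.1, le_rfl, hlt⟩) tendsto_const_nhds (fun _ => by linarith)
      tendsto_const_nhds (fun N => by simp; positivity)
  · obtain ⟨a, ha⟩ : S.A.Nonempty := (hF.nonempty 0).of_image
    refine ⟨fun _ => x₀, fun _ => a, ⟨⟨aemeasurable_const, Eventually.of_forall fun _ => ha⟩, ?_, ?_⟩, ?_, ?_⟩
    · simp
    · intro s hs
      obtain rfl : s = t₀ := le_antisymm hs.2 hs.1
      simp
    · simp
    · intro h hh
      obtain rfl : h = 0 := le_antisymm (by simpa using hh.2) hh.1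
      simp

lemma superOptimal_Icc_of_isSupersolution (hT : 0 < T) (hS : S.Regular) (hF : S.HF P)
    (hL : S.HL P cl lam) (hG : S.HG cl lam) (hsup : IsSupersolution T S.HamF u)
    (hinit : InitialTimeRegular u) : S.SuperOptimal T (Icc 0 T) u := by
  intro t₀ ht₀ x₀
  rcases ht₀.1.lt_or_eq with h0 | rfl
  · exact superOptimal_Ioc_of_isSupersolution hS hF hL hG hsup t₀ ⟨h0, ht₀.2⟩ x₀
  have hex : ∀ N : ℕ, ∃ z : ℝ × Vec d, 0 < z.1 ∧ z.1 < T ∧ dist z (0, x₀) < 1 / ((N : ℝ) + 1) ∧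
      u z.1 z.2 < u 0 x₀ + 1 / ((N : ℝ) + 1) := by
    intro N
    have hN : (0 : ℝ) < 1 / ((N : ℝ) + 1) := by positivity
    have h1 : ∀ᶠ z in 𝓝[Ioi 0 ×ˢ univ] ((0 : ℝ), x₀), dist z (0, x₀) < min T (1 / ((N : ℝ) + 1)) ∧
        z ∈ Ioi (0 : ℝ) ×ˢ (univ : Set (Vec d)) :=
      (eventually_nhdsWithin_of_eventually_nhds (Metric.ball_mem_nhds _ (lt_min hT hN))).and
        self_mem_nhdsWithin
    obtain ⟨z, hz1, hz2, hz3⟩ := ((hinit x₀ _ hN).and_eventually h1).exists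
    refine ⟨z, hz3.1, ?_, hz2.trans_le (min_le_right _ _), hz1⟩
    have h2 : dist z.1 0 ≤ dist z (0, x₀) := by rw [Prod.dist_eq]; exact le_max_left _ _
    rw [Real.dist_eq, sub_zero] at h2
    exact (le_abs_self _).trans_lt (h2.trans_lt (hz2.trans_le (min_le_left _ _)))
  choose z hz0 hzT hzd hzu using hex
  have hlim : Tendsto z atTop (𝓝 (0, x₀)) := by
    rw [tendsto_iff_dist_tendsto_zero]
    exact squeeze_zero (fun _ => dist_nonneg) (fun N => (hzd N).le)
      tendsto_one_div_add_atTop_nhds_zero_nat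
  refine exists_superOptimal_trajectory hS hF hL hG hsup (t := fun N => (z N).1) (x := fun N => (z N).2)
    ⟨le_rfl, hT⟩ (fun N => ⟨hz0 N, (hz0 N).le, hzT N⟩) ((continuous_fst.tendsto _).comp hlim) (fun N => ?_)
    ((continuous_snd.tendsto _).comp hlim) (fun N => (hzu N).le)
  have h1 : dist (z N).2 x₀ ≤ dist (z N) (0, x₀) := by rw [Prod.dist_eq]; exact le_max_right _ _
  have h2 : (1 : ℝ) / ((N : ℝ) + 1) ≤ 1 := by
    rw [div_le_one (by positivity)]; linarith [N.cast_nonneg (α := ℝ)]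
  have h3 := norm_le_norm_add_norm_sub' (z N).2 x₀
  rw [dist_eq_norm] at h1
  linarith [hzd N]

lemma IsSupersolution.mono {H H' : Vec d → Vec d → EReal} (hH : ∀ x p, H x p ≤ H' x p)
    (h : IsSupersolution T H u) : IsSupersolution T H' u :=
  ⟨h.1, fun t ht x φ hφ hmin => (h.2 t ht x φ hφ hmin).trans (by gcongr; exact hH _ _)⟩

lemma ControlProblem.HamE_le_HamF (x p : Vec d) : S.HamE P x p ≤ S.HamF x p :=
  biSup_mono fun _ ha => ha.1

lemma ControlProblem.SuperOptimal.mono {I J : Set ℝ} (hIJ : I ⊆ J) (h : S.SuperOptimal T J u) :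
    S.SuperOptimal T I u := fun t ht x => h t (hIJ ht) x

end SuperOptimality

/-! ### Planar curves with one-sided increment bounds. -/

section PlanarCurves

lemma ContinuousOn.exists_left_forall_pos {y : ℝ → ℝ} {h₀ τ : ℝ} (hy : ContinuousOn y (Icc 0 h₀))
    (hτ : τ ∈ Ioc 0 h₀) (hpos : 0 < y τ) : ∃ s ∈ Ico 0 τ, ∀ r ∈ Icc s τ, 0 < y r := by
  have h1 : ∀ᶠ r in 𝓝[Icc 0 h₀] τ, 0 < y r :=
    (hy τ ⟨hτ.1.le, hτ.2⟩).eventually (lt_mem_nhds hpos)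
  obtain ⟨δ, hδ, hball⟩ := Metric.mem_nhdsWithin_iff.1 h1
  refine ⟨max 0 (τ - δ / 2), ⟨le_max_left _ _, max_lt hτ.1 (by linarith)⟩, fun r hr => ?_⟩
  have h2 := (le_max_left 0 (τ - δ / 2)).trans hr.1
  have h3 := (le_max_right 0 (τ - δ / 2)).trans hr.1
  refine hball ⟨?_, h2, hr.2.trans hτ.2⟩
  rw [Metric.mem_ball, Real.dist_eq, abs_lt]
  constructor <;> linarith [hr.2]

/-- A continuous function without zeros on a connected set has a constant sign there. -/
lemma ContinuousOn.sign_const_of_ne_zero {y : ℝ → ℝ} {I : Set ℝ} (hy : ContinuousOn y I)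
    (hI : IsPreconnected I) (hne : ∀ r ∈ I, y r ≠ 0) : (∀ r ∈ I, 0 < y r) ∨ ∀ r ∈ I, y r < 0 := by
  by_contra! h
  obtain ⟨⟨a, ha, hya⟩, b, hb, hyb⟩ := h
  obtain ⟨r, hr, hr0⟩ := hI.intermediate_value ha hb hy ⟨hya, hyb⟩
  exact hne r hr hr0

/-- The leftmost minimum point must be 0, as `hleft` would push any other one further left. -/
lemma ContinuousOn.apply_zero_le_of_forall_exists_left {W : ℝ → ℝ} {h₀ : ℝ}
    (hW : ContinuousOn W (Icc 0 h₀)) (hleft : ∀ τ ∈ Ioc 0 h₀, ∃ s ∈ Ico 0 τ, W s ≤ W τ)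
    {s : ℝ} (hs : s ∈ Icc 0 h₀) : W 0 ≤ W s := by
  have hne : (Icc 0 h₀).Nonempty := ⟨s, hs⟩
  obtain ⟨m, hm, hmin⟩ := isCompact_Icc.exists_isMinOn hne hW
  have hK : IsCompact (Icc 0 h₀ ∩ W ⁻¹' {W m}) :=
    isCompact_Icc.of_isClosed_subset (hW.preimage_isClosed_of_isClosed isClosed_Icc isClosed_singleton)
      inter_subset_left
  obtain ⟨τ, ⟨hτ, hτm⟩, hleast⟩ := hK.exists_isLeast ⟨m, hm, rfl⟩
  rcases hτ.1.eq_or_lt with h0 | h0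
  · rw [h0, hτm]; exact hmin hs
  · obtain ⟨r, hr, hrW⟩ := hleft τ ⟨h0, hτ.2⟩
    have hrI : r ∈ Icc 0 h₀ := ⟨hr.1, hr.2.le.trans hτ.2⟩
    have : W r = W m := le_antisymm (hrW.trans hτm.le) (hmin hrI)
    exact absurd (hleast ⟨hrI, this⟩) (not_le.2 hr.2)

variable {y₁ y₂ Ψ : ℝ → ℝ} {h₀ : ℝ}

/-- Two linear estimates with the same coefficient `c` glue into one for a function that is
continuous across the line `y₁ = 0`. The zeros of `y₁` may accumulate, so the time interval is not
cut into excursions: it is enough that the defect `W` takes, to the left of every positive time, a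
value that is no larger. -/
lemma piecewise_linear_le_of_increments (hy₁ : ContinuousOn y₁ (Icc 0 h₀)) (hy₂ : ContinuousOn y₂ (Icc 0 h₀))
    (hΨ : ContinuousOn Ψ (Icc 0 h₀)) (h1 : y₁ 0 = 0) (h2 : y₂ 0 = 0) (h3 : Ψ 0 = 0)
    (hpos : ∀ s ∈ Ioc 0 h₀, y₁ s ≤ 0 → 0 < y₂ s) {p q c : ℝ}
    (hp : ∀ s t, 0 ≤ s → s ≤ t → t ≤ h₀ → (∀ r ∈ Ioo s t, 0 < y₁ r) →
      p * (y₁ t - y₁ s) + c * (y₂ t - y₂ s) ≤ Ψ t - Ψ s)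
    (hq : ∀ s t, 0 ≤ s → s ≤ t → t ≤ h₀ → (∀ r ∈ Ioo s t, 0 < y₂ r) →
      q * (y₁ t - y₁ s) + c * (y₂ t - y₂ s) ≤ Ψ t - Ψ s) {s : ℝ} (hs : s ∈ Icc 0 h₀) :
    p * max (y₁ s) 0 + q * min (y₁ s) 0 + c * y₂ s ≤ Ψ s := by
  let W : ℝ → ℝ := fun s => Ψ s - (p * max (y₁ s) 0 + q * min (y₁ s) 0 + c * y₂ s)
  have hW : ContinuousOn W (Icc 0 h₀) := by
    refine hΨ.sub (((continuousOn_const.mul (hy₁.sup continuousOn_const)).add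
      (continuousOn_const.mul (hy₁.inf continuousOn_const))).add (continuousOn_const.mul hy₂))
  have hWp : ∀ s, 0 ≤ y₁ s → W s = Ψ s - (p * y₁ s + c * y₂ s) := fun s hs => by
    simp only [W, max_eq_left hs, min_eq_right hs, mul_zero, add_zero]
  have hWq : ∀ s, y₁ s ≤ 0 → W s = Ψ s - (q * y₁ s + c * y₂ s) := fun s hs => by
    simp only [W, max_eq_right hs, min_eq_left hs, mul_zero, zero_add]
  have key : W 0 ≤ W s := by
    refine hW.apply_zero_le_of_forall_exists_left (fun τ hτ => ?_) hs
    rcases lt_trichotomy (y₁ τ) 0 with hn | hz | hp'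
    · obtain ⟨a, ha, hay⟩ := hy₂.exists_left_forall_pos hτ (hpos τ hτ hn.le)
      obtain ⟨b, hb, hby⟩ := hy₁.neg.exists_left_forall_pos hτ (by simpa using hn)
      have hb' : ∀ r ∈ Icc b τ, y₁ r < 0 := fun r hr => by simpa using hby r hr
      have hm : max a b ∈ Icc b τ := ⟨le_max_right _ _, max_le ha.2.le hb.2.le⟩
      refine ⟨max a b, ⟨le_max_of_le_left ha.1, max_lt ha.2 hb.2⟩, ?_⟩
      have := hq (max a b) τ (le_max_of_le_left ha.1) hm.2 hτ.2
        (fun r hr => hay r ⟨(le_max_left _ _).trans hr.1.le, hr.2.le⟩)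
      rw [hWq _ hn.le, hWq _ (hb' _ hm).le]
      linarith
    · obtain ⟨a, ha, hay⟩ := hy₂.exists_left_forall_pos hτ (hpos τ hτ hz.le)
      have hcont : ContinuousOn y₁ (Icc a τ) := hy₁.mono (Icc_subset_Icc ha.1 hτ.2)
      -- Either `y₁` has another zero just to the left, and the `q` estimate compares the two zeros,
      -- or its sign is constant there and tells which estimate to use.
      by_cases hex : ∃ r ∈ Ioo a τ, y₁ r = 0
      · obtain ⟨r, hr, hr0⟩ := hex
        refine ⟨r, ⟨ha.1.trans hr.1.le, hr.2⟩, ?_⟩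
        have := hq r τ (ha.1.trans hr.1.le) hr.2.le hτ.2 (fun r' hr' => hay r' ⟨(hr.1.trans hr'.1).le, hr'.2.le⟩)
        rw [hWq _ hz.le, hWq _ hr0.le]
        linarith
      · push Not at hex
        obtain ⟨m, hm⟩ := nonempty_Ioo.2 ha.2
        have hm0 : 0 ≤ m := ha.1.trans hm.1.le
        refine ⟨m, ⟨hm0, hm.2⟩, ?_⟩
        rcases (hcont.mono Ioo_subset_Icc_self).sign_const_of_ne_zero isPreconnected_Ioo hex with hs | hs
        · have := hp m τ hm0 hm.2.le hτ.2 (fun r hr => hs r ⟨hm.1.trans hr.1, hr.2⟩)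
          rw [hWp _ hz.ge, hWp _ (hs m hm).le]
          linarith
        · have := hq m τ hm0 hm.2.le hτ.2 (fun r hr => hay r ⟨(hm.1.trans hr.1).le, hr.2.le⟩)
          rw [hWq _ hz.le, hWq _ (hs m hm).le]
          linarith
    · obtain ⟨a, ha, hay⟩ := hy₁.exists_left_forall_pos hτ hp'
      refine ⟨a, ha, ?_⟩
      have := hp a τ ha.1 ha.2.le hτ.2 (fun r hr => hay r ⟨hr.1.le, hr.2.le⟩)
      rw [hWp _ hp'.le, hWp _ (hay a ⟨le_rfl, ha.2.le⟩).le]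
      linarith
  have h0 : W 0 = 0 := by simp [W, h1, h2, h3]
  simp only [W] at key h0
  linarith

/-- A planar curve cannot visit both positive half-axes if, globally and near each of them, a suitable
linear form of its increments is dominated by a function that is negative at positive times. -/
lemma planar_increments_contradiction (hy₁ : ContinuousOn y₁ (Icc 0 h₀))
    (hy₂ : ContinuousOn y₂ (Icc 0 h₀)) (hΨ : ContinuousOn Ψ (Icc 0 h₀)) (h1 : y₁ 0 = 0) (h2 : y₂ 0 = 0)
    (h3 : Ψ 0 = 0) (hneg : ∀ s ∈ Ioc 0 h₀, Ψ s < 0) {e₁ e₂ j₁ j₂ k₁ k₂ : ℝ} (he₁ : 0 < e₁) (he₂ : 0 < e₂)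
    (hj₁ : 0 ≤ j₁) (hk₂ : 0 ≤ k₂)
    (he : ∀ s t, 0 ≤ s → s ≤ t → t ≤ h₀ → -e₁ * (y₁ t - y₁ s) + -e₂ * (y₂ t - y₂ s) ≤ Ψ t - Ψ s)
    (hj : ∀ s t, 0 ≤ s → s ≤ t → t ≤ h₀ → (∀ r ∈ Ioo s t, 0 < y₁ r) →
      j₁ * (y₁ t - y₁ s) + j₂ * (y₂ t - y₂ s) ≤ Ψ t - Ψ s)
    (hk : ∀ s t, 0 ≤ s → s ≤ t → t ≤ h₀ → (∀ r ∈ Ioo s t, 0 < y₂ r) →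
      k₁ * (y₁ t - y₁ s) + k₂ * (y₂ t - y₂ s) ≤ Ψ t - Ψ s)
    {s₁ s₂ : ℝ} (hs₁ : s₁ ∈ Ioc 0 h₀) (hs₁0 : y₂ s₁ = 0) (hs₂ : s₂ ∈ Ioc 0 h₀) (hs₂0 : y₁ s₂ = 0) : False := by
  have hey : ∀ s ∈ Ioc 0 h₀, -e₁ * y₁ s + -e₂ * y₂ s ≤ Ψ s := fun s hs => by
    have := he 0 s le_rfl hs.1.le hs.2
    rwa [h1, h2, h3, sub_zero, sub_zero, sub_zero] at this
  have hpos : ∀ s ∈ Ioc 0 h₀, y₁ s ≤ 0 → 0 < y₂ s := fun s hs hy => by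
    have a1 := hey s hs
    have a2 := hneg s hs
    by_contra! hc
    nlinarith
  have hy₁s₁ : 0 < y₁ s₁ := by
    by_contra! hc
    exact (hpos s₁ hs₁ hc).ne' hs₁0
  -- If `j₂ ≤ -e₂`, the global form is used up to the last zero of `y₁` before `s₁`, and the form
  -- `j` after it; the sum gives `0 ≤ Ψ s₁`.
  rcases le_or_gt j₂ (-e₂) with hc | hc
  · have hK : IsCompact (Icc 0 s₁ ∩ y₁ ⁻¹' {0}) :=
      isCompact_Icc.of_isClosed_subset ((hy₁.mono (Icc_subset_Icc_right hs₁.2)).preimage_isClosed_of_isClosed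
        isClosed_Icc isClosed_singleton) inter_subset_left
    obtain ⟨σ, ⟨hσ, hσ0⟩, hgr⟩ := hK.exists_isGreatest ⟨0, ⟨le_rfl, hs₁.1.le⟩, h1⟩
    have hσ0 : y₁ σ = 0 := hσ0
    have hne : ∀ r ∈ Ioo σ s₁, y₁ r ≠ 0 := fun r hr h0 =>
      absurd (hgr ⟨⟨hσ.1.trans hr.1.le, hr.2.le⟩, h0⟩) (not_le.2 hr.1)
    have hσs : σ < s₁ := hσ.2.lt_of_ne fun h => by rw [h] at hσ0; exact hy₁s₁.ne' hσ0
    have hposI : ∀ r ∈ Ioo σ s₁, 0 < y₁ r := by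
      refine ((hy₁.mono (Ioo_subset_Icc_self.trans (Icc_subset_Icc hσ.1 hs₁.2))).sign_const_of_ne_zero
        isPreconnected_Ioo hne).resolve_right fun hn => ?_
      obtain ⟨a, ha, hay⟩ := hy₁.exists_left_forall_pos hs₁ hy₁s₁
      obtain ⟨m, hm⟩ := nonempty_Ioo.2 (max_lt ha.2 hσs)
      exact (hn m ⟨(le_max_right _ _).trans_lt hm.1, hm.2⟩).not_gt
        (hay m ⟨(le_max_left _ _).trans hm.1.le, hm.2.le⟩)
    have h4 := hj σ s₁ hσ.1 hσ.2 hs₁.2 hposI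
    rw [hσ0, hs₁0] at h4
    have h5 : 0 ≤ j₁ * y₁ s₁ := mul_nonneg hj₁ hy₁s₁.le
    have h6 := hneg s₁ hs₁
    rcases hσ.1.eq_or_lt with h0 | h0
    · rw [← h0, h2, h3] at h4
      linarith
    · have h7 := hey σ ⟨h0, hσ.2.trans hs₁.2⟩
      have h8 := hpos σ ⟨h0, hσ.2.trans hs₁.2⟩ hσ0.le
      rw [hσ0] at h7
      nlinarith
  -- Otherwise, of `j` and `k`, the form with the larger second coefficient is averaged with the
  -- global form until the second coefficients agree. The two estimates then glue, and evaluation at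
  -- `s₁` or `s₂` is contradictory.
  · rcases le_or_gt j₂ k₂ with hc' | hc'
    · obtain ⟨a, b, ha, hb, hab, hj2⟩ : ∃ a b : ℝ, 0 ≤ a ∧ 0 ≤ b ∧ a + b = 1 ∧ a * k₂ + b * (-e₂) = j₂ := by
        have hd : 0 < k₂ + e₂ := by linarith
        refine ⟨(j₂ + e₂) / (k₂ + e₂), (k₂ - j₂) / (k₂ + e₂), by apply div_nonneg <;> linarith,
          by apply div_nonneg <;> linarith, ?_, ?_⟩ <;> field_simp <;> ring
      have := piecewise_linear_le_of_increments hy₁ hy₂ hΨ h1 h2 h3 hpos (p := j₁) (q := a * k₁ + b * (-e₁)) (c := j₂)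
        hj (fun s t h0 hst ht hr => by
          have b1 := mul_le_mul_of_nonneg_left (hk s t h0 hst ht hr) ha
          have b2 := mul_le_mul_of_nonneg_left (he s t h0 hst ht) hb
          have b3 : a * (Ψ t - Ψ s) + b * (Ψ t - Ψ s) = Ψ t - Ψ s := by rw [← add_mul, hab, one_mul]
          rw [← hj2]
          linarith) (s := s₁) ⟨hs₁.1.le, hs₁.2⟩
      rw [max_eq_left hy₁s₁.le, min_eq_right hy₁s₁.le, hs₁0] at this
      have h5 : 0 ≤ j₁ * y₁ s₁ := mul_nonneg hj₁ hy₁s₁.le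
      linarith [hneg s₁ hs₁]
    · obtain ⟨a, b, ha, hb, hab, hk2⟩ : ∃ a b : ℝ, 0 ≤ a ∧ 0 ≤ b ∧ a + b = 1 ∧ a * j₂ + b * (-e₂) = k₂ := by
        have hd : 0 < j₂ + e₂ := by linarith
        refine ⟨(k₂ + e₂) / (j₂ + e₂), (j₂ - k₂) / (j₂ + e₂), by apply div_nonneg <;> linarith,
          by apply div_nonneg <;> linarith, ?_, ?_⟩ <;> field_simp <;> ring
      have := piecewise_linear_le_of_increments hy₁ hy₂ hΨ h1 h2 h3 hpos (p := a * j₁ + b * (-e₁)) (q := k₁) (c := k₂)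
        (fun s t h0 hst ht hr => by
          have b1 := mul_le_mul_of_nonneg_left (hj s t h0 hst ht hr) ha
          have b2 := mul_le_mul_of_nonneg_left (he s t h0 hst ht) hb
          have b3 : a * (Ψ t - Ψ s) + b * (Ψ t - Ψ s) = Ψ t - Ψ s := by rw [← add_mul, hab, one_mul]
          rw [← hk2]
          linarith) hk (s := s₂) ⟨hs₂.1.le, hs₂.2⟩
      rw [hs₂0, max_self, min_self, mul_zero, mul_zero, zero_add, zero_add] at this
      have h5 : 0 ≤ k₂ * y₂ s₂ := mul_nonneg hk₂ (hpos s₂ hs₂ hs₂0.le).le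
      linarith [hneg s₂ hs₂]

lemma SignType.sign_eq_of_mul_pos {ε : SignType} {x : ℝ} (h : 0 < (ε : ℝ) * x) : SignType.sign x = ε := by
  cases ε
  · simp at h
  · simp at h; simpa [sign_eq_neg_one_iff] using h
  · simp at h; simpa [sign_eq_one_iff] using h

lemma SignType.coe_mul_self {ε : SignType} (h : ε ≠ 0) : (ε : ℝ) * ε = 1 := by
  cases ε
  · exact absurd rfl h
  · simp
  · simp

/-- A curve whose two coordinates, near each sign pattern, have a linear form of increments dominated
by the increments of a function that is negative at positive times, does not exist if these
linear forms are nonnegative on the corresponding closed orthants. -/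
lemma sign_pattern_increments_contradiction {y : Bool → ℝ → ℝ} (hh₀ : 0 < h₀)
    (hy : ∀ b, ContinuousOn (y b) (Icc 0 h₀)) (hΨ : ContinuousOn Ψ (Icc 0 h₀)) (hy0 : ∀ b, y b 0 = 0)
    (hΨ0 : Ψ 0 = 0) (hneg : ∀ s ∈ Ioc 0 h₀, Ψ s < 0) {k : (Bool → SignType) → Bool → ℝ}
    (hk : ∀ σ b, σ b ≠ 0 → 0 ≤ (σ b : ℝ) * k σ b)
    (hinc : ∀ σ s t, 0 ≤ s → s ≤ t → t ≤ h₀ →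
      (∀ r ∈ Ioo s t, ∀ b, σ b ≠ 0 → SignType.sign (y b r) = σ b) →
      ∑ b, k σ b * (y b t - y b s) ≤ Ψ t - Ψ s) : False := by
  -- A curve that starts at 0, stays in the star of `σ` and arrives with pattern exactly `σ` has `k
  -- σ` nonnegative on arrival, against `Ψ < 0`.
  have hpt : ∀ (σ : Bool → SignType) (s : ℝ), s ∈ Ioc 0 h₀ →
      (∀ r ∈ Ioo 0 s, ∀ b, σ b ≠ 0 → SignType.sign (y b r) = σ b) →
      (∀ b, SignType.sign (y b s) = σ b) → False := by
    intro σ s hs h1 h2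
    have h3 := hinc σ 0 s le_rfl hs.1.le hs.2 h1
    simp only [hy0, hΨ0, sub_zero] at h3
    have h4 : 0 ≤ ∑ b, k σ b * y b s := by
      refine Finset.sum_nonneg fun b _ => ?_
      rcases eq_or_ne (σ b) 0 with h0 | h0
      · rw [← h2 b, sign_eq_zero_iff] at h0
        simp [h0]
      · have h5 := hk σ b h0
        have h6 := sign_mul_abs (y b s)
        rw [h2 b] at h6
        rw [← h6, ← mul_assoc]
        exact mul_nonneg (by rwa [mul_comm]) (abs_nonneg _)
    linarith [hneg s hs]
  have hsign : ∀ b, (∃ s ∈ Ioc 0 h₀, y b s = 0) ∨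
      ∃ ε : SignType, ∀ r ∈ Ioc 0 h₀, SignType.sign (y b r) = ε := by
    intro b
    by_cases h : ∃ s ∈ Ioc 0 h₀, y b s = 0
    · exact Or.inl h
    · push Not at h
      right
      rcases ((hy b).mono Ioc_subset_Icc_self).sign_const_of_ne_zero isPreconnected_Ioc h with h' | h'
      · exact ⟨1, fun r hr => sign_eq_one_iff.2 (h' r hr)⟩
      · exact ⟨-1, fun r hr => sign_eq_neg_one_iff.2 (h' r hr)⟩
  -- Hence each coordinate vanishes at some positive time: otherwise a pattern with one or two
  -- nonzero signs falls under `hpt`.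
  have hone : ∀ b, ∃ s ∈ Ioc 0 h₀, y b s = 0 := by
    intro b
    refine (hsign b).resolve_right fun ⟨ε, hε⟩ => ?_
    rcases hsign (!b) with ⟨s, hs, hs0⟩ | ⟨ε', hε'⟩
    · refine hpt (fun b' => if b' = b then ε else 0) s hs (fun r hr b' hb' => ?_) (fun b' => ?_)
      · by_cases hbb : b' = b
        · subst hbb; simpa using hε r ⟨hr.1, hr.2.le.trans hs.2⟩
        · simp [hbb] at hb'
      · by_cases hbb : b' = b
        · subst hbb; simpa using hε s hs
        · have : b' = !b := Bool.eq_not.2 hbb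
          subst this
          simp [hs0]
    · have hall : ∀ r ∈ Ioc 0 h₀, ∀ b', SignType.sign (y b' r) = if b' = b then ε else ε' := by
        intro r hr b'
        by_cases hbb : b' = b
        · subst hbb; simpa using hε r hr
        · have : b' = !b := Bool.eq_not.2 hbb
          subst this
          simpa using hε' r hr
      exact hpt (fun b' => if b' = b then ε else ε') h₀ ⟨hh₀, le_rfl⟩
        (fun r hr b' _ => hall r ⟨hr.1, hr.2.le⟩ b') (hall h₀ ⟨hh₀, le_rfl⟩)
  obtain ⟨s₁, hs₁, hs₁0⟩ := hone false
  obtain ⟨s₂, hs₂, hs₂0⟩ := hone true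
  have hglob : ∀ s t, 0 ≤ s → s ≤ t → t ≤ h₀ →
      k 0 true * (y true t - y true s) + k 0 false * (y false t - y false s) ≤ Ψ t - Ψ s := by
    intro s t h1 h2 h3
    simpa using hinc 0 s t h1 h2 h3 (fun r _ b hb => absurd rfl hb)
  -- At `s₁` only the `true` coordinate can be nonzero, so a zero global coefficient there would
  -- give `0 ≤ Ψ s₁`; likewise for the other one at `s₂`.
  have hne₁ : k 0 true ≠ 0 := by
    intro h0
    have := hglob 0 s₁ le_rfl hs₁.1.le hs₁.2
    simp only [h0, hs₁0, hy0, hΨ0] at this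
    have := hneg s₁ hs₁
    linarith
  have hne₂ : k 0 false ≠ 0 := by
    intro h0
    have := hglob 0 s₂ le_rfl hs₂.1.le hs₂.2
    simp only [h0, hs₂0, hy0, hΨ0] at this
    have := hneg s₂ hs₂
    linarith
  have hε : ∀ x : ℝ, x ≠ 0 → SignType.sign (-x) ≠ 0 ∧ -|x| * ((SignType.sign (-x) : SignType) : ℝ) = x := by
    intro x hx
    refine ⟨by simpa using hx, ?_⟩
    have h1 := sign_mul_abs (-x)
    rw [abs_neg] at h1
    linarith
  obtain ⟨hε₁, he₁⟩ := hε _ hne₁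
  obtain ⟨hε₂, he₂⟩ := hε _ hne₂
  -- Reflecting the axes by `ε₁` and `ε₂` makes both global coefficients negative.
  generalize SignType.sign (-k 0 true) = ε₁ at hε₁ he₁
  generalize SignType.sign (-k 0 false) = ε₂ at hε₂ he₂
  have hc₁ := SignType.coe_mul_self hε₁
  have hc₂ := SignType.coe_mul_self hε₂
  have hinv : ∀ (ε : SignType), (ε : ℝ) * ε = 1 → ∀ c a b : ℝ, c * ε * (ε * a - ε * b) = c * (a - b) := by
    intro ε h c a b
    linear_combination c * (a - b) * h
  let σ₁ : Bool → SignType := fun b => if b then ε₁ else 0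
  let σ₂ : Bool → SignType := fun b => if b then 0 else ε₂
  refine planar_increments_contradiction (y₁ := fun s => ε₁ * y true s) (y₂ := fun s => ε₂ * y false s)
    (Ψ := Ψ) (h₀ := h₀) (continuousOn_const.mul (hy _)) (continuousOn_const.mul (hy _)) hΨ (by simp [hy0])
    (by simp [hy0]) hΨ0 hneg (e₁ := |k 0 true|) (e₂ := |k 0 false|) (j₁ := k σ₁ true * ε₁)
    (j₂ := k σ₁ false * ε₂) (k₁ := k σ₂ true * ε₁) (k₂ := k σ₂ false * ε₂) (abs_pos.2 hne₁) (abs_pos.2 hne₂)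
    ?_ ?_ ?_ ?_ ?_ hs₁ (by simp [hs₁0]) hs₂ (by simp [hs₂0])
  · have := hk σ₁ true (by simpa [σ₁] using hε₁)
    rw [mul_comm]; simpa [σ₁] using this
  · have := hk σ₂ false (by simpa [σ₂] using hε₂)
    rw [mul_comm]; simpa [σ₂] using this
  · intro s t h1 h2 h3
    have := hglob s t h1 h2 h3
    rw [← he₁, ← he₂] at this
    linarith
  · intro s t h1 h2 h3 h4
    have := hinc σ₁ s t h1 h2 h3 (fun r hr b hb => by
      cases b
      · exact absurd rfl hb
      · exact SignType.sign_eq_of_mul_pos (h4 r hr))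
    rw [hinv _ hc₁, hinv _ hc₂]
    simpa using this
  · intro s t h1 h2 h3 h4
    have := hinc σ₂ s t h1 h2 h3 (fun r hr b hb => by
      cases b
      · exact SignType.sign_eq_of_mul_pos (h4 r hr)
      · exact absurd rfl hb)
    rw [hinv _ hc₁, hinv _ hc₂]
    simpa using this

end PlanarCurves

/-! ### Local structure of the hyperplane arrangement. -/

namespace MultiDomain

variable {d : ℕ} {P : MultiDomain d}

lemma mem_hyperplane {j : Fin P.q} {x : Vec d} : x ∈ P.hyperplane j ↔ inner ℝ (P.normal j) x = P.offset j :=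
  Iff.rfl

lemma H1.eq_of_parallel (hP : P.H1) {i j : Fin P.q} {x : Vec d} (hi : x ∈ P.hyperplane i)
    (hj : x ∈ P.hyperplane j) (hij : P.normal i = P.normal j ∨ P.normal i = -P.normal j) : i = j := by
  refine hP.hyperplane_injective (Set.ext fun z => ?_)
  rw [mem_hyperplane] at hi hj
  rw [mem_hyperplane, mem_hyperplane]
  rcases hij with h | h
  · rw [← hi, ← hj, h]
  · rw [← hi, ← hj, h, inner_neg_left, inner_neg_left, neg_inj]

/-- The hyperplanes through a point have at most two normals, which are orthogonal. -/
lemma H1.exists_normals (hP : P.H1) (x₀ : Vec d) : ∃ ν : Bool → Vec d,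
    (∀ b, ν b ≠ 0 → ‖ν b‖ = 1) ∧ (∀ b, inner ℝ (ν b) (ν !b) = 0) ∧
    (∀ j, x₀ ∈ P.hyperplane j → ∃ b, P.normal j = ν b) ∧
    ∀ b, ν b ≠ 0 → ∃ j, x₀ ∈ P.hyperplane j ∧ P.normal j = ν b := by
  classical
  obtain ⟨fam, hfam⟩ := hP.two_families
  let ν : Bool → Vec d := fun b =>
    if h : ∃ j, fam j = b ∧ x₀ ∈ P.hyperplane j then P.normal h.choose else 0
  have h1 : ∀ b, ν b ≠ 0 → ∃ j, fam j = b ∧ x₀ ∈ P.hyperplane j ∧ P.normal j = ν b := by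
    intro b hb
    by_cases h : ∃ j, fam j = b ∧ x₀ ∈ P.hyperplane j
    · exact ⟨h.choose, h.choose_spec.1, h.choose_spec.2, by simp only [ν, dif_pos h]⟩
    · exact absurd (by simp only [ν, dif_neg h]) hb
  refine ⟨ν, fun b hb => ?_, fun b => ?_, fun j hj => ⟨fam j, ?_⟩, fun b hb => ?_⟩
  · obtain ⟨j, -, -, hj⟩ := h1 b hb
    rw [← hj]; exact hP.unit_normal j
  · by_cases hb : ν b = 0
    · rw [hb, inner_zero_left]
    by_cases hb' : ν (!b) = 0
    · rw [hb', inner_zero_right]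
    obtain ⟨i, hi, hix, hi'⟩ := h1 b hb
    obtain ⟨j, hj, hjx, hj'⟩ := h1 _ hb'
    rw [← hi', ← hj']
    refine (hP.parallel_or_perp i j).resolve_left fun hpar => ?_
    have := hP.eq_of_parallel hix hjx hpar
    rw [this, hj] at hi
    cases b <;> simp at hi
  · have h : ∃ i, fam i = fam j ∧ x₀ ∈ P.hyperplane i := ⟨j, rfl, hj⟩
    simp only [ν, dif_pos h]
    exact congrArg _ (hP.eq_of_parallel hj h.choose_spec.2 (hfam _ _ h.choose_spec.1.symm))
  · obtain ⟨j, -, h2, h3⟩ := h1 b hb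
    exact ⟨j, h2, h3⟩

lemma mem_face_self (z : Vec d) : z ∈ P.face z := fun _ => rfl

lemma convex_face (z : Vec d) : Convex ℝ (P.face z) := by
  have h : P.face z = ⋂ j, {x | SignType.sign (inner ℝ (P.normal j) x - P.offset j)
      = SignType.sign (inner ℝ (P.normal j) z - P.offset j)} := by
    ext x; simp [face]
  rw [h]
  refine convex_iInter fun j => ?_
  have hlin : IsLinearMap ℝ fun x : Vec d => inner ℝ (P.normal j) x :=
    ⟨fun x y => inner_add_right _ _ _, fun c x => real_inner_smul_right _ _ _⟩
  rcases lt_trichotomy (inner ℝ (P.normal j) z - P.offset j) 0 with h0 | h0 | h0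
  · simp only [sign_neg h0, sign_eq_neg_one_iff, sub_neg]
    exact convex_halfSpace_lt hlin _
  · simp only [h0, sign_zero, sign_eq_zero_iff, sub_eq_zero]
    exact convex_hyperplane hlin _
  · simp only [sign_pos h0, sign_eq_one_iff, sub_pos]
    exact convex_halfSpace_gt hlin _

/-- A face that does not meet the interface is a cell. -/
lemma H1.face_eq_cell (hP : P.H1) {z : Vec d} (hz : z ∉ P.interface) : ∃ i, P.face z = P.cell i := by
  have hdisj : ∀ x ∈ P.face z, x ∉ P.interface := by
    intro x hx hxI
    obtain ⟨j, hj⟩ := mem_iUnion.1 hxI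
    rw [mem_hyperplane] at hj
    have h1 := hx j
    rw [hj, sub_self, sign_zero, eq_comm, sign_eq_zero_iff, sub_eq_zero] at h1
    exact hz (mem_iUnion.2 ⟨j, h1⟩)
  have hcov : ∀ x ∉ P.interface, ∃ i, x ∈ P.cell i := by
    intro x hx
    have : x ∈ P.interface ∪ ⋃ i, P.cell i := hP.cover ▸ mem_univ x
    exact mem_iUnion.1 (this.resolve_left hx)
  obtain ⟨i, hi⟩ := hcov z hz
  refine ⟨i, Subset.antisymm ?_ ?_⟩
  -- The face is convex, hence connected, and is covered by the disjoint open cells.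
  · refine (convex_face z).isPreconnected.subset_left_of_subset_union (hP.cell_isOpen i)
      (isOpen_iUnion fun k => isOpen_iUnion fun (_ : k ≠ i) => hP.cell_isOpen k) ?_ ?_ ⟨z, mem_face_self z, hi⟩
    · refine disjoint_iUnion₂_right.2 fun k hk => hP.cell_disjoint hk.symm
    · intro x hx
      obtain ⟨k, hk⟩ := hcov x (hdisj x hx)
      by_cases hki : k = i
      · exact Or.inl (hki ▸ hk)
      · exact Or.inr (mem_iUnion₂.2 ⟨k, hki, hk⟩)
  -- Conversely, the affine functions have no zero on the connected cell, so their signs are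
  -- constant there.
  · intro x hx j
    have hcont : ContinuousOn (fun x : Vec d => inner ℝ (P.normal j) x - P.offset j) (P.cell i) := by fun_prop
    have hne : ∀ y ∈ P.cell i, inner ℝ (P.normal j) y - P.offset j ≠ 0 := by
      intro y hy h0
      have : y ∈ P.interface ∩ P.cell i := ⟨mem_iUnion.2 ⟨j, sub_eq_zero.1 h0⟩, hy⟩
      rw [hP.interface_inter_cell i] at this
      exact this
    have hpre := (hP.cell_isConnected i).isPreconnected.image _ hcont
    by_contra hs
    have h1 : (0 : ℝ) ∈ (fun x : Vec d => inner ℝ (P.normal j) x - P.offset j) '' P.cell i := by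
      have ho := hpre.ordConnected
      rcases lt_or_gt_of_ne (hne x hx) with hx0 | hx0 <;> rcases lt_or_gt_of_ne (hne z hi) with hz0 | hz0
      · exact absurd (by rw [sign_neg hx0, sign_neg hz0]) hs
      · exact ho.out (mem_image_of_mem _ hx) (mem_image_of_mem _ hi) ⟨hx0.le, hz0.le⟩
      · exact ho.out (mem_image_of_mem _ hi) (mem_image_of_mem _ hx) ⟨hz0.le, hx0.le⟩
      · exact absurd (by rw [sign_pos hx0, sign_pos hz0]) hs
    obtain ⟨y, hy, hy0⟩ := h1
    exact hne y hy hy0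

/-- A point has a neighbourhood on which only the hyperplanes through it matter. -/
lemma eventually_sign_eq (x₀ : Vec d) : ∀ᶠ z in 𝓝 x₀, ∀ j, x₀ ∉ P.hyperplane j →
    SignType.sign (inner ℝ (P.normal j) z - P.offset j)
      = SignType.sign (inner ℝ (P.normal j) x₀ - P.offset j) := by
  refine eventually_all.2 fun j => ?_
  by_cases hj : x₀ ∈ P.hyperplane j
  · exact Eventually.of_forall fun _ h => absurd hj h
  have hne : inner ℝ (P.normal j) x₀ - P.offset j ≠ 0 := fun h => hj (sub_eq_zero.1 h)
  have hcont : Continuous fun z : Vec d => inner ℝ (P.normal j) z - P.offset j := by fun_prop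
  rcases lt_or_gt_of_ne hne with h0 | h0
  · filter_upwards [hcont.continuousAt.eventually_lt_const h0] with z hz _
    rw [sign_neg hz, sign_neg h0]
  · filter_upwards [hcont.continuousAt.eventually_const_lt h0] with z hz _
    rw [sign_pos hz, sign_pos h0]

/-- The local structure of the multi-domain at a point: orthogonal vectors `ν b`, and the subdomains
`M σ` described near the point by the signs of the coordinates along the `ν b`. -/
structure LocalChart (P : MultiDomain d) (x₀ : Vec d) where
  ν : Bool → Vec d
  M : (Bool → SignType) → Set (Vec d)
  orth : ∀ b, inner ℝ (ν b) (ν !b) = 0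
  norm_eq : ∀ b, ν b ≠ 0 → ‖ν b‖ = 1
  subdomain : ∀ σ, P.IsSubdomain (M σ)
  mem_iff : ∀ᶠ z in 𝓝 x₀, ∀ σ, z ∈ M σ ↔ ∀ b, ν b ≠ 0 → SignType.sign (inner ℝ (ν b) (z - x₀)) = σ b

namespace LocalChart

variable {x₀ : Vec d} (c : LocalChart P x₀)

/-- The open star of the sign pattern `σ`. -/
def star (σ : Bool → SignType) : Set (Vec d) :=
  {z | ∀ b, σ b ≠ 0 → SignType.sign (inner ℝ (c.ν b) (z - x₀)) = σ b}

/-- A vector pointing from `x₀` into the subdomain of sign pattern `σ`. -/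
def dir (ν : Bool → Vec d) (σ : Bool → SignType) : Vec d := ∑ b, ((σ b : SignType) : ℝ) • ν b

lemma inner_dir {ν : Bool → Vec d} (h1 : ∀ b, ν b ≠ 0 → ‖ν b‖ = 1) (h2 : ∀ b, inner ℝ (ν b) (ν !b) = 0)
    (σ : Bool → SignType) {b : Bool} (hb : ν b ≠ 0) : inner ℝ (ν b) (dir ν σ) = (σ b : ℝ) := by
  have h3 := h1 b hb
  have h4 := h2 b
  cases b <;> simp [dir, inner_add_right, real_inner_smul_right, h3] <;> right <;> simpa using h4

end LocalChart

lemma sign_add_pos_mul {ε : SignType} {a c : ℝ} (hc : 0 < c) (ha : ε = 0 → a = 0)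
    (ha' : ε ≠ 0 → 0 ≤ (ε : ℝ) * a) : SignType.sign (a + c * (ε : ℝ)) = ε := by
  cases ε
  · simp [ha rfl]
  · have := ha' (by decide)
    simp at this
    refine sign_eq_neg_one_iff.2 ?_
    simp
    linarith
  · have := ha' (by decide)
    simp at this
    refine sign_eq_one_iff.2 ?_
    simp
    linarith

/-- `M σ` is the face through `x₀ + ε • dir ν σ`, with `ε` so small that no hyperplane missing `x₀`
is reached. If only one family, or none, passes through `x₀`, some `ν b` is zero and the sign `σ b`
is ignored. -/
lemma H1.exists_localChart (hP : P.H1) (x₀ : Vec d) : Nonempty (P.LocalChart x₀) := by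
  obtain ⟨ν, h1, h2, h3, h4⟩ := hP.exists_normals x₀
  have hev := P.eventually_sign_eq x₀
  have hlim : ∀ σ, Tendsto (fun ε : ℝ => x₀ + ε • LocalChart.dir ν σ) (𝓝[>] 0) (𝓝 x₀) := fun σ => by
    have : Continuous fun ε : ℝ => x₀ + ε • LocalChart.dir ν σ := by fun_prop
    simpa using (this.tendsto 0).mono_left nhdsWithin_le_nhds
  have hall : ∀ᶠ ε : ℝ in 𝓝[>] 0, ∀ σ, ∀ j, x₀ ∉ P.hyperplane j →
      SignType.sign (inner ℝ (P.normal j) (x₀ + ε • LocalChart.dir ν σ) - P.offset j)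
      = SignType.sign (inner ℝ (P.normal j) x₀ - P.offset j) :=
    eventually_all.2 fun σ => (hlim σ).eventually hev
  obtain ⟨ε, hε, hε0⟩ := (hall.and self_mem_nhdsWithin).exists
  have hε0 : 0 < ε := hε0
  have hν : ∀ j, x₀ ∈ P.hyperplane j → ∀ z, inner ℝ (P.normal j) z - P.offset j = inner ℝ (P.normal j) (z - x₀) := by
    intro j hj z
    rw [inner_sub_right, mem_hyperplane.1 hj]
  have hsgn : ∀ σ b, ν b ≠ 0 → SignType.sign (inner ℝ (ν b) (x₀ + ε • LocalChart.dir ν σ - x₀)) = σ b := by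
    intro σ b hb
    rw [add_sub_cancel_left, real_inner_smul_right, LocalChart.inner_dir h1 h2 σ hb]
    simpa using sign_add_pos_mul (ε := σ b) (a := 0) hε0 (fun _ => rfl) (by simp)
  refine ⟨⟨ν, fun σ => P.face (x₀ + ε • LocalChart.dir ν σ), h2, h1, fun σ => ?_, ?_⟩⟩
  · by_cases hI : x₀ + ε • LocalChart.dir ν σ ∈ P.interface
    · exact Or.inr ⟨_, hI, rfl⟩
    · exact Or.inl (hP.face_eq_cell hI)
  · filter_upwards [hev] with z hz σ
    constructor
    · intro hzM b hb
      obtain ⟨j, hj, hjν⟩ := h4 b hb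
      have := hzM j
      rwa [hν j hj, hν j hj, hjν, hsgn σ b hb] at this
    · intro hzs j
      by_cases hj : x₀ ∈ P.hyperplane j
      · obtain ⟨b, hb⟩ := h3 j hj
        have hb0 : ν b ≠ 0 := by
          intro h0
          have := hP.unit_normal j
          rw [hb, h0, norm_zero] at this
          exact zero_ne_one this
        rw [hν j hj, hν j hj, hb, hsgn σ b hb0, hzs b hb0]
      · rw [hz j hj, hε σ j hj]

namespace LocalChart

variable {x₀ : Vec d} (c : LocalChart P x₀)

/-- Moving from a point into the direction of the sign pattern `σ'` leads into `M σ'`. -/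
lemma eventually_mem : ∀ᶠ w in 𝓝 x₀, ∀ σ',
    (∀ b, c.ν b ≠ 0 → (σ' b = 0 → inner ℝ (c.ν b) (w - x₀) = 0) ∧
      (σ' b ≠ 0 → 0 ≤ (σ' b : ℝ) * inner ℝ (c.ν b) (w - x₀))) →
    ∀ᶠ δ : ℝ in 𝓝[>] 0, w + δ • dir c.ν σ' ∈ c.M σ' := by
  have h := eventually_eventually_nhds.2 c.mem_iff
  filter_upwards [h] with w hw σ' hσ
  have hlim : Tendsto (fun ε : ℝ => w + ε • dir c.ν σ') (𝓝[>] 0) (𝓝 w) := by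
    have : Continuous fun ε : ℝ => w + ε • dir c.ν σ' := by fun_prop
    simpa using (this.tendsto 0).mono_left nhdsWithin_le_nhds
  filter_upwards [hlim.eventually hw, self_mem_nhdsWithin] with δ hδ hδ0
  refine (hδ σ').2 fun b hb => ?_
  rw [add_sub_right_comm, inner_add_right, real_inner_smul_right, inner_dir c.norm_eq c.orth σ' hb]
  exact sign_add_pos_mul hδ0 (hσ b hb).1 (hσ b hb).2

lemma eventually_mem_closure : ∀ᶠ w in 𝓝 x₀, ∀ σ',
    (∀ b, c.ν b ≠ 0 → (σ' b = 0 → inner ℝ (c.ν b) (w - x₀) = 0) ∧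
      (σ' b ≠ 0 → 0 ≤ (σ' b : ℝ) * inner ℝ (c.ν b) (w - x₀))) → w ∈ closure (c.M σ') := by
  filter_upwards [c.eventually_mem] with w hw σ' hσ
  have hlim : Tendsto (fun ε : ℝ => w + ε • dir c.ν σ') (𝓝[>] 0) (𝓝 w) := by
    have : Continuous fun ε : ℝ => w + ε • dir c.ν σ' := by fun_prop
    simpa using (this.tendsto 0).mono_left nhdsWithin_le_nhds
  exact mem_closure_of_tendsto hlim (hw σ' hσ)

lemma mem_closure (σ : Bool → SignType) : x₀ ∈ closure (c.M σ) :=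
  c.eventually_mem_closure.self_of_nhds σ fun b _ => by simp

/-- The segment from `x₀` along `v` stays in the closure for small times, so the quotient is
eventually zero. Only this inclusion of the orthant in the tangent cone is needed. -/
lemma mem_tangentConeOf {σ : Bool → SignType} {v : Vec d}
    (hv : ∀ b, c.ν b ≠ 0 → (σ b = 0 → inner ℝ (c.ν b) v = 0) ∧ (σ b ≠ 0 → 0 ≤ (σ b : ℝ) * inner ℝ (c.ν b) v)) :
    v ∈ tangentConeOf (closure (c.M σ)) x₀ := by
  have hlim : Tendsto (fun t : ℝ => x₀ + t • v) (𝓝[>] 0) (𝓝 x₀) := by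
    have : Continuous fun t : ℝ => x₀ + t • v := by fun_prop
    simpa using (this.tendsto 0).mono_left nhdsWithin_le_nhds
  have hz : (fun t : ℝ => Metric.infDist (x₀ + t • v) (closure (c.M σ)) / t) =ᶠ[𝓝[>] 0] fun _ => (0 : ℝ) := by
    filter_upwards [hlim.eventually c.eventually_mem_closure, self_mem_nhdsWithin] with t ht ht0
    have ht0 : 0 < t := ht0
    rw [Metric.infDist_zero_of_mem, zero_div]
    refine ht σ fun b hb => ?_
    rw [add_sub_cancel_left, real_inner_smul_right]
    refine ⟨fun h0 => by rw [(hv b hb).1 h0, mul_zero], fun h0 => ?_⟩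
    rw [mul_left_comm]
    exact mul_nonneg ht0.le ((hv b hb).2 h0)
  change liminf _ _ = 0
  rw [liminf_congr hz, liminf_const]

end LocalChart

end MultiDomain

/-! ### Extensions by continuity and separation. -/

section EssentialVelocities

variable {d n : ℕ} {P : MultiDomain d} {S : ControlProblem d n} {T cl lam : ℝ} {x₀ : Vec d}

lemma mem_contExt_iff {E : Type*} [PseudoMetricSpace E] {Φ : Vec d → Set E} {M : Set (Vec d)} {x : Vec d} {p : E} :
    p ∈ contExt Φ M x ↔ ∀ ε > 0, ∃ z ∈ M, dist z x < ε ∧ ∃ v ∈ Φ z, dist v p < ε := by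
  constructor
  · rintro ⟨z, v, hz, hv, hzx, hvp⟩ ε hε
    obtain ⟨N, h1, h2⟩ := ((Metric.tendsto_nhds.1 hzx ε hε).and (Metric.tendsto_nhds.1 hvp ε hε)).exists
    exact ⟨z N, hz N, h1, v N, hv N, h2⟩
  · intro h
    choose z hz hzx v hv hvp using fun N : ℕ => h (1 / ((N : ℝ) + 1)) (by positivity)
    refine ⟨z, v, hz, hv, tendsto_iff_dist_tendsto_zero.2 ?_, tendsto_iff_dist_tendsto_zero.2 ?_⟩
    · exact squeeze_zero (fun _ => dist_nonneg) (fun N => (hzx N).le) tendsto_one_div_add_atTop_nhds_zero_nat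
    · exact squeeze_zero (fun _ => dist_nonneg) (fun N => (hvp N).le) tendsto_one_div_add_atTop_nhds_zero_nat

lemma isClosed_contExt {E : Type*} [PseudoMetricSpace E] (Φ : Vec d → Set E) (M : Set (Vec d)) (x : Vec d) :
    IsClosed (contExt Φ M x) := by
  refine isClosed_of_closure_subset fun p hp => mem_contExt_iff.2 fun ε hε => ?_
  obtain ⟨p', hp', hpp⟩ := Metric.mem_closure_iff.1 hp (ε / 2) (half_pos hε)
  obtain ⟨z, hz, hzx, v, hv, hvp⟩ := mem_contExt_iff.1 hp' (ε / 2) (half_pos hε)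
  refine ⟨z, hz, by linarith, v, hv, ?_⟩
  have := dist_triangle v p' p
  rw [dist_comm p' p] at this
  linarith

/-- A Cauchy form of the extension by continuity, common to cells (Lipschitz bound) and interface
pieces (Hausdorff limit). -/
lemma ControlProblem.HF.exists_nhds_approx (hF : S.HF P) {M : Set (Vec d)} (hM : P.IsSubdomain M)
    (hx : x₀ ∈ closure M) {ε : ℝ} (hε : 0 < ε) :
    ∃ U ∈ 𝓝 x₀, ∀ y ∈ U ∩ M, ∀ z ∈ U ∩ M, ∀ v ∈ S.F y, ∃ w ∈ S.F z, dist v w < ε := by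
  rcases hM with ⟨i, rfl⟩ | hM
  · obtain ⟨K, U, hU, hK⟩ := hF.lipschitz i x₀ hx
    have hr : 0 < ε / (4 * (|K| + 1)) := by positivity
    refine ⟨U ∩ Metric.ball x₀ (ε / (4 * (|K| + 1))), inter_mem hU (Metric.ball_mem_nhds _ hr), ?_⟩
    rintro y ⟨⟨hyU, hyb⟩, hyM⟩ z ⟨⟨hzU, hzb⟩, hzM⟩ v hv
    refine Metric.exists_dist_lt_of_hausdorffDist_lt hv ?_
      (Metric.hausdorffEDist_ne_top_of_nonempty_of_bounded (hF.nonempty y) (hF.nonempty z)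
        (hF.isCompact y).isBounded (hF.isCompact z).isBounded)
    refine (hK y ⟨hyU, hyM⟩ z ⟨hzU, hzM⟩).trans_lt ?_
    have h1 : dist y z < ε / (2 * (|K| + 1)) := by
      have h2 := dist_triangle_right y z x₀
      rw [Metric.mem_ball] at hyb hzb
      have h3 : ε / (4 * (|K| + 1)) + ε / (4 * (|K| + 1)) = ε / (2 * (|K| + 1)) := by field_simp; ring
      linarith
    have h4 : |K| * (ε / (2 * (|K| + 1))) < ε := by
      rw [mul_div_assoc', div_lt_iff₀ (by positivity)]
      nlinarith [abs_nonneg K]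
    calc K * dist y z ≤ |K| * dist y z := by gcongr; exact le_abs_self K
      _ ≤ |K| * (ε / (2 * (|K| + 1))) := by gcongr
      _ < ε := h4
  · obtain ⟨C, hCne, hC, hlim⟩ := hF.extends_interface M hM x₀ hx
    have hev : ∀ᶠ y in 𝓝[M] x₀, Metric.hausdorffDist (S.F y) C < ε / 2 :=
      hlim.eventually_lt_const (half_pos hε)
    obtain ⟨U, hU, hUM⟩ := mem_nhdsWithin_iff_exists_mem_nhds_inter.1 hev
    refine ⟨U, hU, fun y hy z hz v hv => ?_⟩
    have hfin : ∀ y, Metric.hausdorffEDist (S.F y) C ≠ ⊤ := fun y =>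
      Metric.hausdorffEDist_ne_top_of_nonempty_of_bounded (hF.nonempty y) hCne
        (hF.isCompact y).isBounded hC.isBounded
    obtain ⟨p, hp, hvp⟩ := Metric.exists_dist_lt_of_hausdorffDist_lt hv (hUM hy) (hfin y)
    obtain ⟨w, hw, hwp⟩ := Metric.exists_dist_lt_of_hausdorffDist_lt' hp (hUM hz) (hfin z)
    refine ⟨w, hw, ?_⟩
    have := dist_triangle_right v w p
    linarith

lemma ControlProblem.HF.eventually_approx (hF : S.HF P) (x : Vec d) {ε : ℝ} (hε : 0 < ε) :
    ∀ᶠ z in 𝓝 x, ∀ v ∈ S.F z, ∃ w ∈ S.F x, dist v w < ε := by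
  have h := hF.usc x _ (Metric.isOpen_thickening.mem_nhdsSet.2 (Metric.self_subset_thickening hε (S.F x)))
  filter_upwards [h] with z hz v hv
  exact Metric.mem_thickening_iff.1 (subset_of_mem_nhdsSet hz hv)

lemma ControlProblem.HG.convex_F (hL : S.HL P cl lam) (hG : S.HG cl lam) (x : Vec d) : Convex ℝ (S.F x) := by
  have : S.F x = LinearMap.fst ℝ (Vec d) ℝ '' S.G cl lam x := by
    ext p
    constructor
    · rintro ⟨a, ha, rfl⟩
      exact ⟨_, hL.augVelocity_mem ha, rfl⟩
    · rintro ⟨w, ⟨a, ha, r, -, -, rfl⟩, rfl⟩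
      exact ⟨a, ha, rfl⟩
  rw [this]
  exact (hG.convex x).linear_image _

open MultiDomain

/-- Velocities in the open star of a subdomain are approximated by velocities on the subdomain. -/
lemma MultiDomain.LocalChart.exists_nhds_approx (c : P.LocalChart x₀) (hF : S.HF P) (σ : Bool → SignType)
    {ε : ℝ} (hε : 0 < ε) : ∃ U ∈ 𝓝 x₀, ∀ z ∈ U ∩ c.star σ, ∀ w ∈ U ∩ c.M σ, ∀ v ∈ S.F z,
      ∃ p ∈ S.F w, dist v p < ε := by
  choose V hV hVM using fun σ' => hF.exists_nhds_approx (c.subdomain σ') (c.mem_closure σ') (half_pos hε)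
  have hall : ∀ᶠ z in 𝓝 x₀, ∀ σ', z ∈ interior (V σ') :=
    eventually_all.2 fun σ' => interior_mem_nhds.2 (hV σ')
  have hev := (c.mem_iff.and c.eventually_mem).and hall
  refine ⟨_, hev, ?_⟩
  rintro z ⟨⟨⟨hz1, hz2⟩, hz3⟩, hzs⟩ w ⟨⟨⟨hw1, hw2⟩, hw3⟩, hwM⟩ v hv
  -- The actual pattern `σ'` of `z` refines `σ`. A small move from `w` along `σ'` enters `M σ'`,
  -- where velocities are comparable with those at `z`; upper semicontinuity at `w` brings them back
  -- to `S.F w`.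
  let σ' : Bool → SignType := fun b => SignType.sign (inner ℝ (c.ν b) (z - x₀))
  have hσ : ∀ b, σ b ≠ 0 → σ' b = σ b := fun b hb => hzs b hb
  have hzM : z ∈ c.M σ' := (hz1 σ').2 fun b _ => rfl
  have hwM' := (hw1 σ).1 hwM
  have hin : ∀ᶠ δ : ℝ in 𝓝[>] 0, w + δ • LocalChart.dir c.ν σ' ∈ c.M σ' := by
    refine hw2 σ' fun b hb => ⟨fun h0 => ?_, fun h0 => ?_⟩
    · have : σ b = 0 := by
        by_contra h; rw [hσ b h] at h0; exact h h0
      have h2 := hwM' b hb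
      rwa [this, sign_eq_zero_iff] at h2
    · by_cases hb0 : σ b = 0
      · have h2 := hwM' b hb
        rw [hb0, sign_eq_zero_iff] at h2
        rw [h2, mul_zero]
      · rw [hσ b hb0, ← hwM' b hb, sign_mul_self]
        exact abs_nonneg _
  have hlim : Tendsto (fun δ : ℝ => w + δ • LocalChart.dir c.ν σ') (𝓝[>] 0) (𝓝 w) := by
    have : Continuous fun δ : ℝ => w + δ • LocalChart.dir c.ν σ' := by fun_prop
    simpa using (this.tendsto 0).mono_left nhdsWithin_le_nhds
  have hVw : ∀ᶠ y in 𝓝 w, y ∈ V σ' := mem_interior_iff_mem_nhds.1 (hw3 σ')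
  obtain ⟨δ, h1, h2, h3⟩ := (hin.and ((hlim.eventually hVw).and
    (hlim.eventually (hF.eventually_approx w (half_pos hε))))).exists
  obtain ⟨p', hp', hvp⟩ := hVM σ' z ⟨interior_subset (hz3 σ'), hzM⟩ _ ⟨h2, h1⟩ v hv
  obtain ⟨p, hp, hpp⟩ := h3 p' hp'
  refine ⟨p, hp, ?_⟩
  have := dist_triangle v p' p
  linarith

/-- The extension from `M σ` also captures limits of velocities taken through the larger adjacent
subdomains. -/
lemma MultiDomain.LocalChart.mem_contExt_of_tendsto (c : P.LocalChart x₀) (hF : S.HF P) {σ : Bool → SignType}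
    {ι : Type*} {l : Filter ι} [l.NeBot] {z : ι → Vec d} {v : ι → Vec d} {p : Vec d} (hz : ∀ i, z i ∈ c.star σ)
    (hv : ∀ i, v i ∈ S.F (z i)) (hzl : Tendsto z l (𝓝 x₀)) (hvl : Tendsto v l (𝓝 p)) :
    p ∈ contExt S.F (c.M σ) x₀ := by
  refine mem_contExt_iff.2 fun ε hε => ?_
  obtain ⟨U, hU, hUσ⟩ := c.exists_nhds_approx hF σ (half_pos hε)
  obtain ⟨w, ⟨hwU, hwb⟩, hwM⟩ := mem_closure_iff_nhds.1 (c.mem_closure σ) _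
    (inter_mem hU (Metric.ball_mem_nhds x₀ hε))
  obtain ⟨i, hi, hi'⟩ := ((hzl.eventually hU).and (Metric.tendsto_nhds.1 hvl _ (half_pos hε))).exists
  obtain ⟨p', hp', hd⟩ := hUσ (z i) ⟨hi, hz i⟩ w ⟨hwU, hwM⟩ (v i) (hv i)
  refine ⟨w, hwM, hwb, p', hp', ?_⟩
  have := dist_triangle_left p' p (v i)
  linarith

/-- Velocities at two points of `M σ` near `x₀` are nearly interchangeable, so a convex combination
can be formed at a single point, where `F` has convex values. -/
lemma MultiDomain.LocalChart.convex_contExt (c : P.LocalChart x₀) (hF : S.HF P) (hL : S.HL P cl lam)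
    (hG : S.HG cl lam) {σ : Bool → SignType} (hσ : ∀ b, c.ν b = 0 → σ b = 0) :
    Convex ℝ (contExt S.F (c.M σ) x₀) := by
  intro p hp p' hp' a b ha hb hab
  refine mem_contExt_iff.2 fun ε hε => ?_
  obtain ⟨U, hU, hUσ⟩ := c.exists_nhds_approx hF σ (half_pos hε)
  obtain ⟨r, hr, hrU⟩ := Metric.mem_nhds_iff.1 (inter_mem hU c.mem_iff)
  have hr' : 0 < min r (ε / 2) := by positivity
  obtain ⟨z, hz, hzx, v, hv, hvp⟩ := mem_contExt_iff.1 hp _ hr'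
  obtain ⟨z', hz', hzx', v', hv', hvp'⟩ := mem_contExt_iff.1 hp' _ hr'
  have hzU := hrU (Metric.mem_ball.2 (hzx.trans_le (min_le_left _ _)))
  have hzU' := hrU (Metric.mem_ball.2 (hzx'.trans_le (min_le_left _ _)))
  have hstar : z' ∈ c.star σ := fun b hb => (hzU'.2 σ).1 hz' b fun h0 => hb (hσ b h0)
  obtain ⟨v'', hv'', hd⟩ := hUσ z' ⟨hzU'.1, hstar⟩ z ⟨hzU.1, hz⟩ v' hv'
  have h1 := hzx.trans_le (min_le_right _ _)
  refine ⟨z, hz, by linarith, a • v + b • v'', hG.convex_F hL z hv hv'' ha hb hab, ?_⟩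
  have h2 : dist v p < ε := by have := hvp.trans_le (min_le_right _ _); linarith
  have h3 : dist v'' p' < ε := by
    have := hvp'.trans_le (min_le_right _ _)
    have := dist_triangle_left v'' p' v'
    linarith
  have h4 := (convex_ball (0 : Vec d) ε) (x := v - p) (by simpa [dist_eq_norm] using h2) (y := v'' - p')
    (by simpa [dist_eq_norm] using h3) ha hb hab
  rw [mem_ball_zero_iff] at h4
  rw [dist_eq_norm]
  have e : a • v + b • v'' - (a • p + b • p') = a • (v - p) + b • (v'' - p') := by module
  rw [e]
  exact h4

/-- Separation of a compact convex set of triples from the triples `(a, b, p)` with `p ≤ 0` and `(a, b)`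
in an orthant, in normalized form. -/
lemma exists_orthant_separation {K : Set (ℝ × ℝ × ℝ)} (hK : IsCompact K) (hKc : Convex ℝ K) (σ : Bool → SignType)
    (hdisj : ∀ w ∈ K, (σ true = 0 → w.1 = 0) → (σ true ≠ 0 → 0 ≤ (σ true : ℝ) * w.1) →
      (σ false = 0 → w.2.1 = 0) → (σ false ≠ 0 → 0 ≤ (σ false : ℝ) * w.2.1) → 0 < w.2.2) :
    ∃ k : Bool → ℝ, (∀ b, σ b ≠ 0 → 0 ≤ (σ b : ℝ) * k b) ∧
      ∃ δ > 0, ∀ w ∈ K, k true * w.1 + k false * w.2.1 < w.2.2 - δ := by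
  let t : Set (ℝ × ℝ × ℝ) := {w | (σ true = 0 → w.1 = 0) ∧ (σ true ≠ 0 → 0 ≤ (σ true : ℝ) * w.1) ∧
      (σ false = 0 → w.2.1 = 0) ∧ (σ false ≠ 0 → 0 ≤ (σ false : ℝ) * w.2.1) ∧ w.2.2 ≤ 0}
  have ht : Convex ℝ t := by
    rintro w ⟨h1, h2, h3, h4, h5⟩ w' ⟨h1', h2', h3', h4', h5'⟩ a b ha hb -
    refine ⟨fun h => ?_, fun h => ?_, fun h => ?_, fun h => ?_, ?_⟩
    · simp [h1 h, h1' h]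
    · have := mul_nonneg ha (h2 h); have := mul_nonneg hb (h2' h)
      simp; linarith
    · simp [h3 h, h3' h]
    · have := mul_nonneg ha (h4 h); have := mul_nonneg hb (h4' h)
      simp; linarith
    · have := mul_nonneg ha (neg_nonneg.2 h5); have := mul_nonneg hb (neg_nonneg.2 h5')
      simp; linarith
  have htc : IsClosed t := by
    refine IsClosed.inter ?_ (IsClosed.inter ?_ (IsClosed.inter ?_ (IsClosed.inter ?_ ?_)))
    · exact isClosed_imp isOpen_const (isClosed_eq (by fun_prop) (by fun_prop))
    · exact isClosed_imp isOpen_const (isClosed_le (by fun_prop) (by fun_prop))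
    · exact isClosed_imp isOpen_const (isClosed_eq (by fun_prop) (by fun_prop))
    · exact isClosed_imp isOpen_const (isClosed_le (by fun_prop) (by fun_prop))
    · exact isClosed_le (f := fun w : ℝ × ℝ × ℝ => w.2.2) (g := fun _ => 0) (by fun_prop) (by fun_prop)
  have hd : Disjoint K t := by
    rw [disjoint_left]
    rintro w hw ⟨h1, h2, h3, h4, h5⟩
    exact (hdisj w hw h1 h2 h3 h4).not_ge h5
  obtain ⟨f, u, v, hfK, huv, hft⟩ := geometric_hahn_banach_compact_closed hKc hK ht htc hd
  have hf : ∀ w : ℝ × ℝ × ℝ, f w = f (1, 0, 0) * w.1 + f (0, 1, 0) * w.2.1 + f (0, 0, 1) * w.2.2 := by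
    intro w
    have : w = w.1 • ((1 : ℝ), (0 : ℝ), (0 : ℝ)) + w.2.1 • ((0 : ℝ), (1 : ℝ), (0 : ℝ)) +
        w.2.2 • ((0 : ℝ), (0 : ℝ), (1 : ℝ)) := by
      ext <;> simp
    conv_lhs => rw [this]
    simp only [map_add, map_smul, smul_eq_mul]
    ring
  -- A linear functional that is bounded below on a ray from 0 is nonnegative on it.
  have hcone : ∀ w, (∀ m : ℕ, (m : ℝ) • w ∈ t) → 0 ≤ f w := by
    intro w hw
    by_contra! hneg
    obtain ⟨m, hm⟩ := exists_nat_gt (v / f w)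
    have h1 := hft _ (hw m)
    rw [map_smul, smul_eq_mul] at h1
    rw [div_lt_iff_of_neg hneg] at hm
    linarith
  have h0 : v < 0 := by
    have := hft 0 (by simp [t])
    simpa using this
  have hs : ∀ ε : SignType, ε ≠ 0 → (ε : ℝ) * ε = 1 := fun ε => SignType.coe_mul_self
  have hf1 : σ true ≠ 0 → 0 ≤ (σ true : ℝ) * f (1, 0, 0) := fun h => by
    have := hcone ((σ true : ℝ), 0, 0) (fun m => by
      refine ⟨fun h' => absurd h' h, fun _ => ?_, by simp, by simp, by simp⟩
      simp only [Prod.smul_mk, smul_eq_mul]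
      rw [mul_left_comm, hs _ h]; simp)
    rw [hf] at this
    simpa [mul_comm] using this
  have hf2 : σ false ≠ 0 → 0 ≤ (σ false : ℝ) * f (0, 1, 0) := fun h => by
    have := hcone (0, (σ false : ℝ), 0) (fun m => by
      refine ⟨by simp, by simp, fun h' => absurd h' h, fun _ => ?_, by simp⟩
      simp only [Prod.smul_mk, smul_eq_mul]
      rw [mul_left_comm, hs _ h]; simp)
    rw [hf] at this
    simpa [mul_comm] using this
  have hf3 : f (0, 0, 1) ≤ 0 := by
    have := hcone (0, 0, -1) (fun m => by simp [t])
    rw [hf] at this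
    simpa using this
  obtain ⟨C, hC⟩ := hK.isBounded.exists_norm_le
  have hC' : ∀ w ∈ K, -w.2.2 ≤ |C| := fun w hw =>
    (neg_le_abs _).trans (((norm_snd_le w.2).trans (norm_snd_le w)).trans ((hC w hw).trans (le_abs_self C)))
  -- The coefficient `-f (0, 0, 1)` may be zero. Adding `θ` makes it positive at a cost of at most
  -- `-v / 2` on the bounded set `K`; the remaining half becomes the margin `δ`.
  let θ : ℝ := -v / (2 * (|C| + 1))
  have hθ : 0 < θ := by simp only [θ]; apply div_pos; linarith; positivity
  have hθC : θ * |C| ≤ -v / 2 := by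
    simp only [θ]
    rw [div_mul_eq_mul_div, div_le_iff₀ (by positivity)]
    nlinarith [abs_nonneg C]
  let μ : ℝ := -f (0, 0, 1) + θ
  have hμ : 0 < μ := by simp only [μ]; linarith
  refine ⟨fun b => if b then f (1, 0, 0) / μ else f (0, 1, 0) / μ, ?_, -v / (2 * μ), ?_, ?_⟩
  · intro b hb
    cases b
    · have := hf2 hb
      simp only [Bool.false_eq_true, if_false, mul_div_assoc']
      positivity
    · have := hf1 hb
      simp only [if_true, mul_div_assoc']
      positivity
  · apply div_pos; linarith; positivity
  · intro w hw
    have h1 := hfK w hw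
    rw [hf] at h1
    have h2 : θ * -w.2.2 ≤ -v / 2 := (mul_le_mul_of_nonneg_left (hC' w hw) hθ.le).trans hθC
    simp only [if_true, Bool.false_eq_true, if_false]
    rw [div_mul_eq_mul_div, div_mul_eq_mul_div, ← add_div, div_lt_iff₀ hμ, sub_mul]
    have h3 : -v / (2 * μ) * μ = -v / 2 := by field_simp
    rw [h3]
    simp only [μ]
    nlinarith

end EssentialVelocities

/-! ### From super-optimality to the essential Hamiltonian. -/

section Necessity

variable {d n : ℕ} {P : MultiDomain d} {S : ControlProblem d n} {T cl lam : ℝ} {x₀ : Vec d}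

/-- If a functional is bounded below by a positive constant on the essential controls at `x₀`, then it
dominates, on each open star near `x₀`, a linear form in the velocity having the signs of the star. -/
lemma MultiDomain.LocalChart.exists_linear_minorant (c : P.LocalChart x₀) (hF : S.HF P) (hL : S.HL P cl lam)
    (hG : S.HG cl lam) {q : Vec d} {τ : ℝ}
    (hpos : ∀ a ∈ S.AE P x₀, 0 < τ + inner ℝ q (S.f x₀ a) + S.ℓ x₀ a) (σ : Bool → SignType) :
    ∃ k : Bool → ℝ, (∀ b, σ b ≠ 0 → 0 ≤ (σ b : ℝ) * k b) ∧ ∃ δ > 0, ∀ᶠ z in 𝓝 x₀, z ∈ c.star σ →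
      ∀ a ∈ S.A, ∑ b, k b * inner ℝ (c.ν b) (S.f z a) + δ ≤ τ + inner ℝ q (S.f z a) + S.ℓ z a := by
  by_cases hσ : ∀ b, c.ν b = 0 → σ b = 0
  swap
  -- A nonzero sign along a zero normal makes the star empty.
  · push Not at hσ
    obtain ⟨b, hb, hσb⟩ := hσ
    refine ⟨0, by simp, 1, one_pos, Eventually.of_forall fun z hz => ?_⟩
    have := hz b hσb
    rw [hb, inner_zero_left, sign_zero] at this
    exact absurd this.symm hσb
  let Λ : Vec d × ℝ → ℝ × ℝ × ℝ := fun w =>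
    (inner ℝ (c.ν true) w.1, inner ℝ (c.ν false) w.1, τ + inner ℝ q w.1 - w.2)
  let C : Set (Vec d × ℝ) := S.G cl lam x₀ ∩ Prod.fst ⁻¹' contExt S.F (c.M σ) x₀
  have hΛ : Continuous Λ := by fun_prop
  have hC : IsCompact C := (hG.isCompact x₀).inter_right ((isClosed_contExt _ _ _).preimage continuous_fst)
  have hCc : Convex ℝ C := (hG.convex x₀).inter
    ((c.convex_contExt hF hL hG hσ).linear_preimage (LinearMap.fst ℝ (Vec d) ℝ))
  have hΛc : Convex ℝ (Λ '' C) := by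
    rintro _ ⟨w, hw, rfl⟩ _ ⟨w', hw', rfl⟩ a b ha hb hab
    refine ⟨_, hCc hw hw' ha hb hab, ?_⟩
    ext
    · simp [Λ, inner_add_right, real_inner_smul_right]
    · simp [Λ, inner_add_right, real_inner_smul_right]
    · simp only [Λ, Prod.fst_add, Prod.smul_fst, inner_add_right, real_inner_smul_right, Prod.snd_add,
        Prod.smul_snd, smul_eq_mul]
      linear_combination (-τ) * hab
  -- A point of `C` with normal components in the closed orthant of `σ` comes from an essential
  -- control, so `hpos` applies; the slack `r` only increases the third coordinate.
  obtain ⟨k, hk, δ, hδ, hkδ⟩ := exists_orthant_separation (hC.image hΛ) hΛc σ (by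
    rintro _ ⟨w, ⟨⟨a, ha, r, hr, -, rfl⟩, hwE⟩, rfl⟩ h1 h2 h3 h4
    have ht : S.f x₀ a ∈ tangentConeOf (closure (c.M σ)) x₀ := by
      refine c.mem_tangentConeOf fun b _ => ?_
      cases b
      · exact ⟨h3, h4⟩
      · exact ⟨h1, h2⟩
    have := hpos a ⟨ha, _, c.subdomain σ, c.mem_closure σ, hwE, ht⟩
    simp only [Λ]
    linarith)
  refine ⟨k, hk, δ, hδ, ?_⟩
  -- Otherwise augmented velocities at points of the star tending to `x₀` would accumulate at a
  -- point of `C` that violates the strict separation.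
  by_contra hcon
  obtain ⟨z, hz, hzc⟩ := exists_seq_forall_of_frequently (not_eventually.1 hcon)
  push Not at hzc
  choose hzs a ha hlt using hzc
  have hev : ∀ m : ℕ, ∃ N : ℕ, ∃ g ∈ S.G cl lam x₀,
      dist (S.augVelocity (z N) (a N)) g < 1 / ((m : ℝ) + 1) ∧ dist (z N) x₀ < 1 / ((m : ℝ) + 1) := by
    intro m
    have hm : 0 < 1 / ((m : ℝ) + 1) := by positivity
    obtain ⟨r, hr, hrG⟩ := hG.exists_thickening x₀ hm
    obtain ⟨N, hN, hN'⟩ := ((Metric.tendsto_nhds.1 hz r hr).and (Metric.tendsto_nhds.1 hz _ hm)).exists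
    obtain ⟨g, hg, hgd⟩ := Metric.mem_thickening_iff.1 (hrG _ hN (hL.augVelocity_mem (ha N)))
    exact ⟨N, g, hg, hgd, hN'⟩
  choose N g hg hgd hzd using hev
  obtain ⟨g₀, hg₀, s, hs, hlim⟩ := (hG.isCompact x₀).tendsto_subseq hg
  have hone := tendsto_one_div_add_atTop_nhds_zero_nat (𝕜 := ℝ)
  have hv : Tendsto (fun m => S.augVelocity (z (N (s m))) (a (N (s m)))) atTop (𝓝 g₀) :=
    (tendsto_iff_of_dist ((squeeze_zero (fun _ => dist_nonneg) (fun m => (hgd m).le) hone).comp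
      hs.tendsto_atTop)).2 hlim
  have hz' : Tendsto (fun m => z (N (s m))) atTop (𝓝 x₀) := by
    refine Tendsto.comp (g := fun m => z (N m)) ?_ hs.tendsto_atTop
    exact tendsto_iff_dist_tendsto_zero.2 (squeeze_zero (fun _ => dist_nonneg) (fun m => (hzd m).le) hone)
  have hg₀C : g₀ ∈ C := ⟨hg₀, c.mem_contExt_of_tendsto hF (fun m => hzs _)
    (fun m => mem_image_of_mem _ (ha (N (s m)))) hz' ((continuous_fst.tendsto g₀).comp hv)⟩
  have h1 := hkδ _ (mem_image_of_mem Λ hg₀C)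
  have h2 := (hΛ.tendsto g₀).comp hv
  have hcont : Continuous fun w : ℝ × ℝ × ℝ => k true * w.1 + k false * w.2.1 - (w.2.2 - δ) := by fun_prop
  have h3 := (hcont.tendsto _).comp h2
  have h4 := ge_of_tendsto' (b := 0) h3 fun m => by
    have := hlt (N (s m))
    simp only [Fintype.sum_bool] at this
    simp only [Function.comp_apply, Λ, ControlProblem.augVelocity]
    linarith
  linarith

lemma inner_integral_le_of_ae_le {s t κ : ℝ} (hst : s ≤ t) {v : ℝ → Vec d} {j : ℝ → ℝ} {w : Vec d}
    (hv : IntervalIntegrable v volume s t) (hj : IntervalIntegrable j volume s t)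
    (h : ∀ᵐ r ∂volume.restrict (Ioo s t), inner ℝ w (v r) ≤ κ + j r) :
    inner ℝ w (∫ r in s..t, v r) ≤ κ * (t - s) + ∫ r in s..t, j r := by
  have h1 : inner ℝ w (∫ r in s..t, v r) = ∫ r in s..t, inner ℝ w (v r) :=
    ((innerSL ℝ w).intervalIntegral_comp_comm hv).symm
  have h2 : κ * (t - s) + ∫ r in s..t, j r = ∫ r in s..t, (κ + j r) := by
    rw [intervalIntegral.integral_add intervalIntegrable_const hj, intervalIntegral.integral_const, smul_eq_mul,
      mul_comm]
  rw [h1, h2]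
  have hvw : IntervalIntegrable (fun r => inner ℝ w (v r)) volume s t :=
    ⟨(innerSL ℝ w).integrable_comp hv.1, (innerSL ℝ w).integrable_comp hv.2⟩
  refine intervalIntegral.integral_mono_ae_restrict hst hvw (intervalIntegrable_const.add hj) ?_
  rwa [← restrict_Ioo_eq_restrict_Icc]

/-- The partial derivatives at a point of differentiability. -/
lemma hasFDerivAt_apply_eq_deriv_add_inner_gradient {φ : ℝ × Vec d → ℝ} {t₀ : ℝ} {φ' : ℝ × Vec d →L[ℝ] ℝ}
    (h : HasFDerivAt φ φ' (t₀, x₀)) (s : ℝ) (v : Vec d) :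
    φ' (s, v) = deriv (fun t => φ (t, x₀)) t₀ * s + inner ℝ (gradient (fun x => φ (t₀, x)) x₀) v := by
  have h1 : HasDerivAt (fun t => φ (t, x₀)) (φ' (1, 0)) t₀ :=
    HasFDerivAt.comp_hasDerivAt t₀ h ((hasDerivAt_id t₀).prodMk (hasDerivAt_const t₀ x₀))
  have h2 : HasFDerivAt (fun x => φ (t₀, x)) (φ'.comp (ContinuousLinearMap.inr ℝ ℝ (Vec d))) x₀ :=
    HasFDerivAt.comp x₀ h (hasFDerivAt_prodMk_right t₀ x₀)
  rw [h1.deriv, gradient, h2.fderiv, InnerProductSpace.toDual_symm_apply]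
  have : ((s, v) : ℝ × Vec d) = s • ((1 : ℝ), (0 : Vec d)) + (0, v) := by simp
  rw [this, map_add, map_smul, smul_eq_mul, mul_comm]
  rfl

lemma isSupersolution_HamE_of_superOptimal (hP : P.H1) (hF : S.HF P) (hL : S.HL P cl lam) (hG : S.HG cl lam)
    {u : ℝ → Vec d → ℝ} (hu : LowerSemicontinuousOn (fun z : ℝ × Vec d => u z.1 z.2) (Ioc 0 T ×ˢ univ))
    (hsup : S.SuperOptimal T (Ioc 0 T) u) : IsSupersolution T (S.HamE P) u := by
  refine ⟨hu, fun t₀ ht₀ x₀ φ hφ hmin => ?_⟩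
  set τ : ℝ := deriv (fun t => φ (t, x₀)) t₀
  set q : Vec d := gradient (fun x => φ (t₀, x)) x₀
  by_contra hneg
  have hHam : S.HamE P x₀ q < (τ : EReal) := by
    by_contra! hle
    refine hneg ?_
    have h0 : (0 : EReal) = ((-τ : ℝ) : EReal) + (τ : EReal) := by
      rw [← EReal.coe_add, neg_add_cancel, EReal.coe_zero]
    rw [h0]
    gcongr
  have hpos : ∀ a ∈ S.AE P x₀, 0 < τ + inner ℝ q (S.f x₀ a) + S.ℓ x₀ a := by
    intro a ha
    have h1 : ((-inner ℝ q (S.f x₀ a) - S.ℓ x₀ a : ℝ) : EReal) ≤ S.HamE P x₀ q :=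
      le_iSup₂ (f := fun a (_ : a ∈ S.AE P x₀) => ((-inner ℝ q (S.f x₀ a) - S.ℓ x₀ a : ℝ) : EReal)) a ha
    have h2 := EReal.coe_lt_coe_iff.1 (h1.trans_lt hHam)
    linarith
  obtain ⟨c⟩ := hP.exists_localChart x₀
  choose k hk δ' hδ' hkδ using c.exists_linear_minorant hF hL hG hpos
  -- One margin for the finitely many patterns.
  obtain ⟨δ, hδδ, hδ⟩ : ∃ δ, (∀ σ, δ ≤ δ' σ) ∧ 0 < δ :=
    ((eventually_all.2 fun σ => (Ioc_mem_nhdsGT (hδ' σ) : ∀ᶠ δ in 𝓝[>] 0, δ ∈ Ioc 0 (δ' σ))).mono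
      fun δ h => (⟨fun σ => (h σ).2, (h 0).1⟩ : (∀ σ, δ ≤ δ' σ) ∧ 0 < δ)).exists
  obtain ⟨y, α, ⟨⟨-, hαA⟩, hfi, hy⟩, hℓi, hopt⟩ := hsup t₀ ⟨ht₀.1, ht₀.2.le⟩ x₀
  obtain ⟨cf, hcf, hgrow⟩ := hF.growth
  set v : ℝ → Vec d := fun s => S.f (y s) (α s) with hv
  set j : ℝ → ℝ := fun s => S.ℓ (y s) (α s) with hj
  let C : ℝ := cf * (2 + ‖x₀‖)
  have hC : 0 < C := by positivity
  have hmem : ((t₀, x₀) : ℝ × Vec d) ∈ Ioo 0 T ×ˢ (univ : Set (Vec d)) := ⟨ht₀, mem_univ _⟩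
  have hder := ((hφ.contDiffAt ((isOpen_Ioo.prod isOpen_univ).mem_nhds hmem)).differentiableAt
    one_ne_zero).hasFDerivAt
  -- `C` bounds the speed while the trajectory is within distance 1 of `x₀`; with this tolerance the
  -- first-order error of `φ` along it is at most `δ * h / 2`.
  have hε : 0 < δ / (2 * (1 + C)) := by positivity
  have hsub : ∀ s ∈ Icc 0 (T - t₀), ∀ t ∈ Icc 0 (T - t₀), uIcc (t₀ + s) (t₀ + t) ⊆ uIcc t₀ T := by
    intro s hs t ht
    rw [uIcc_of_le ht₀.2.le]
    exact (convex_Icc t₀ T).ordConnected.uIcc_subset ⟨by linarith [hs.1], by linarith [hs.2]⟩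
      ⟨by linarith [ht.1], by linarith [ht.2]⟩
  have hy' : ∀ h ∈ Icc 0 (T - t₀), y (t₀ + h) = x₀ + ∫ r in t₀..(t₀ + h), v r := fun h hh =>
    hy _ ⟨by linarith [hh.1], by linarith [hh.2]⟩
  have h0T : (0 : ℝ) ∈ Icc 0 (T - t₀) := ⟨le_rfl, by linarith [ht₀.2]⟩
  have hy0 : y (t₀ + 0) = x₀ := by rw [hy' 0 h0T]; simp
  have hprim : ∀ {E : Type} [NormedAddCommGroup E] [NormedSpace ℝ E] {w : ℝ → E},
      IntervalIntegrable w volume t₀ T → ContinuousOn (fun h => ∫ r in t₀..(t₀ + h), w r) (Icc 0 (T - t₀)) := by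
    intro E _ _ w hw
    refine (intervalIntegral.continuousOn_primitive_interval' hw left_mem_uIcc).comp (by fun_prop) fun h hh => ?_
    rw [uIcc_of_le ht₀.2.le]
    exact ⟨by linarith [hh.1], by linarith [hh.2]⟩
  have hyc : ContinuousOn (fun h => y (t₀ + h)) (Icc 0 (T - t₀)) :=
    (continuousOn_const.add (hprim hfi)).congr hy'
  have hlim : Tendsto (fun h : ℝ => ((t₀ + h, y (t₀ + h)) : ℝ × Vec d)) (𝓝[≥] 0) (𝓝 (t₀, x₀)) := by
    have h1 : ContinuousWithinAt (fun h : ℝ => ((t₀ + h, y (t₀ + h)) : ℝ × Vec d)) (Icc 0 (T - t₀)) 0 :=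
      (by fun_prop : ContinuousOn (fun h : ℝ => t₀ + h) _).prodMk hyc 0 h0T
    have h2 := h1.tendsto
    rw [hy0, add_zero, nhdsWithin_Icc_eq_nhdsGE (by linarith [ht₀.2])] at h2
    exact h2
  have hsnd : Tendsto (Prod.snd : ℝ × Vec d → Vec d) (𝓝 (t₀, x₀)) (𝓝 x₀) := continuous_snd.tendsto _
  have hev := hlim.eventually (hmin.and ((hder.isLittleO.def hε).and
    ((hsnd.eventually (eventually_all.2 hkδ)).and (hsnd.eventually (Metric.ball_mem_nhds x₀ one_pos)))))
  obtain ⟨h₁, hh₁, hh₁ev⟩ := (mem_nhdsGE_iff_exists_Icc_subset (a := (0 : ℝ))).1 hev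
  have hh₁ : 0 < h₁ := hh₁
  obtain ⟨h₀, hh₀, hh₀₁, hh₀T⟩ : ∃ h₀, 0 < h₀ ∧ h₀ ≤ h₁ ∧ h₀ ≤ T - t₀ :=
    ⟨min h₁ (T - t₀), lt_min hh₁ (by linarith [ht₀.2]), min_le_left _ _, min_le_right _ _⟩
  have hsubT : Icc 0 h₀ ⊆ Icc 0 (T - t₀) := Icc_subset_Icc_right hh₀T
  have hev' : ∀ h ∈ Icc 0 h₀, _ := fun h hh => hh₁ev ⟨hh.1, hh.2.trans hh₀₁⟩
  have hbound : ∀ h ∈ Icc 0 h₀, ‖y (t₀ + h) - x₀‖ ≤ C * h := by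
    intro h hh
    rw [hy' h (hsubT hh), add_sub_cancel_left]
    refine (intervalIntegral.norm_integral_le_of_norm_le_const_ae (C := C) ?_).trans_eq ?_
    swap
    · rw [add_sub_cancel_left, abs_of_nonneg hh.1]
    have hαA' := (ae_restrict_iff' measurableSet_Ioo).1 hαA
    -- The constraint on `α` is known only on the open interval `(0, T)`.
    have hne : ∀ᵐ r : ℝ, r ≠ T := Measure.ae_ne volume T
    filter_upwards [hαA', hne] with r hr hrT hrI
    rw [uIoc_of_le (by linarith [hh.1])] at hrI
    have hrr : r - t₀ ∈ Icc 0 h₀ := ⟨by linarith [hrI.1], by linarith [hrI.2, hh.2]⟩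
    have hb := (hev' _ hrr).2.2.2
    rw [add_sub_cancel, dist_eq_norm] at hb
    have h1 := hgrow (y r) _ (mem_image_of_mem _ (hr ⟨by linarith [hrI.1, ht₀.1],
      lt_of_le_of_ne (by linarith [hrI.2, hh.2]) hrT⟩))
    have h2 : ‖y r‖ ≤ ‖x₀‖ + 1 := by
      have := norm_le_norm_add_norm_sub x₀ (y r)
      rw [norm_sub_rev] at this
      linarith
    exact h1.trans (mul_le_mul_of_nonneg_left (by linarith) hcf.le)
  -- Super-optimality and the local minimum bound the first three terms by the first-order error `δ
  -- * h / 2`, so subtracting `δ * h` makes `Ψ` negative at positive times.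
  let Ψ : ℝ → ℝ := fun h => τ * h + inner ℝ q (y (t₀ + h) - x₀) + (∫ r in t₀..(t₀ + h), j r) - δ * h
  have hinner : ∀ w : Vec d, ContinuousOn (fun h => inner ℝ w (y (t₀ + h) - x₀)) (Icc 0 h₀) := fun w =>
    (innerSL ℝ w).continuous.comp_continuousOn ((hyc.mono hsubT).sub continuousOn_const)
  refine sign_pattern_increments_contradiction (y := fun b h => inner ℝ (c.ν b) (y (t₀ + h) - x₀)) (Ψ := Ψ)
    hh₀ (fun b => ?_) ?_ (fun b => ?_) ?_ ?_ hk ?_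
  · exact hinner (c.ν b)
  · exact (((by fun_prop : ContinuousOn (fun h => τ * h) _).add (hinner q)).add ((hprim hℓi).mono hsubT)).sub
      (by fun_prop)
  · rw [hy0, sub_self, inner_zero_right]
  · simp only [Ψ, hy0]; simp
  · intro s hs
    have hs' : s ∈ Icc 0 h₀ := ⟨hs.1.le, hs.2⟩
    obtain ⟨h1, h2, -, -⟩ := hev' s hs'
    have h3 := hopt s (hsubT hs')
    have h4 := hbound s hs'
    simp only at h1
    rw [Prod.mk_sub_mk, add_sub_cancel_left, hasFDerivAt_apply_eq_deriv_add_inner_gradient hder, Real.norm_eq_abs] at h2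
    have h5 : ‖((s, y (t₀ + s) - x₀) : ℝ × Vec d)‖ ≤ (1 + C) * s := by
      rw [Prod.norm_mk, Real.norm_of_nonneg hs'.1]
      refine max_le ?_ ?_ <;> nlinarith [hs.1]
    have h6 := (le_abs_self _).trans (h2.trans (mul_le_mul_of_nonneg_left h5 hε.le))
    have h6' := (neg_le_abs _).trans (h2.trans (mul_le_mul_of_nonneg_left h5 hε.le))
    have h7 : δ / (2 * (1 + C)) * ((1 + C) * s) = δ * s / 2 := by field_simp
    rw [h7] at h6 h6'
    have h8 : 0 < δ * s := mul_pos hδ hs.1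
    simp only [Ψ]
    linarith
  · intro σ s t hs hst ht hσ
    have hsI : s ∈ Icc 0 (T - t₀) := ⟨hs, by linarith⟩
    have htI : t ∈ Icc 0 (T - t₀) := ⟨by linarith, by linarith⟩
    have hvi := hfi.mono_set (hsub s hsI t htI)
    have hji := hℓi.mono_set (hsub s hsI t htI)
    have e1 : y (t₀ + t) - y (t₀ + s) = ∫ r in (t₀ + s)..(t₀ + t), v r := by
      rw [hy' t htI, hy' s hsI, add_sub_add_left_eq_sub, intervalIntegral.integral_interval_sub_left]
      · exact hfi.mono_set (by simpa using hsub 0 h0T t htI)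
      · exact hfi.mono_set (by simpa using hsub 0 h0T s hsI)
    have e2 : (∫ r in t₀..(t₀ + t), j r) - (∫ r in t₀..(t₀ + s), j r) = ∫ r in (t₀ + s)..(t₀ + t), j r := by
      rw [intervalIntegral.integral_interval_sub_left]
      · exact hℓi.mono_set (by simpa using hsub 0 h0T t htI)
      · exact hℓi.mono_set (by simpa using hsub 0 h0T s hsI)
    -- On this interval the trajectory lies in the star of `σ`, so the minorant for `σ`, with `δ`
    -- and the `q` term moved to the other side, can be integrated.
    have hmain := inner_integral_le_of_ae_le (w := ∑ b, k σ b • c.ν b - q) (κ := τ - δ)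
      (by linarith : t₀ + s ≤ t₀ + t) hvi hji (by
        have hsubset : Ioo (t₀ + s) (t₀ + t) ⊆ Ioo 0 T := Ioo_subset_Ioo (by linarith [ht₀.1]) (by linarith [htI.2])
        filter_upwards [ae_restrict_of_ae_restrict_of_subset hsubset hαA, ae_restrict_mem measurableSet_Ioo]
          with r hr hrI
        have hrr : r - t₀ ∈ Icc 0 h₀ := ⟨by linarith [hrI.1], by linarith [hrI.2]⟩
        have h1 := (hev' _ hrr).2.2.1 σ
        have h2 := hσ (r - t₀) ⟨by linarith [hrI.1], by linarith [hrI.2]⟩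
        rw [add_sub_cancel] at h1
        simp only [add_sub_cancel] at h2
        have h3 := h1 h2 (α r) hr
        rw [inner_sub_left, sum_inner]
        simp only [real_inner_smul_left]
        have := hδδ σ
        simp only [hv, hj]
        linarith)
    rw [← e1, ← e2, inner_sub_left, sum_inner] at hmain
    simp only [real_inner_smul_left] at hmain
    have e3 : ∀ w : Vec d, inner ℝ w (y (t₀ + t) - x₀) - inner ℝ w (y (t₀ + s) - x₀)
        = inner ℝ w (y (t₀ + t) - y (t₀ + s)) := by
      intro w
      rw [← inner_sub_right, sub_sub_sub_cancel_right]
    simp only [e3, Ψ]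
    have := e3 q
    linarith

end Necessity

theorem mainTheorem5 {d n : ℕ} (P : MultiDomain d) (S : ControlProblem d n)
    (T cl lam : ℝ) (hT : 0 < T)
    (hP : P.H1) (hS : S.Regular) (hF : S.HF P) (hL : S.HL P cl lam) (hG : S.HG cl lam)
    (u : ℝ → Vec d → ℝ)
    (hu : LowerSemicontinuousOn (fun z : ℝ × Vec d => u z.1 z.2) (Ioc 0 T ×ˢ univ)) :
    (S.SuperOptimal T (Ioc 0 T) u ↔ IsSupersolution T (S.HamE P) u) ∧
    (IsSupersolution T (S.HamE P) u ↔ IsSupersolution T S.HamF u) ∧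
    (InitialTimeRegular u →
      (S.SuperOptimal T (Icc 0 T) u ↔ IsSupersolution T (S.HamE P) u)) := by
  have h12 : S.SuperOptimal T (Ioc 0 T) u → IsSupersolution T (S.HamE P) u :=
    isSupersolution_HamE_of_superOptimal hP hF hL hG hu
  have h23 : IsSupersolution T (S.HamE P) u → IsSupersolution T S.HamF u := fun h =>
    h.mono fun x p => ControlProblem.HamE_le_HamF x p
  have h31 : IsSupersolution T S.HamF u → S.SuperOptimal T (Ioc 0 T) u :=
    superOptimal_Ioc_of_isSupersolution hS hF hL hG
  exact ⟨⟨h12, h31 ∘ h23⟩, ⟨h23, h12 ∘ h31⟩, fun hinit =>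
    ⟨fun h => h12 (h.mono Ioc_subset_Icc_self), fun h => superOptimal_Icc_of_isSupersolution hT hS hF hL hG (h23 h) hinit⟩⟩
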